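/- All forms are non-degenerate symmetric bilinear forms on finite-dimensional vector spaces, and $\langle a\rangle$ denotes the rank one form $(x,y)\mapsto axy$. For a field $F$ let $W(F)$ be the Witt group of $F$, i.e. the set of forms over $F$ modulo the relation $B_1\sim B_2$ iff $B_1\oplus M_1\cong B_2\oplus M_2$ for some metabolic forms $M_1,M_2$ (a form of rank $2k$ is metabolic if it has a totally isotropic subspace of dimension $k$), with addition induced by $\oplus$; write $[B]$ for the class of $B$ and $[a]$ for the class of $\langle a\rangle$. For a prime $p$ let $\partial_p:W(\mathbb Q)\to W(\mathbb F_p)$ be the composition of $W(\mathbb Q)\to W(\mathbb Q_p)$ with the second residue homomorphism $W(\mathbb Q_p)\to W(\mathbb F_p)$, the additive map with $[u]\mapsto 0$ and $[pu]\mapsto[\bar u]$ for all $u\in\mathbb Z_p^\ast$, and let $\partial=\oplus_p\partial_p:W(\mathbb Q)\to\bigoplus_p W(\mathbb F_p)$. The Witt span of $[B]\in W(\mathbb Q)$ is $ws([B])=\min\{\operatorname{rank}B' \mid \partial[B']=\partial[B]\}$. Let $B$ be a form over $\mathbb Q$. For $r=1,2,3$ let $\mathcal I_r$ be the set of signatures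 of the anisotropic forms of rank $r$ over $\mathbb Q$ whose Witt class lies in $\partial^{-1}(\partial[B])$, and for $i\in\mathcal I_r$ let $B_i$ denote such a form (of rank $r$) with signature $i$. Then: (i) $ws([B])=0$ if and only if $\partial[B]=0$. (ii) $ws([B])=1$ if and only if $\mathcal I_1\neq\emptyset$ and $\partial[B]\neq 0$. (iii) $ws([B])=2$ if and only if $\mathcal I_2\ne\emptyset$ and for each $i\in\mathcal I_2$ the forms $B_i\oplus\langle 1\rangle$ and $B_i\oplus\langle -1\rangle$ are anisotropic. The set $\mathcal I_2$ is always a subset of $\{0,\pm2\}$, and for every non-empty subset $S$ of $\{0,\pm 2\}$ there is a form $B$ over $\mathbb Q$ with $ws([B])=2$ and $\mathcal I_2=S$. (iv) $ws([B])=3$ if and only if $\mathcal I_3=\{\pm1,\pm3\}$ and for each $i\in\mathcal I_3$ the forms $B_i\oplus\langle 1\rangle$ and $B_i\oplus\langle -1\rangle$ are anisotropic. -/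

import Mathlib

open scoped TensorProduct DirectSum

noncomputable section

/-- A non-degenerate symmetric bilinear form `(V, B)` on a finite-dimensional vector space. -/
structure SymForm (F : Type) [Field F] where
  V : Type
  [grp : AddCommGroup V]
  [mod : Module F V]
  [fin : FiniteDimensional F V]
  form : LinearMap.BilinForm F V
  symm : form.IsSymm
  nondeg : form.Nondegenerate

attribute [instance] SymForm.grp SymForm.mod SymForm.fin

namespace SymForm

variable {F : Type} [Field F]

theorem nondeg_of_symm {V : Type} [AddCommGroup V] [Module F V] {B : LinearMap.BilinForm F V}
    (hs : B.IsSymm) (h : ∀ x, (∀ y, B x y = 0) → x = 0) : B.Nondegenerate := by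
  refine ⟨h, fun y hy => h y fun x => ?_⟩
  rw [hs.eq]; exact hy x

/-- The rank of a non-degenerate form is the dimension of the underlying space. -/
def rank (B : SymForm F) : ℕ := Module.finrank F B.V

/-- Isomorphism of forms. -/
def Iso (B₁ B₂ : SymForm F) : Prop := B₁.form.Equivalent B₂.form

/-- `B` is anisotropic: no nonzero vector `x` has `B(x, x) = 0`. -/
def Anisotropic (B : SymForm F) : Prop := ∀ x : B.V, B.form x x = 0 → x = 0

/-- `B` is metabolic: it has even rank `2k` and a totally isotropic subspace of dimension `k`. -/
def Metabolic (B : SymForm F) : Prop :=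
  ∃ (k : ℕ) (W : Submodule F B.V), B.rank = 2 * k ∧ Module.finrank F W = k ∧
    ∀ x ∈ W, ∀ y ∈ W, B.form x y = 0

/-- The bilinear form `(B₁ ⊕ B₂)((x₁, x₂), (y₁, y₂)) = B₁(x₁, y₁) + B₂(x₂, y₂)`. -/
def sumForm {V₁ V₂ : Type} [AddCommGroup V₁] [Module F V₁] [AddCommGroup V₂] [Module F V₂]
    (B₁ : LinearMap.BilinForm F V₁) (B₂ : LinearMap.BilinForm F V₂) :
    LinearMap.BilinForm F (V₁ × V₂) :=
  B₁.comp (LinearMap.fst F V₁ V₂) (LinearMap.fst F V₁ V₂) +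
    B₂.comp (LinearMap.snd F V₁ V₂) (LinearMap.snd F V₁ V₂)

@[simp]
theorem sumForm_apply {V₁ V₂ : Type} [AddCommGroup V₁] [Module F V₁] [AddCommGroup V₂]
    [Module F V₂] (B₁ : LinearMap.BilinForm F V₁) (B₂ : LinearMap.BilinForm F V₂)
    (x y : V₁ × V₂) : sumForm B₁ B₂ x y = B₁ x.1 y.1 + B₂ x.2 y.2 := rfl

theorem sumForm_symm (B₁ B₂ : SymForm F) : (sumForm B₁.form B₂.form).IsSymm :=
  ⟨fun x y => by simp [B₁.symm.eq x.1 y.1, B₂.symm.eq x.2 y.2]⟩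

/-- The orthogonal sum of two forms. -/
def sum (B₁ B₂ : SymForm F) : SymForm F where
  V := B₁.V × B₂.V
  form := sumForm B₁.form B₂.form
  symm := sumForm_symm B₁ B₂
  nondeg := nondeg_of_symm (sumForm_symm B₁ B₂) fun x h => Prod.ext
    (B₁.nondeg.1 _ fun y => by simpa using h (y, 0))
    (B₂.nondeg.1 _ fun y => by simpa using h (0, y))

/-- The form `-B`. -/
def neg (B : SymForm F) : SymForm F where
  V := B.V
  form := -B.form
  symm := ⟨fun x y => by simp [B.symm.eq x y]⟩
  nondeg := nondeg_of_symm ⟨fun x y => by simp [B.symm.eq x y]⟩ fun x h =>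
    B.nondeg.1 _ fun y => by simpa using h y

/-- The form on the zero space. -/
def zero : SymForm F where
  V := PUnit
  form := 0
  symm := ⟨fun _ _ => rfl⟩
  nondeg := nondeg_of_symm ⟨fun _ _ => rfl⟩ fun _ _ => rfl

/-- The rank one form `⟨a⟩(x, y) = a x y`. -/
def unary (a : Fˣ) : SymForm F where
  V := F
  form := (a : F) • LinearMap.mul F F
  symm := ⟨fun x y => by simp [mul_comm x y]⟩
  nondeg := nondeg_of_symm ⟨fun x y => by simp [mul_comm x y]⟩ fun x h => by
    simpa using h 1

theorem Iso.refl (B : SymForm F) : Iso B B := LinearMap.BilinForm.Equivalent.refl _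

theorem Iso.symm {B₁ B₂ : SymForm F} (h : Iso B₁ B₂) : Iso B₂ B₁ :=
  LinearMap.BilinForm.Equivalent.symm h

theorem Iso.trans {B₁ B₂ B₃ : SymForm F} (h : Iso B₁ B₂) (h' : Iso B₂ B₃) : Iso B₁ B₃ :=
  LinearMap.BilinForm.Equivalent.trans h h'

theorem Iso.of {B₁ B₂ : SymForm F} (e : B₁.V ≃ₗ[F] B₂.V)
    (h : ∀ x y, B₂.form (e x) (e y) = B₁.form x y) : Iso B₁ B₂ := ⟨{ e with map_app' := h }⟩

theorem Iso.exists {B₁ B₂ : SymForm F} (h : Iso B₁ B₂) :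
    ∃ e : B₁.V ≃ₗ[F] B₂.V, ∀ x y, B₂.form (e x) (e y) = B₁.form x y := by
  obtain ⟨f⟩ := h
  exact ⟨f.toLinearEquiv, f.map_app'⟩

theorem Iso.sum {A A' B B' : SymForm F} (h : Iso A A') (h' : Iso B B') :
    Iso (A.sum B) (A'.sum B') := by
  obtain ⟨e, he⟩ := h.exists
  obtain ⟨f, hf⟩ := h'.exists
  exact Iso.of (B₁ := A.sum B) (B₂ := A'.sum B') (e.prodCongr f)
    fun x y => congrArg₂ (· + ·) (he x.1 y.1) (hf x.2 y.2)

theorem sum_comm_iso (A B : SymForm F) : Iso (A.sum B) (B.sum A) :=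
  Iso.of (B₁ := A.sum B) (B₂ := B.sum A) (LinearEquiv.prodComm F A.V B.V)
    fun _ _ => add_comm _ _

theorem sum_assoc_iso (A B C : SymForm F) : Iso ((A.sum B).sum C) (A.sum (B.sum C)) :=
  Iso.of (B₁ := (A.sum B).sum C) (B₂ := A.sum (B.sum C)) (LinearEquiv.prodAssoc F A.V B.V C.V)
    fun _ _ => (add_assoc _ _ _).symm

theorem zero_sum_iso (A : SymForm F) : Iso ((zero : SymForm F).sum A) A :=
  Iso.of (B₁ := (zero : SymForm F).sum A) (B₂ := A) 
    (LinearEquiv.uniqueProd (R := F) (M := A.V) (M₂ := PUnit))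
    fun _ _ => (zero_add _).symm

theorem sum_sum_sum_comm_iso (A B C D : SymForm F) :
    Iso ((A.sum B).sum (C.sum D)) ((A.sum C).sum (B.sum D)) :=
  Iso.of (B₁ := (A.sum B).sum (C.sum D)) (B₂ := (A.sum C).sum (B.sum D))
    (LinearEquiv.prodProdProdComm F A.V B.V C.V D.V) fun _ _ => add_add_add_comm _ _ _ _

theorem metabolic_zero : (zero : SymForm F).Metabolic :=
  ⟨0, ⊥, Module.finrank_zero_of_subsingleton (M := PUnit), finrank_bot _ _, fun _ _ _ _ => rfl⟩

theorem Metabolic.sum {A B : SymForm F} (hA : A.Metabolic) (hB : B.Metabolic) :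
    (A.sum B).Metabolic := by
  obtain ⟨k, W, h1, h2, h3⟩ := hA
  obtain ⟨k', W', h1', h2', h3'⟩ := hB
  refine ⟨k + k', W.prod W', ?_, ?_, fun x hx y hy => ?_⟩
  · have : (A.sum B).rank = A.rank + B.rank := Module.finrank_prod (R := F) (M := A.V) (M' := B.V)
    omega
  · rw [← h2, ← h2', ← Module.finrank_prod, ← LinearMap.finrank_range_of_inj
      (f := W.subtype.prodMap W'.subtype)
      (Prod.map_injective.2 ⟨W.injective_subtype, W'.injective_subtype⟩)]
    rw [LinearMap.range_prodMap, Submodule.range_subtype, Submodule.range_subtype]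
    rfl
  · exact (congrArg₂ (· + ·) (h3 _ hx.1 _ hy.1) (h3' _ hx.2 _ hy.2)).trans (add_zero _)

theorem metabolic_sum_neg (A : SymForm F) : (A.sum A.neg).Metabolic := by
  refine ⟨A.rank, LinearMap.range (LinearMap.prod (LinearMap.id : A.V →ₗ[F] A.V) LinearMap.id),
    ?_, ?_, ?_⟩
  · have : (A.sum A.neg).rank = A.rank + A.rank :=
      Module.finrank_prod (R := F) (M := A.V) (M' := A.V)
    omega
  · refine LinearMap.finrank_range_of_inj fun x y h => ?_
    exact congrArg Prod.fst h
  · rintro _ ⟨x, rfl⟩ _ ⟨y, rfl⟩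
    exact add_neg_cancel (A.form x y)

/-- Witt equivalence: the forms become isomorphic after adding metabolic forms. -/
def WittEquiv (B₁ B₂ : SymForm F) : Prop :=
  ∃ M₁ M₂ : SymForm F, M₁.Metabolic ∧ M₂.Metabolic ∧ Iso (B₁.sum M₁) (B₂.sum M₂)

theorem Iso.wittEquiv {A B : SymForm F} (h : Iso A B) : WittEquiv A B :=
  ⟨zero, zero, metabolic_zero, metabolic_zero, h.sum (Iso.refl _)⟩

theorem WittEquiv.trans {A B C : SymForm F} (h : WittEquiv A B) (h' : WittEquiv B C) :
    WittEquiv A C := by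
  obtain ⟨M₁, M₂, m1, m2, e⟩ := h
  obtain ⟨N₁, N₂, n1, n2, f⟩ := h'
  refine ⟨M₁.sum N₁, N₂.sum M₂, m1.sum n1, n2.sum m2, ?_⟩
  refine (sum_assoc_iso _ _ _).symm.trans ((e.sum (Iso.refl N₁)).trans ?_)
  refine (sum_assoc_iso _ _ _).trans (((Iso.refl B).sum (sum_comm_iso _ _)).trans ?_)
  exact (sum_assoc_iso _ _ _).symm.trans ((f.sum (Iso.refl M₂)).trans (sum_assoc_iso _ _ _))

theorem WittEquiv.sum {A B C D : SymForm F} (h : WittEquiv A B) (h' : WittEquiv C D) :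
    WittEquiv (A.sum C) (B.sum D) := by
  obtain ⟨M₁, M₂, m1, m2, e⟩ := h
  obtain ⟨N₁, N₂, n1, n2, f⟩ := h'
  exact ⟨M₁.sum N₁, M₂.sum N₂, m1.sum n1, m2.sum n2,
    (sum_sum_sum_comm_iso _ _ _ _).trans ((e.sum f).trans (sum_sum_sum_comm_iso _ _ _ _))⟩

theorem Metabolic.neg {A : SymForm F} (hA : A.Metabolic) : A.neg.Metabolic := by
  obtain ⟨k, W, h1, h2, h3⟩ := hA
  exact ⟨k, W, h1, h2, fun x hx y hy => (congrArg Neg.neg (h3 x hx y hy)).trans neg_zero⟩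

theorem Iso.neg {A B : SymForm F} (h : Iso A B) : Iso A.neg B.neg := by
  obtain ⟨e, he⟩ := h.exists
  exact Iso.of (B₁ := A.neg) (B₂ := B.neg) e fun x y => congrArg Neg.neg (he x y)

theorem neg_sum_iso (A B : SymForm F) : Iso (A.sum B).neg (A.neg.sum B.neg) :=
  Iso.of (B₁ := (A.sum B).neg) (B₂ := A.neg.sum B.neg) (LinearEquiv.refl F (A.V × B.V))
    fun _ _ => (neg_add _ _).symm

theorem WittEquiv.neg {A B : SymForm F} (h : WittEquiv A B) : WittEquiv A.neg B.neg := by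
  obtain ⟨M₁, M₂, m1, m2, e⟩ := h
  exact ⟨M₁.neg, M₂.neg, m1.neg, m2.neg,
    (neg_sum_iso _ _).symm.trans (e.neg.trans (neg_sum_iso _ _))⟩

theorem Metabolic.wittEquiv_zero {A : SymForm F} (h : A.Metabolic) : WittEquiv A zero :=
  ⟨zero, A, metabolic_zero, h, sum_comm_iso _ _⟩

instance wittSetoid (F : Type) [Field F] : Setoid (SymForm F) where
  r := WittEquiv
  iseqv :=
    { refl := fun A => (Iso.refl A).wittEquiv
      symm := fun ⟨M₁, M₂, m1, m2, e⟩ => ⟨M₂, M₁, m2, m1, e.symm⟩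
      trans := WittEquiv.trans }

end SymForm

/-- The additive group of the Witt ring `W(F)`: Witt equivalence classes of forms. -/
def WittGroup (F : Type) [Field F] : Type 1 := Quotient (SymForm.wittSetoid F)

namespace WittGroup

open SymForm

variable {F : Type} [Field F]

/-- The Witt class `[B]`. -/
def mk (B : SymForm F) : WittGroup F := Quotient.mk _ B

theorem mk_eq {A B : SymForm F} (h : WittEquiv A B) : mk A = mk B := Quotient.sound h

instance : Add (WittGroup F) :=
  ⟨Quotient.map₂ SymForm.sum fun _ _ h _ _ h' => WittEquiv.sum h h'⟩

instance : Neg (WittGroup F) := ⟨Quotient.map SymForm.neg fun _ _ h => WittEquiv.neg h⟩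

instance : Zero (WittGroup F) := ⟨mk SymForm.zero⟩

theorem mk_sum (A B : SymForm F) : mk (A.sum B) = mk A + mk B := rfl

theorem mk_zero : mk (SymForm.zero : SymForm F) = 0 := rfl

theorem mk_neg (A : SymForm F) : mk A.neg = -mk A := rfl

theorem ind {p : WittGroup F → Prop} (h : ∀ B, p (mk B)) (x : WittGroup F) : p x :=
  Quotient.ind h x

instance : AddCommGroup (WittGroup F) where
  add_assoc x y z := by
    induction x using ind; induction y using ind; induction z using ind
    exact mk_eq (sum_assoc_iso _ _ _).wittEquiv
  zero_add x := by
    induction x using ind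
    exact mk_eq (zero_sum_iso _).wittEquiv
  add_zero x := by
    induction x using ind
    exact mk_eq ((sum_comm_iso _ _).trans (zero_sum_iso _)).wittEquiv
  neg_add_cancel x := by
    induction x using ind
    exact mk_eq ((sum_comm_iso _ _).wittEquiv.trans (metabolic_sum_neg _).wittEquiv_zero)
  add_comm x y := by
    induction x using ind; induction y using ind
    exact mk_eq (sum_comm_iso _ _).wittEquiv
  nsmul := nsmulRec
  zsmul := zsmulRec

theorem mk_metabolic {A : SymForm F} (h : A.Metabolic) : mk A = 0 := mk_eq h.wittEquiv_zero

/-- The class `[a]` of the rank one form `⟨a⟩`. -/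
def unary (a : Fˣ) : WittGroup F := mk (SymForm.unary a)

end WittGroup

section Lift

variable {K : Type} [Field K]

/-- Relations satisfied by `a ↦ [a]`, `a ∈ K^*`, in the Witt group of a field. -/
structure WittRelations {G : Type 1} [AddCommGroup G] (r : K → G) : Prop where
  sq : ∀ a c : K, a ≠ 0 → c ≠ 0 → r (a * c ^ 2) = r a
  neg : ∀ a : K, a ≠ 0 → r a + r (-a) = 0
  add : ∀ a b : K, a ≠ 0 → b ≠ 0 → a + b ≠ 0 → r a + r b = r (a + b) + r (a * b * (a + b))

/-- In an orthogonal family, a vector `x` with at least three nonzero coordinates has two whose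
contributions to `B(x, x)` do not cancel. -/
theorem exists_pair_ne_zero (h2 : (2 : K) ≠ 0) {ι : Type} (t : Finset ι) (f : ι → K)
    (hf : ∀ i ∈ t, f i ≠ 0) (ht : 2 < t.card) :
    ∃ i ∈ t, ∃ j ∈ t, i ≠ j ∧ f i + f j ≠ 0 := by
  obtain ⟨i, j, k, hi, hj, hk, hij, hik, hjk⟩ := Finset.two_lt_card_iff.1 ht
  by_contra! H
  have h1 := H i hi j hj hij
  have h3 := H i hi k hk hik
  have h4 := H j hj k hk hjk
  have : 2 * f i = 0 := by linear_combination h1 + h3 - h4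
  exact hf i hi ((mul_eq_zero.1 this).resolve_left h2)

theorem sum_eq_add_add_erase {M : Type*} [AddCommMonoid M] {ι : Type} [DecidableEq ι]
    {s : Finset ι} {i j : ι} (hi : i ∈ s) (hj : j ∈ s) (hij : i ≠ j) (g : ι → M) :
    ∑ k ∈ s, g k = g i + g j + ∑ k ∈ (s.erase i).erase j, g k := by
  rw [add_assoc, Finset.add_sum_erase _ _ (Finset.mem_erase.2 ⟨hij.symm, hj⟩),
    Finset.add_sum_erase _ _ hi]

open scoped Classical in
/-- The diagonal entries of a form with a totally isotropic subspace of at least half the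
dimension have trivial sum under any map obeying the Witt relations. -/
theorem WittRelations.sum_eq_zero {G : Type 1} [AddCommGroup G] {r : K → G}
    (hr : WittRelations r) (h2 : (2 : K) ≠ 0) {V : Type} [AddCommGroup V] [Module K V]
    [FiniteDimensional K V] (B : LinearMap.BilinForm K V) (hB : B.IsSymm) {ι : Type}
    (n m : ℕ) (s : Finset ι) (v : ι → V) (N : Submodule K V) (x : V)
    (hn : s.card = n) (hm : (s.filter fun k => B x (v k) ≠ 0).card = m)
    (hx : x ∈ N) (hx0 : x ≠ 0 ∨ n = 0)
    (hv : ∀ i ∈ s, ∀ j ∈ s, i ≠ j → B (v i) (v j) = 0) (hv0 : ∀ i ∈ s, B (v i) (v i) ≠ 0)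
    (hN : ∀ y ∈ N, ∀ z ∈ N, B y z = 0)
    (hexp : ∀ y ∈ N, y = ∑ k ∈ s, (B y (v k) / B (v k) (v k)) • v k)
    (hdim : n ≤ 2 * Module.finrank K N) :
    ∑ k ∈ s, r (B (v k) (v k)) = 0 := by
  induction n using Nat.strong_induction_on generalizing m s v N x with
  | _ n ihn =>
  induction m using Nat.strong_induction_on generalizing v with
  | _ m ihm =>
  rcases Nat.eq_zero_or_pos n with h0 | hpos
  · have : s = ∅ := Finset.card_eq_zero.1 (hn.trans h0)
    simp [this]
  have hx0 : x ≠ 0 := hx0.resolve_right hpos.ne'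
  set t := s.filter fun k => B x (v k) ≠ 0 with ht
  -- the value of `B x x` in coordinates
  have hxx : ∑ k ∈ t, B x (v k) ^ 2 / B (v k) (v k) = 0 := by
    have h1 : B x x = ∑ k ∈ s, B x (v k) ^ 2 / B (v k) (v k) := by
      conv_lhs => rw [hexp x hx]
      rw [← hexp x hx]
      conv_lhs => enter [2]; rw [hexp x hx]
      rw [map_sum]
      refine Finset.sum_congr rfl fun k _ => ?_
      simp; ring
    rw [hN x hx x hx] at h1
    rw [h1, ht, Finset.sum_filter]
    refine Finset.sum_congr rfl fun k _ => ?_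
    by_cases h : B x (v k) = 0 <;> simp [h]
  have hxexp : x = ∑ k ∈ t, (B x (v k) / B (v k) (v k)) • v k := by
    conv_lhs => rw [hexp x hx]
    rw [ht, Finset.sum_filter]
    refine Finset.sum_congr rfl fun k _ => ?_
    by_cases h : B x (v k) = 0 <;> simp [h]
  have hts : ∀ i ∈ t, i ∈ s ∧ B x (v i) ≠ 0 := fun i hi => Finset.mem_filter.1 hi
  by_cases hcard : 2 < t.card
  · -- reduce the number of nonzero coordinates of `x`
    obtain ⟨i, hi, j, hj, hij, hne⟩ := exists_pair_ne_zero h2 t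
      (fun k => B x (v k) ^ 2 / B (v k) (v k))
      (fun k hk => div_ne_zero (pow_ne_zero _ (hts k hk).2) (hv0 k (hts k hk).1)) hcard
    obtain ⟨his, hci⟩ := hts i hi
    obtain ⟨hjs, hcj⟩ := hts j hj
    have hai := hv0 i his
    have haj := hv0 j hjs
    have hBij := hv i his j hjs hij
    have hBji := hv j hjs i his hij.symm
    generalize hα : B x (v i) = α at *
    generalize hβ : B x (v j) = β at *
    generalize ha : B (v i) (v i) = a at *
    generalize hb : B (v j) (v j) = b at *
    set S := α ^ 2 / a + β ^ 2 / b with hS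
    set w₁ := (α / a) • v i + (β / b) • v j with hw₁
    set w₂ := (-β) • v i + α • v j with hw₂
    have e11 : B w₁ w₁ = S := by
      simp only [hw₁, map_add, map_smul, LinearMap.add_apply, LinearMap.smul_apply, ha, hb, hBij,
        hBji, smul_eq_mul, hS]
      field_simp; ring
    have e22 : B w₂ w₂ = a * b * S := by
      simp only [hw₂, map_add, map_smul, LinearMap.add_apply, LinearMap.smul_apply, ha, hb, hBij,
        hBji, smul_eq_mul, hS]
      field_simp; ring
    have e12 : B w₁ w₂ = 0 := by
      simp only [hw₁, hw₂, map_add, map_smul, LinearMap.add_apply, LinearMap.smul_apply, ha, hb,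
        hBij, hBji, smul_eq_mul]
      field_simp; ring
    have hS0 : S ≠ 0 := hne
    set v' := Function.update (Function.update v i w₁) j w₂ with hv'
    have hvi : v' i = w₁ := by simp [hv', hij]
    have hvj : v' j = w₂ := by simp [hv']
    have hvk : ∀ k, k ≠ i → k ≠ j → v' k = v k := fun k h h' => by simp [hv', h, h']
    have hort : ∀ k ∈ s, k ≠ i → k ≠ j → ∀ y ∈ ({w₁, w₂} : Set V), B (v k) y = 0 := by
      rintro k hk hki hkj y (rfl | rfl) <;>
        simp [hw₁, hw₂, hv k hk i his hki, hv k hk j hjs hkj]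
    have hvsum : ∑ k ∈ s, r (B (v k) (v k)) = ∑ k ∈ s, r (B (v' k) (v' k)) := by
      rw [sum_eq_add_add_erase his hjs hij, sum_eq_add_add_erase his hjs hij, hvi, hvj, e11, e22,
        ha, hb]
      congr 1
      · have h1 := hr.add (α ^ 2 / a) (β ^ 2 / b) (div_ne_zero (pow_ne_zero _ hci) hai)
          (div_ne_zero (pow_ne_zero _ hcj) haj) hS0
        rw [← hS] at h1
        rw [show α ^ 2 / a * (β ^ 2 / b) * S = a * b * S * (α * β / (a * b)) ^ 2 by field_simp,
          hr.sq _ _ (mul_ne_zero (mul_ne_zero hai haj) hS0)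
            (div_ne_zero (mul_ne_zero hci hcj) (mul_ne_zero hai haj)),
          show α ^ 2 / a = a * (α / a) ^ 2 by field_simp,
          show β ^ 2 / b = b * (β / b) ^ 2 by field_simp,
          hr.sq _ _ hai (div_ne_zero hci hai), hr.sq _ _ haj (div_ne_zero hcj haj)] at h1
        exact h1
      · refine Finset.sum_congr rfl fun k hk => ?_
        simp only [Finset.mem_erase] at hk
        rw [hvk k hk.2.1 hk.1]
    have hx1 : B x w₁ = S := by
      simp only [hw₁, map_add, map_smul, hα, hβ, smul_eq_mul, hS]
      field_simp
    have hx2 : B x w₂ = 0 := by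
      simp only [hw₂, map_add, map_smul, hα, hβ, smul_eq_mul]
      ring
    have hfil : (s.filter fun k => B x (v' k) ≠ 0) = t.erase j := by
      ext k
      simp only [ht, Finset.mem_filter, Finset.mem_erase]
      by_cases hkj : k = j
      · subst hkj; simp [hvj, hx2]
      by_cases hki : k = i
      · subst hki; simp [hvi, hx1, hS0, hij, his, hα, hci]
      · simp [hvk k hki hkj, hkj]
    rw [hvsum]
    refine ihm (m - 1) (by omega) v' ?_ ?_ ?_ ?_
    · rw [hfil, Finset.card_erase_of_mem hj, hm]
    · intro k hk l hl hkl
      by_cases hki : k = i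
      · subst hki
        by_cases hlj : l = j
        · subst hlj; rw [hvi, hvj, e12]
        · rw [hvi, hvk l (Ne.symm hkl) hlj, hB.eq, hort l hl (Ne.symm hkl) hlj _ (by simp)]
      by_cases hkj : k = j
      · subst hkj
        by_cases hli : l = i
        · subst hli; rw [hvi, hvj, hB.eq, e12]
        · rw [hvj, hvk l hli (Ne.symm hkl), hB.eq, hort l hl hli (Ne.symm hkl) _ (by simp)]
      rw [hvk k hki hkj]
      by_cases hli : l = i
      · subst hli; rw [hvi, hort k hk hki hkj _ (by simp)]
      by_cases hlj : l = j
      · subst hlj; rw [hvj, hort k hk hki hkj _ (by simp)]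
      rw [hvk l hli hlj, hv k hk l hl hkl]
    · intro k hk
      by_cases hki : k = i
      · subst hki; rw [hvi, e11]; exact hS0
      by_cases hkj : k = j
      · subst hkj; rw [hvj, e22]; exact mul_ne_zero (mul_ne_zero hai haj) hS0
      rw [hvk k hki hkj]; exact hv0 k hk
    · intro y hy
      conv_lhs => rw [hexp y hy]
      rw [sum_eq_add_add_erase his hjs hij, sum_eq_add_add_erase his hjs hij, hvi, hvj, e11, e22,
        ha, hb]
      congr 1
      · simp only [hw₁, hw₂, map_add, map_smul, smul_eq_mul]
        obtain ⟨D, hD⟩ : ∃ D, D = α ^ 2 * b + β ^ 2 * a := ⟨_, rfl⟩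
        have hS' : S = D / (a * b) := by rw [hS, hD]; field_simp
        have hT : D ≠ 0 := by
          intro h; rw [hS', h, zero_div] at hS0; exact hS0 rfl
        rw [hS']
        generalize B y (v i) = p
        generalize B y (v j) = q
        match_scalars
        · field_simp; rw [hD]; ring
        · field_simp; rw [hD]; ring
      · refine Finset.sum_congr rfl fun k hk => ?_
        simp only [Finset.mem_erase] at hk
        rw [hvk k hk.2.1 hk.1]
  · -- now `x` lies in a hyperbolic plane spanned by two of the vectors
    have ht2 : t.card = 2 := by
      rcases Nat.lt_or_ge t.card 2 with h | h
      · exfalso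
        rcases Nat.lt_or_ge t.card 1 with h' | h'
        · rw [Finset.card_eq_zero.1 (by omega : t.card = 0), Finset.sum_empty] at hxexp
          exact hx0 hxexp
        · obtain ⟨i, hi⟩ := Finset.card_eq_one.1 (by omega : t.card = 1)
          obtain ⟨h1, h2⟩ := hts i (by simp [hi])
          rw [hi, Finset.sum_singleton] at hxx
          exact div_ne_zero (pow_ne_zero _ h2) (hv0 i h1) hxx
      · omega
    obtain ⟨i, j, hij, htij⟩ := Finset.card_eq_two.1 ht2
    obtain ⟨his, hci⟩ := hts i (by simp [htij])
    obtain ⟨hjs, hcj⟩ := hts j (by simp [htij])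
    rw [htij, Finset.sum_pair hij] at hxx hxexp
    have hai := hv0 i his
    have haj := hv0 j hjs
    have hBij := hv i his j hjs hij
    have hBji := hv j hjs i his hij.symm
    generalize hα : B x (v i) = α at *
    generalize hβ : B x (v j) = β at *
    generalize ha : B (v i) (v i) = a at *
    generalize hb : B (v j) (v j) = b at *
    have hrel : α ^ 2 * b + β ^ 2 * a = 0 := by
      field_simp at hxx; linear_combination hxx
    have hbeq : b = -a * (β / α) ^ 2 := by
      field_simp; linear_combination hrel
    have hrab : r a + r b = 0 := by
      rw [hbeq, hr.sq _ _ (neg_ne_zero.2 hai) (div_ne_zero hcj hci), hr.neg a hai]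
    rw [sum_eq_add_add_erase his hjs hij, ha, hb, hrab, zero_add]
    set s' := (s.erase i).erase j with hs'
    have hs'c : s'.card = n - 2 := by
      rw [hs', Finset.card_erase_of_mem (Finset.mem_erase.2 ⟨hij.symm, hjs⟩),
        Finset.card_erase_of_mem his, hn]
      omega
    have hs's : ∀ k ∈ s', k ≠ j ∧ k ≠ i ∧ k ∈ s := fun k hk => by
      simpa only [hs', Finset.mem_erase] using hk
    have hn2 : 2 ≤ n := by
      rw [← hn, ← ht2]; exact Finset.card_le_card (Finset.filter_subset _ _)
    let π : V →ₗ[K] V := LinearMap.id - (B (v i)).smulRight (a⁻¹ • v i) -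
      (B (v j)).smulRight (b⁻¹ • v j)
    have hπ : ∀ y, π y = y - (B y (v i) / a) • v i - (B y (v j) / b) • v j := by
      intro y
      simp only [π, LinearMap.sub_apply, LinearMap.id_apply, LinearMap.smulRight_apply, smul_smul,
        hB.eq (v i) y, hB.eq (v j) y, div_eq_mul_inv]
    have hperp : ∀ y ∈ N, B y (v i) * α / a + B y (v j) * β / b = 0 := by
      intro y hy
      have := hN y hy x hx
      rw [hxexp, map_add, map_smul, map_smul, smul_eq_mul, smul_eq_mul] at this
      linear_combination this
    have hsolve : ∀ y ∈ N, B y (v j) = B y (v i) * β / α := by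
      intro y hy
      have h1 := hperp y hy
      field_simp at h1 ⊢
      have h3 : β * a * (B y (v j) * α - B y (v i) * β) = 0 := by
        linear_combination α * h1 - B y (v i) * hrel
      rcases mul_eq_zero.1 h3 with h | h
      · exact absurd h (mul_ne_zero hcj hai)
      · linear_combination h
    have hBπ : ∀ y, ∀ k ∈ s', B (π y) (v k) = B y (v k) := by
      intro y k hk
      obtain ⟨h1, h2, h3⟩ := hs's k hk
      rw [hπ]
      simp [hv i his k h3 (Ne.symm h2), hv j hjs k h3 (Ne.symm h1)]
    have hker : Module.finrank K (LinearMap.ker (π.domRestrict N)) ≤ 1 := by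
      have hle : (LinearMap.ker (π.domRestrict N)).map N.subtype ≤ Submodule.span K {x} := by
        rintro _ ⟨⟨y, hy⟩, hy', rfl⟩
        have h1 : π y = 0 := hy'
        rw [hπ, hsolve y hy, sub_sub, sub_eq_zero] at h1
        refine Submodule.mem_span_singleton.2 ⟨B y (v i) / α, ?_⟩
        refine Eq.trans ?_ h1.symm
        rw [hxexp]
        match_scalars <;> field_simp
      calc Module.finrank K (LinearMap.ker (π.domRestrict N))
          = Module.finrank K ((LinearMap.ker (π.domRestrict N)).map N.subtype) :=
            (LinearEquiv.finrank_eq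
              (Submodule.equivMapOfInjective _ N.injective_subtype _))
        _ ≤ Module.finrank K (Submodule.span K {x}) := Submodule.finrank_mono hle
        _ ≤ 1 := (finrank_span_singleton hx0).le
    have hrk := LinearMap.finrank_range_add_finrank_ker (π.domRestrict N)
    set N' := LinearMap.range (π.domRestrict N) with hN'
    have hdim' : n - 2 ≤ 2 * Module.finrank K N' := by omega
    obtain ⟨x', hx', hx'0⟩ : ∃ x' ∈ N', x' ≠ 0 ∨ n - 2 = 0 := by
      by_cases h : n - 2 = 0
      · exact ⟨0, zero_mem _, Or.inr h⟩
      · have : 0 < Module.finrank K N' := by omega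
        have := Module.nontrivial_of_finrank_pos this
        obtain ⟨z, hz⟩ := exists_ne (0 : N')
        exact ⟨z, z.2, Or.inl fun h => hz (Subtype.ext h)⟩
    refine ihn (n - 2) (by omega) _ s' v N' x' hs'c rfl hx' hx'0
      (fun k hk l hl => hv k (hs's k hk).2.2 l (hs's l hl).2.2)
      (fun k hk => hv0 k (hs's k hk).2.2) ?_ ?_ hdim'
    · rintro _ ⟨⟨y, hy⟩, rfl⟩ _ ⟨⟨z, hz⟩, rfl⟩
      change B (π y) (π z) = 0
      rw [hπ, hπ]
      simp only [map_sub, map_smul, LinearMap.sub_apply, LinearMap.smul_apply, smul_eq_mul, ha, hb,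
        hBij, hBji, hN y hy z hz, hB.eq (v i) z, hB.eq (v j) z, hsolve y hy, hsolve z hz]
      field_simp
      linear_combination (-(B y (v i) * B z (v i))) * hrel
    · rintro _ ⟨⟨y, hy⟩, rfl⟩
      change π y = _
      have h1 : ∑ k ∈ s', (B (π y) (v k) / B (v k) (v k)) • v k =
          ∑ k ∈ s', (B y (v k) / B (v k) (v k)) • v k :=
        Finset.sum_congr rfl fun k hk => by rw [hBπ y k hk]
      refine Eq.trans ?_ h1.symm
      have h2 := hexp y hy
      rw [sum_eq_add_add_erase his hjs hij, ha, hb] at h2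
      rw [hπ, sub_sub, sub_eq_iff_eq_add']
      exact h2

end Lift

section Lift

open SymForm

variable {K : Type} [Field K] {G : Type 1} [AddCommGroup G] {r : K → G}

/-- An orthogonal basis. -/
def SymForm.IsOrtho (B : SymForm K) {ι : Type} (v : Module.Basis ι K B.V) : Prop :=
  ∀ i j, i ≠ j → B.form (v i) (v j) = 0

theorem SymForm.IsOrtho.ne_zero {B : SymForm K} {ι : Type} {v : Module.Basis ι K B.V}
    (hv : B.IsOrtho v) (i : ι) : B.form (v i) (v i) ≠ 0 := fun h => by
  refine v.ne_zero i (B.nondeg.1 _ fun y => ?_)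
  have : B.form (v i) = 0 := v.ext fun j => by
    by_cases hij : i = j
    · subst hij; exact h
    · exact hv i j hij
  rw [this]; rfl

theorem SymForm.exists_isOrtho (h2 : (2 : K) ≠ 0) (B : SymForm K) :
    ∃ v : Module.Basis (Fin (Module.finrank K B.V)) K B.V, B.IsOrtho v := by
  have : Invertible (2 : K) := invertibleOfNonzero h2
  obtain ⟨v, hv⟩ := LinearMap.BilinForm.exists_orthogonal_basis
    (B := B.form) ⟨fun x y => B.symm.eq x y⟩
  exact ⟨v, fun i j hij => hv hij⟩

theorem WittRelations.metabolic (hr : WittRelations r) (h2 : (2 : K) ≠ 0) {B : SymForm K}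
    (hB : B.Metabolic) {ι : Type} [Fintype ι] (v : Module.Basis ι K B.V) (hv : B.IsOrtho v) :
    ∑ k, r (B.form (v k) (v k)) = 0 := by
  classical
  obtain ⟨k, N, h1, h3, hN⟩ := hB
  have hcard : (Finset.univ : Finset ι).card = B.rank := (Module.finrank_eq_card_basis v).symm
  obtain ⟨x, hx, hx0⟩ : ∃ x ∈ N, x ≠ 0 ∨ B.rank = 0 := by
    by_cases h : B.rank = 0
    · exact ⟨0, zero_mem _, Or.inr h⟩
    · have : 0 < Module.finrank K N := by omega
      have := Module.nontrivial_of_finrank_pos this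
      obtain ⟨z, hz⟩ := exists_ne (0 : N)
      exact ⟨z, z.2, Or.inl fun h => hz (Subtype.ext h)⟩
  refine hr.sum_eq_zero h2 B.form B.symm B.rank _ Finset.univ v N x hcard rfl hx hx0
    (fun i _ j _ => hv i j) (fun i _ => hv.ne_zero i) hN (fun y _ => ?_) (by omega)
  conv_lhs => rw [← v.sum_repr y]
  refine Finset.sum_congr rfl fun k _ => ?_
  congr 1
  rw [eq_div_iff (hv.ne_zero k)]
  conv_rhs => rw [← v.sum_repr y]
  rw [map_sum, LinearMap.sum_apply, Finset.sum_eq_single k]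
  · simp
  · intro j _ hj; simp [hv j k hj]
  · simp

/-- The sum of `r` over the entries of a diagonalization. -/
def SymForm.diagSum (r : K → G) (h2 : (2 : K) ≠ 0) (B : SymForm K) : G :=
  ∑ k, r (B.form ((B.exists_isOrtho h2).choose k) ((B.exists_isOrtho h2).choose k))

/-- The basis of an orthogonal sum formed by bases of the summands. -/
def SymForm.sumBasis {A B : SymForm K} {ι κ : Type} (v : Module.Basis ι K A.V)
    (w : Module.Basis κ K B.V) : Module.Basis (ι ⊕ κ) K (A.sum B).V :=
  (v.prod w : Module.Basis (ι ⊕ κ) K (A.V × B.V))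

theorem sum_form_sumBasis {A B : SymForm K} {ι κ : Type} (v : Module.Basis ι K A.V)
    (w : Module.Basis κ K B.V) (i j : ι ⊕ κ) :
    (A.sum B).form (sumBasis v w i) (sumBasis v w j) =
      A.form ((v.prod w) i).1 ((v.prod w) j).1 + B.form ((v.prod w) i).2 ((v.prod w) j).2 := rfl

theorem sum_isOrtho_sum {A B : SymForm K} {ι κ : Type} {v : Module.Basis ι K A.V}
    {w : Module.Basis κ K B.V} (hv : A.IsOrtho v) (hw : B.IsOrtho w) :
    (A.sum B).IsOrtho (sumBasis v w) := by
  rintro (i | i) (j | j) hij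
  · simpa [sum_form_sumBasis] using hv i j (fun h => hij (h ▸ rfl))
  · simp [sum_form_sumBasis]
  · simp [sum_form_sumBasis]
  · simpa [sum_form_sumBasis] using hw i j (fun h => hij (h ▸ rfl))

theorem sum_diag_sum {A B : SymForm K} {ι κ : Type} [Fintype ι] [Fintype κ]
    (v : Module.Basis ι K A.V) (w : Module.Basis κ K B.V) (r : K → G) :
    ∑ k, r ((A.sum B).form (sumBasis v w k) (sumBasis v w k)) =
    ∑ k, r (A.form (v k) (v k)) + ∑ k, r (B.form (w k) (w k)) := by
  rw [Fintype.sum_sum_type]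
  simp [sum_form_sumBasis]

theorem WittRelations.diagSum_eq (hr : WittRelations r) (h2 : (2 : K) ≠ 0) (B : SymForm K)
    {ι : Type} [Fintype ι] (v : Module.Basis ι K B.V) (hv : B.IsOrtho v) :
    ∑ k, r (B.form (v k) (v k)) = B.diagSum r h2 := by
  obtain ⟨w, hw⟩ : ∃ w, w = (B.exists_isOrtho h2).choose := ⟨_, rfl⟩
  have hw' : B.IsOrtho w := hw ▸ (B.exists_isOrtho h2).choose_spec
  have hwn : B.neg.IsOrtho (w : Module.Basis _ K B.neg.V) := fun i j hij =>
    (congrArg Neg.neg (hw' i j hij)).trans neg_zero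
  have h := hr.metabolic h2 (metabolic_sum_neg B) _ (sum_isOrtho_sum hv hwn)
  rw [sum_diag_sum (A := B) (B := B.neg) v w r] at h
  have h3 : ∑ k, r (B.form (w k) (w k)) + ∑ k, r (B.neg.form (w k) (w k)) = 0 := by
    rw [← Finset.sum_add_distrib]
    exact Finset.sum_eq_zero fun k _ => hr.neg _ (hw'.ne_zero k)
  rw [SymForm.diagSum, ← hw]
  exact add_right_cancel (h.trans h3.symm)

theorem WittRelations.diagSum_sum (hr : WittRelations r) (h2 : (2 : K) ≠ 0) (A B : SymForm K) :
    (A.sum B).diagSum r h2 = A.diagSum r h2 + B.diagSum r h2 := by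
  rw [← hr.diagSum_eq h2 (A.sum B) _ (sum_isOrtho_sum (A.exists_isOrtho h2).choose_spec
    (B.exists_isOrtho h2).choose_spec), sum_diag_sum]
  rfl

theorem WittRelations.diagSum_iso (hr : WittRelations r) (h2 : (2 : K) ≠ 0) {A B : SymForm K}
    (h : Iso A B) : A.diagSum r h2 = B.diagSum r h2 := by
  obtain ⟨e, he⟩ := h.exists
  rw [← hr.diagSum_eq h2 B ((A.exists_isOrtho h2).choose.map e) fun i j hij => by
    simpa [he] using (A.exists_isOrtho h2).choose_spec i j hij]
  exact Finset.sum_congr rfl fun k _ => by simp [he]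

theorem WittRelations.diagSum_metabolic (hr : WittRelations r) (h2 : (2 : K) ≠ 0)
    {A : SymForm K} (h : A.Metabolic) : A.diagSum r h2 = 0 :=
  hr.metabolic h2 h _ (A.exists_isOrtho h2).choose_spec

/-- A map obeying the Witt relations extends additively to the Witt group. -/
def WittRelations.lift (hr : WittRelations r) (h2 : (2 : K) ≠ 0) : WittGroup K →+ G :=
  AddMonoidHom.mk'
    (Quotient.lift (fun B => B.diagSum r h2) fun A B ⟨M₁, M₂, m1, m2, e⟩ => by
      have h := hr.diagSum_iso h2 e
      rwa [hr.diagSum_sum, hr.diagSum_sum, hr.diagSum_metabolic h2 m1,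
        hr.diagSum_metabolic h2 m2, add_zero, add_zero] at h)
    (WittGroup.ind fun A => WittGroup.ind fun B => hr.diagSum_sum h2 A B)

theorem WittRelations.lift_unary (hr : WittRelations r) (h2 : (2 : K) ≠ 0) (a : Kˣ) :
    hr.lift h2 (WittGroup.unary a) = r a := by
  change (SymForm.unary a).diagSum r h2 = r a
  rw [← hr.diagSum_eq h2 (SymForm.unary a)
    (Module.Basis.singleton Unit K : Module.Basis Unit K K) fun i j hij => (hij rfl).elim]
  rw [Fintype.sum_unique]
  change r ((a : K) * (Module.Basis.singleton Unit K default *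
    Module.Basis.singleton Unit K default)) = r a
  simp

end Lift

section Generation

open SymForm

variable {K : Type} [Field K]

/-- A vector with `B(x, x) ≠ 0` splits off. -/
theorem SymForm.exists_split (h2 : (2 : K) ≠ 0) (B : SymForm K) (hB : 0 < B.rank) :
    ∃ (a : Kˣ) (B' : SymForm K), Iso B ((SymForm.unary a).sum B') ∧ B'.rank < B.rank := by
  have : Invertible (2 : K) := invertibleOfNonzero h2
  have hnt : Nontrivial B.V := Module.nontrivial_of_finrank_pos hB
  obtain ⟨x, hx⟩ := LinearMap.BilinForm.exists_bilinForm_self_ne_zero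
    (LinearMap.BilinForm.Nondegenerate.ne_zero B.nondeg) ⟨fun x y => B.symm.eq x y⟩
  have hx0 : x ≠ 0 := fun h => hx (by simp [h])
  have hc := LinearMap.BilinForm.isCompl_span_singleton_orthogonal hx
  let U := B.form.orthogonal (K ∙ x)
  have hU : ∀ u ∈ U, B.form x u = 0 := fun u hu => hu x (Submodule.mem_span_singleton_self x)
  have hU' : ∀ u ∈ U, B.form u x = 0 := fun u hu => by rw [B.symm.eq]; exact hU u hu
  let e : (K × U) ≃ₗ[K] B.V :=
    ((LinearEquiv.toSpanNonzeroSingleton K B.V x hx0).prodCongr (LinearEquiv.refl K U)).trans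
      (Submodule.prodEquivOfIsCompl _ _ hc)
  have he : ∀ z, e z = z.1 • x + (z.2 : B.V) := fun z => rfl
  have hs : (B.form.restrict U).IsSymm := ⟨fun u w => B.symm.eq _ _⟩
  let B' : SymForm K :=
    { V := U
      form := B.form.restrict U
      symm := hs
      nondeg := nondeg_of_symm hs fun u hu => by
        refine Subtype.ext (B.nondeg.1 _ fun y => ?_)
        obtain ⟨z, rfl⟩ := e.surjective y
        rw [he, map_add, map_smul, hU' _ u.2, smul_zero, zero_add]
        exact hu z.2 }
  have key : ∀ z w : K × U,
      B.form (e z) (e w) = B.form x x * (z.1 * w.1) + B.form z.2 w.2 := by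
    intro z w
    rw [he, he]
    simp only [map_add, map_smul, LinearMap.add_apply, LinearMap.smul_apply, hU _ w.2.2,
      hU' _ z.2.2, smul_eq_mul, mul_zero, add_zero, zero_add]
    ring
  refine ⟨Units.mk0 _ hx, B', Iso.symm (Iso.of (B₁ := (SymForm.unary _).sum B') (B₂ := B) e ?_), ?_⟩
  · exact key
  · have h1 := e.finrank_eq
    rw [Module.finrank_prod, Module.finrank_self] at h1
    change Module.finrank K U < Module.finrank K B.V
    omega

/-- The Witt group is generated by the classes of rank one forms. -/
theorem WittGroup.unary_induction (h2 : (2 : K) ≠ 0) {p : WittGroup K → Prop} (h0 : p 0)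
    (hadd : ∀ a x, p x → p (WittGroup.unary a + x)) (x : WittGroup K) : p x := by
  induction x using WittGroup.ind with | _ B
  induction hn : B.rank using Nat.strong_induction_on generalizing B with
  | _ n ih =>
  rcases Nat.eq_zero_or_pos B.rank with h | h
  · have : (WittGroup.mk B) = 0 := WittGroup.mk_metabolic
      ⟨0, ⊥, h, finrank_bot _ _, by simp⟩
    rwa [this]
  · obtain ⟨a, B', e, hlt⟩ := B.exists_split h2 h
    rw [WittGroup.mk_eq e.wittEquiv]
    exact hadd a _ (ih _ (hn ▸ hlt) B' rfl)

theorem WittGroup.hom_ext (h2 : (2 : K) ≠ 0) {G : Type 1} [AddCommGroup G]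
    {f g : WittGroup K →+ G} (h : ∀ a, f (WittGroup.unary a) = g (WittGroup.unary a)) : f = g := by
  ext x
  refine WittGroup.unary_induction h2 (p := fun x => f x = g x) (by simp) (fun a x hx => ?_) x
  rw [map_add, map_add, h a, hx]

end Generation

section UnaryRelations

open SymForm

variable {F : Type} [Field F]

open scoped Classical in
/-- The class `[a]`, extended by `[0] = 0`. -/
def WittGroup.unary₀ (a : F) : WittGroup F :=
  if h : a = 0 then 0 else WittGroup.unary (Units.mk0 a h)

theorem WittGroup.unary₀_of_ne {a : F} (h : a ≠ 0) :
    WittGroup.unary₀ a = WittGroup.unary (Units.mk0 a h) := dif_neg h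

theorem WittGroup.unary₀_units (a : Fˣ) : WittGroup.unary₀ (a : F) = WittGroup.unary a := by
  rw [WittGroup.unary₀_of_ne a.ne_zero, Units.mk0_val]

theorem SymForm.unary_form (a : Fˣ) (x y : F) :
    (SymForm.unary a).form x y = (a : F) * (x * y) := rfl

theorem WittGroup.unary₀_relations : WittRelations (WittGroup.unary₀ : F → WittGroup F) where
  sq a c ha hc := by
    have hac : a * c ^ 2 ≠ 0 := mul_ne_zero ha (pow_ne_zero _ hc)
    rw [unary₀_of_ne ha, unary₀_of_ne hac]
    refine WittGroup.mk_eq (Iso.of (B₁ := SymForm.unary (Units.mk0 _ hac))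
      (B₂ := SymForm.unary (Units.mk0 _ ha))
      (LinearEquiv.smulOfNeZero F F c hc) fun (x : F) (y : F) => ?_).wittEquiv
    change a * (c * x * (c * y)) = a * c ^ 2 * (x * y)
    ring
  neg a ha := by
    rw [unary₀_of_ne ha, unary₀_of_ne (neg_ne_zero.2 ha)]
    have : WittGroup.unary (Units.mk0 (-a) (neg_ne_zero.2 ha)) =
        -WittGroup.unary (Units.mk0 a ha) := by
      refine WittGroup.mk_eq (Iso.of (B₁ := SymForm.unary (Units.mk0 (-a) (neg_ne_zero.2 ha)))
        (B₂ := (SymForm.unary (Units.mk0 a ha)).neg) (LinearEquiv.refl F F)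
        fun (x : F) (y : F) => ?_).wittEquiv
      change -(a * (x * y)) = -a * (x * y)
      ring
    rw [this, add_neg_cancel]
  add a b ha hb hab := by
    have hc : a * b * (a + b) ≠ 0 := mul_ne_zero (mul_ne_zero ha hb) hab
    rw [unary₀_of_ne ha, unary₀_of_ne hb, unary₀_of_ne hab, unary₀_of_ne hc]
    let e : (F × F) ≃ₗ[F] (F × F) :=
      LinearEquiv.ofLinearMap
        ((LinearMap.fst F F F - b • LinearMap.snd F F F).prod
          (LinearMap.fst F F F + a • LinearMap.snd F F F))
        (((a + b)⁻¹ • (a • LinearMap.fst F F F + b • LinearMap.snd F F F)).prod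
          ((a + b)⁻¹ • (LinearMap.snd F F F - LinearMap.fst F F F)))
        (by ext <;> simp <;> field_simp <;> ring) (by ext <;> simp <;> field_simp; ring)
    refine WittGroup.mk_eq (Iso.symm (Iso.of
      (B₁ := (SymForm.unary (Units.mk0 _ hab)).sum (SymForm.unary (Units.mk0 _ hc)))
      (B₂ := (SymForm.unary (Units.mk0 _ ha)).sum (SymForm.unary (Units.mk0 _ hb)))
      e fun (x : F × F) (y : F × F) => ?_)).wittEquiv
    change a * ((x.1 - b * x.2) * (y.1 - b * y.2)) + b * ((x.1 + a * x.2) * (y.1 + a * y.2)) =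
      (a + b) * (x.1 * y.1) + a * b * (a + b) * (x.2 * y.2)
    ring

end UnaryRelations

section Residue

variable {p : ℕ} [hp : Fact p.Prime]

open scoped Classical in
/-- Reduction of a `p`-adic integer modulo `p`, extended by `0` to all of `ℚ_p`. -/
def padicRed (x : ℚ_[p]) : ZMod p := if h : ‖x‖ ≤ 1 then PadicInt.toZMod ⟨x, h⟩ else 0

theorem padicRed_coe (u : ℤ_[p]) : padicRed (u : ℚ_[p]) = PadicInt.toZMod u := dif_pos u.2

theorem exists_padicInt {x : ℚ_[p]} (hx : ‖x‖ ≤ 1) : ∃ u : ℤ_[p], (u : ℚ_[p]) = x :=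
  ⟨⟨x, hx⟩, rfl⟩

theorem padicRed_add {x y : ℚ_[p]} (hx : ‖x‖ ≤ 1) (hy : ‖y‖ ≤ 1) :
    padicRed (x + y) = padicRed x + padicRed y := by
  obtain ⟨u, rfl⟩ := exists_padicInt hx
  obtain ⟨w, rfl⟩ := exists_padicInt hy
  rw [← PadicInt.coe_add, padicRed_coe, padicRed_coe, padicRed_coe, map_add]

theorem padicRed_mul {x y : ℚ_[p]} (hx : ‖x‖ ≤ 1) (hy : ‖y‖ ≤ 1) :
    padicRed (x * y) = padicRed x * padicRed y := by
  obtain ⟨u, rfl⟩ := exists_padicInt hx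
  obtain ⟨w, rfl⟩ := exists_padicInt hy
  rw [← PadicInt.coe_mul, padicRed_coe, padicRed_coe, padicRed_coe, map_mul]

theorem padicRed_eq_zero {x : ℚ_[p]} (hx : ‖x‖ ≤ 1) : padicRed x = 0 ↔ ‖x‖ < 1 := by
  obtain ⟨u, rfl⟩ := exists_padicInt hx
  rw [padicRed_coe, ← RingHom.mem_ker, PadicInt.ker_toZMod, IsLocalRing.mem_maximalIdeal,
    PadicInt.mem_nonunits]
  rfl

/-- The residue of the unit part `a p^{-v(a)}` of `a`. -/
def padicAc (a : ℚ_[p]) : ZMod p := padicRed (a * (p : ℚ_[p]) ^ (-a.valuation))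

theorem p_ne_zero' : (p : ℚ_[p]) ≠ 0 := by exact_mod_cast hp.1.ne_zero

theorem norm_unitPart {a : ℚ_[p]} (ha : a ≠ 0) : ‖a * (p : ℚ_[p]) ^ (-a.valuation)‖ = 1 := by
  have : (p : ℝ) ≠ 0 := by exact_mod_cast hp.1.ne_zero
  rw [norm_mul, Padic.norm_eq_zpow_neg_valuation ha, norm_zpow, Padic.norm_p, inv_zpow,
    ← zpow_neg, neg_neg, ← zpow_add₀ this]
  simp

theorem padicAc_ne_zero {a : ℚ_[p]} (ha : a ≠ 0) : padicAc a ≠ 0 := by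
  rw [padicAc, Ne, padicRed_eq_zero (norm_unitPart ha).le, norm_unitPart ha]
  exact lt_irrefl _

theorem padicAc_mul {a b : ℚ_[p]} (ha : a ≠ 0) (hb : b ≠ 0) :
    padicAc (a * b) = padicAc a * padicAc b := by
  rw [padicAc, padicAc, padicAc, ← padicRed_mul (norm_unitPart ha).le (norm_unitPart hb).le,
    Padic.valuation_mul ha hb, neg_add, zpow_add₀ p_ne_zero']
  congr 1; ring

theorem valuation_neg' (a : ℚ_[p]) : (-a).valuation = a.valuation := by
  rcases eq_or_ne a 0 with rfl | ha
  · simp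
  have h1 : (-1 : ℚ_[p]).valuation = 0 := by
    have := Padic.valuation_intCast (p := p) (-1)
    simpa [padicValInt] using this
  rw [neg_eq_neg_one_mul, Padic.valuation_mul (by simp) ha, h1, zero_add]

theorem padicAc_neg {a : ℚ_[p]} (ha : a ≠ 0) : padicAc (-a) = -padicAc a := by
  have h := padicRed_add (norm_unitPart ha).le (norm_unitPart (neg_ne_zero.2 ha)).le
  rw [valuation_neg', neg_mul, add_neg_cancel, (padicRed_eq_zero (by simp)).2 (by simp)] at h
  rw [padicAc, padicAc, valuation_neg', neg_mul]
  exact (neg_eq_of_add_eq_zero_right h.symm).symm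

theorem norm_mul_zpow_lt {a : ℚ_[p]} (ha : a ≠ 0) {m : ℤ} (h : m < a.valuation) :
    ‖a * (p : ℚ_[p]) ^ (-m)‖ < 1 := by
  have h1 : (1 : ℝ) < p := by exact_mod_cast hp.1.one_lt
  rw [norm_mul, Padic.norm_eq_zpow_neg_valuation ha, norm_zpow, Padic.norm_p, inv_zpow,
    ← zpow_neg, neg_neg, ← zpow_add₀ (by positivity)]
  exact zpow_lt_one_of_neg₀ h1 (by omega)

theorem valuation_eq_of_norm {a : ℚ_[p]} {m : ℤ} (h : ‖a * (p : ℚ_[p]) ^ (-m)‖ = 1) :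
    a.valuation = m := by
  have ha : a ≠ 0 := by rintro rfl; simp at h
  have h1 : (1 : ℝ) < p := by exact_mod_cast hp.1.one_lt
  rw [norm_mul, Padic.norm_eq_zpow_neg_valuation ha, norm_zpow, Padic.norm_p, inv_zpow,
    ← zpow_neg, neg_neg, ← zpow_add₀ (by positivity)] at h
  have := (zpow_eq_one_iff_right₀ (by positivity) h1.ne').1 h
  omega

/-- If the leading terms do not cancel, they add. -/
theorem padicAc_add {a b : ℚ_[p]} (ha : a ≠ 0) (hb : ‖b * (p : ℚ_[p]) ^ (-a.valuation)‖ ≤ 1)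
    (h : padicAc a + padicRed (b * (p : ℚ_[p]) ^ (-a.valuation)) ≠ 0) :
    (a + b).valuation = a.valuation ∧
      padicAc (a + b) = padicAc a + padicRed (b * (p : ℚ_[p]) ^ (-a.valuation)) := by
  have h1 := padicRed_add (norm_unitPart ha).le hb
  rw [← add_mul] at h1
  have hle : ‖(a + b) * (p : ℚ_[p]) ^ (-a.valuation)‖ ≤ 1 := by
    rw [add_mul]
    exact (Padic.nonarchimedean _ _).trans (max_le (norm_unitPart ha).le hb)
  have h2 : ‖(a + b) * (p : ℚ_[p]) ^ (-a.valuation)‖ = 1 := by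
    refine le_antisymm hle (not_lt.1 fun hlt => h ?_)
    rw [← (padicRed_eq_zero hle).2 hlt, h1]; rfl
  have h3 := valuation_eq_of_norm h2
  refine ⟨h3, ?_⟩
  rw [padicAc, h3, h1]; rfl

open scoped Classical in
/-- The map `a ↦ ∂²_p [a]` on `ℚ_p^*`. -/
def residueFun (a : ℚ_[p]) : WittGroup (ZMod p) :=
  if Odd a.valuation then WittGroup.unary₀ (padicAc a) else 0

theorem residueFun_mul {a b c : ℚ_[p]} (ha : a ≠ 0) (hb : b ≠ 0) (hc : c ≠ 0)
    (h : Even (a.valuation + b.valuation)) :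
    residueFun (a * b * c) = if Odd c.valuation then
      WittGroup.unary₀ (padicAc a * padicAc b * padicAc c) else 0 := by
  rw [residueFun, Padic.valuation_mul (mul_ne_zero ha hb) hc, Padic.valuation_mul ha hb,
    padicAc_mul (mul_ne_zero ha hb) hc, padicAc_mul ha hb]
  congr 1
  rw [Int.odd_add, ← Int.not_even_iff_odd]
  simp [h]

theorem residueFun_relations : WittRelations (residueFun (p := p)) where
  sq a c ha hc := by
    have h1 := WittGroup.unary₀_relations.sq _ _ (padicAc_ne_zero ha) (padicAc_ne_zero hc)
    rw [show a * c ^ 2 = c * c * a by ring, residueFun_mul hc hc ha ⟨_, rfl⟩, residueFun]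
    congr 1
    rw [← h1]; congr 1; ring
  neg a ha := by
    have h1 := WittGroup.unary₀_relations.neg _ (padicAc_ne_zero ha)
    rw [residueFun, residueFun, valuation_neg', padicAc_neg ha]
    split_ifs
    · exact h1
    · simp
  add a b ha hb hab := by
    have key : ∀ a b : ℚ_[p], a ≠ 0 → b ≠ 0 → a + b ≠ 0 → a.valuation ≤ b.valuation →
        residueFun a + residueFun b = residueFun (a + b) + residueFun (a * b * (a + b)) := by
      intro a b ha hb hab hle
      rcases hle.lt_or_eq with hlt | heq
      · have hn := norm_mul_zpow_lt hb hlt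
        have h0 := (padicRed_eq_zero hn.le).2 hn
        obtain ⟨h1, h2⟩ := padicAc_add ha hn.le (by rw [h0, add_zero]; exact padicAc_ne_zero ha)
        rw [h0, add_zero] at h2
        have h3 := residueFun_mul ha hab hb (by rw [h1]; exact ⟨_, rfl⟩)
        rw [show a * (a + b) * b = a * b * (a + b) by ring, h2] at h3
        have h4 := WittGroup.unary₀_relations.sq _ _ (padicAc_ne_zero hb) (padicAc_ne_zero ha)
        rw [show padicAc b * padicAc a ^ 2 = padicAc a * padicAc a * padicAc b by ring] at h4
        rw [h3, h4]
        congr 1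
        rw [residueFun, residueFun, h1, h2]
      · have hb' : padicRed (b * (p : ℚ_[p]) ^ (-a.valuation)) = padicAc b := by
          rw [padicAc, heq]
        have hbn : ‖b * (p : ℚ_[p]) ^ (-a.valuation)‖ ≤ 1 := by
          rw [heq]; exact (norm_unitPart hb).le
        rw [residueFun_mul ha hb hab (by rw [heq]; exact ⟨_, rfl⟩)]
        by_cases hs : padicAc a + padicAc b = 0
        · have hba : padicAc b = -padicAc a := (neg_eq_of_add_eq_zero_right hs).symm
          have hL : residueFun a + residueFun b = 0 := by
            rw [residueFun, residueFun, ← heq, hba]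
            have := WittGroup.unary₀_relations.neg _ (padicAc_ne_zero ha)
            split_ifs
            · exact this
            · simp
          have h5 := WittGroup.unary₀_relations.sq _ _ (neg_ne_zero.2 (padicAc_ne_zero hab))
            (padicAc_ne_zero ha)
          have h6 := WittGroup.unary₀_relations.neg _ (padicAc_ne_zero hab)
          rw [hL, residueFun, hba, show padicAc a * -padicAc a * padicAc (a + b) =
            -padicAc (a + b) * padicAc a ^ 2 by ring, h5]
          split_ifs
          · exact h6.symm
          · simp
        · obtain ⟨h1, h2⟩ := padicAc_add ha hbn (by rwa [hb'])
          rw [hb'] at h2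
          have h7 := WittGroup.unary₀_relations.add _ _ (padicAc_ne_zero ha) (padicAc_ne_zero hb) hs
          rw [residueFun, residueFun, residueFun, h1, ← heq, h2]
          split_ifs
          · exact h7
          · simp
    rcases le_total a.valuation b.valuation with h | h
    · exact key a b ha hb hab h
    · have := key b a hb ha (by rwa [add_comm]) h
      rw [add_comm b a, mul_comm b a, add_comm (residueFun b)] at this
      exact this

theorem residueFun_unit (u : ℤ_[p]ˣ) : residueFun ((u : ℤ_[p]) : ℚ_[p]) = 0 := by
  have : ((u : ℤ_[p]) : ℚ_[p]).valuation = 0 := by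
    refine valuation_eq_of_norm ?_
    simp
  rw [residueFun, this, if_neg (by simp)]

theorem residueFun_p_mul_unit (u : ℤ_[p]ˣ) : residueFun ((p : ℚ_[p]) * ((u : ℤ_[p]) : ℚ_[p])) =
    WittGroup.unary (Units.map PadicInt.toZMod.toMonoidHom u) := by
  have hu : ‖((u : ℤ_[p]) : ℚ_[p])‖ = 1 := PadicInt.norm_units u
  have h1 : (p : ℚ_[p]) * ((u : ℤ_[p]) : ℚ_[p]) * (p : ℚ_[p]) ^ (-1 : ℤ) =
      ((u : ℤ_[p]) : ℚ_[p]) := by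
    rw [zpow_neg_one]; field_simp [p_ne_zero' (p := p)]
  have hv : ((p : ℚ_[p]) * ((u : ℤ_[p]) : ℚ_[p])).valuation = 1 := by
    refine valuation_eq_of_norm ?_
    rw [h1, hu]
  rw [residueFun, if_pos (by rw [hv]; exact odd_one), padicAc, hv, h1, padicRed_coe,
    ← WittGroup.unary₀_units]
  rfl

/-- A unit of `ℤ_p` as an element of `ℚ_p^*`. -/
def padicUnit (u : ℤ_[p]ˣ) : ℚ_[p]ˣ := Units.map (PadicInt.Coe.ringHom (p := p)).toMonoidHom u

/-- The uniformizer `p` as an element of `ℚ_p^*`. -/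
def padicUniformizer (p : ℕ) [Fact p.Prime] : ℚ_[p]ˣ := Units.mk0 (p : ℚ_[p]) p_ne_zero'

/-- Up to squares, every element of `ℚ_p^*` is `u` or `p u` with `u` a unit. -/
theorem exists_unary_eq (a : ℚ_[p]ˣ) : ∃ u : ℤ_[p]ˣ,
    WittGroup.unary a = WittGroup.unary (padicUnit u) ∨
    WittGroup.unary a = WittGroup.unary (padicUniformizer p * padicUnit u) := by
  have hu := norm_unitPart a.ne_zero
  refine ⟨PadicInt.mkUnits hu, ?_⟩
  have hpu : ((padicUnit (PadicInt.mkUnits hu) : ℚ_[p]ˣ) : ℚ_[p]) =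
    (a : ℚ_[p]) * (p : ℚ_[p]) ^ (-(a : ℚ_[p]).valuation) := rfl
  rw [← WittGroup.unary₀_units, ← WittGroup.unary₀_units, ← WittGroup.unary₀_units]
  have hsq := fun (b : ℚ_[p]ˣ) (k : ℤ) => WittGroup.unary₀_relations.sq (b : ℚ_[p])
    ((p : ℚ_[p]) ^ k) b.ne_zero (zpow_ne_zero _ p_ne_zero')
  rcases Int.even_or_odd' (a : ℚ_[p]).valuation with ⟨k, hk | hk⟩
  · left
    rw [← hsq (padicUnit _) k, hpu, hk, mul_assoc, ← zpow_natCast, ← zpow_mul, ← zpow_add₀ p_ne_zero']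
    simp [mul_comm]
  · right
    rw [← hsq (_ * padicUnit _) k, Units.val_mul, hpu, hk]
    congr 1
    change (a : ℚ_[p]) = (p : ℚ_[p]) * _ * _
    rw [← zpow_natCast, ← zpow_mul, mul_comm (p : ℚ_[p]), mul_assoc, mul_assoc, ← zpow_one_add₀
      p_ne_zero', ← zpow_add₀ p_ne_zero']
    have : -(2 * k + 1) + (1 + k * ((2 : ℕ) : ℤ)) = 0 := by push_cast; ring
    rw [this, zpow_zero, mul_one]

/-- Existence and uniqueness of the second residue homomorphism: the additive map
`∂²_p : W(ℚ_p) → W(𝔽_p)` with `[u] ↦ 0` and `[p u] ↦ [ū]` for every unit `u` of `ℤ_p`. -/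
theorem existsUnique_secondResidue (p : ℕ) [Fact p.Prime] :
    ∃! f : WittGroup ℚ_[p] →+ WittGroup (ZMod p), ∀ u : ℤ_[p]ˣ,
      f (WittGroup.unary (padicUnit u)) = 0 ∧
      f (WittGroup.unary (padicUniformizer p * padicUnit u)) =
        WittGroup.unary (Units.map PadicInt.toZMod.toMonoidHom u) := by
  have h2 : (2 : ℚ_[p]) ≠ 0 := two_ne_zero
  refine ⟨residueFun_relations.lift h2, fun u => ⟨?_, ?_⟩, fun g hg => ?_⟩
  · rw [WittRelations.lift_unary]; exact residueFun_unit u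
  · rw [WittRelations.lift_unary]; exact residueFun_p_mul_unit u
  · refine WittGroup.hom_ext h2 fun a => ?_
    have hf := fun u : ℤ_[p]ˣ => show
        residueFun_relations.lift h2 (WittGroup.unary (padicUnit u)) = 0 ∧
        residueFun_relations.lift h2 (WittGroup.unary (padicUniformizer p * padicUnit u)) =
          WittGroup.unary (Units.map PadicInt.toZMod.toMonoidHom u) from
      ⟨by rw [WittRelations.lift_unary]; exact residueFun_unit u,
        by rw [WittRelations.lift_unary]; exact residueFun_p_mul_unit u⟩
    obtain ⟨u, h | h⟩ := exists_unary_eq a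
    · rw [h, (hg u).1, (hf u).1]
    · rw [h, (hg u).2, (hf u).2]

/-- The second residue homomorphism `∂²_p : W(ℚ_p) → W(𝔽_p)`, the unique additive map with
`[u] ↦ 0` and `[p u] ↦ [ū]` for every unit `u` of `ℤ_p`. -/
def secondResidue (p : ℕ) [Fact p.Prime] : WittGroup ℚ_[p] →+ WittGroup (ZMod p) :=
  (existsUnique_secondResidue p).exists.choose

theorem secondResidue_spec (p : ℕ) [Fact p.Prime] (u : ℤ_[p]ˣ) :
    secondResidue p (WittGroup.unary (padicUnit u)) = 0 ∧
    secondResidue p (WittGroup.unary (padicUniformizer p * padicUnit u)) =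
      WittGroup.unary (Units.map PadicInt.toZMod.toMonoidHom u) :=
  (existsUnique_secondResidue p).exists.choose_spec u

end Residue

section BaseChange

open SymForm

variable {F : Type} [Field F] (K : Type) [Field K] [Algebra F K]

theorem baseChange_nondeg (B : SymForm F) : (B.form.baseChange K).Nondegenerate := by
  let b := Module.finBasis F B.V
  have h := (LinearMap.BilinForm.nondegenerate_iff_det_ne_zero b).1 B.nondeg
  refine (LinearMap.BilinForm.nondegenerate_iff_det_ne_zero (b.baseChange K)).2 ?_
  have : LinearMap.BilinForm.toMatrix (b.baseChange K) (B.form.baseChange K) =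
      (LinearMap.BilinForm.toMatrix b B.form).map (algebraMap F K) := by
    ext i j
    simp [LinearMap.BilinForm.toMatrix_apply, Algebra.smul_def]
  rw [this, ← RingHom.mapMatrix_apply, ← RingHom.map_det]
  exact (map_ne_zero _).2 h

/-- The form over `K` obtained from a form over `F` by extension of scalars. -/
def SymForm.baseChange (B : SymForm F) : SymForm K where
  V := K ⊗[F] B.V
  form := B.form.baseChange K
  symm := ⟨fun x y => (LinearMap.BilinForm.IsSymm.baseChange K ⟨B.symm.eq⟩).eq x y⟩
  nondeg := baseChange_nondeg K B

theorem bilin_ext_tmul {V : Type} [AddCommGroup V] [Module F V]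
    {B₁ B₂ : LinearMap.BilinForm K (K ⊗[F] V)}
    (h : ∀ x y : V, B₁ (1 ⊗ₜ x) (1 ⊗ₜ y) = B₂ (1 ⊗ₜ x) (1 ⊗ₜ y)) (z w : K ⊗[F] V) :
    B₁ z w = B₂ z w := by
  have : B₁ = B₂ := by
    ext x y
    simpa using h x y
  rw [this]

theorem SymForm.Iso.baseChange {A B : SymForm F} (h : Iso A B) :
    Iso (A.baseChange K) (B.baseChange K) := by
  obtain ⟨e, he⟩ := h.exists
  let e' : (K ⊗[F] A.V) ≃ₗ[K] (K ⊗[F] B.V) := e.baseChange F K A.V B.V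
  refine Iso.of (B₁ := A.baseChange K) (B₂ := B.baseChange K) e' ?_
  refine bilin_ext_tmul K (B₁ := (B.form.baseChange K).comp e'.toLinearMap e'.toLinearMap)
    (B₂ := A.form.baseChange K) fun x y => ?_
  change B.form.baseChange K (1 ⊗ₜ e x) (1 ⊗ₜ e y) = _
  simp [he]

theorem SymForm.baseChange_sum (A B : SymForm F) :
    Iso ((A.sum B).baseChange K) ((A.baseChange K).sum (B.baseChange K)) := by
  let e' : (K ⊗[F] (A.V × B.V)) ≃ₗ[K] (K ⊗[F] A.V) × (K ⊗[F] B.V) :=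
    TensorProduct.prodRight F K K A.V B.V
  refine Iso.of (B₁ := (A.sum B).baseChange K) (B₂ := (A.baseChange K).sum (B.baseChange K)) e' ?_
  refine bilin_ext_tmul (V := A.V × B.V) K
    (B₁ := (sumForm (A.form.baseChange K) (B.form.baseChange K)).comp
      e'.toLinearMap e'.toLinearMap)
    (B₂ := (sumForm A.form B.form).baseChange K) fun x y => ?_
  simp [e', add_smul]

theorem SymForm.Metabolic.baseChange {A : SymForm F} (h : A.Metabolic) :
    (A.baseChange K).Metabolic := by
  obtain ⟨k, W, h1, h2, h3⟩ := h
  refine ⟨k, LinearMap.range (W.subtype.baseChange K), ?_, ?_, ?_⟩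
  · exact (Module.finrank_baseChange (R := K) (S := F) (M' := A.V)).trans h1
  · refine (LinearMap.finrank_range_of_inj (f := W.subtype.baseChange K) ?_).trans
      (Module.finrank_baseChange.trans h2)
    exact Module.Flat.lTensor_preserves_injective_linearMap (M := K) W.subtype W.injective_subtype
  · rintro _ ⟨x, rfl⟩ _ ⟨y, rfl⟩
    refine bilin_ext_tmul K (B₁ := (A.form.baseChange K).comp (W.subtype.baseChange K)
      (W.subtype.baseChange K)) (B₂ := 0) (fun x y => ?_) x y
    simp [h3 x.1 x.2 y.1 y.2]

/-- The map `W(F) → W(K)` induced by extension of scalars. -/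
def WittGroup.baseChange : WittGroup F →+ WittGroup K :=
  AddMonoidHom.mk'
    (Quotient.lift (fun B => WittGroup.mk (B.baseChange K)) fun A B ⟨M₁, M₂, m1, m2, e⟩ =>
      WittGroup.mk_eq ⟨M₁.baseChange K, M₂.baseChange K, m1.baseChange K, m2.baseChange K,
        (A.baseChange_sum K M₁).symm.trans ((e.baseChange K).trans (B.baseChange_sum K M₂))⟩)
    (WittGroup.ind fun A => WittGroup.ind fun B =>
      (WittGroup.mk_eq (A.baseChange_sum K B).wittEquiv))

theorem WittGroup.baseChange_unary (a : Fˣ) : WittGroup.baseChange K (WittGroup.unary a) =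
    WittGroup.unary (Units.map (algebraMap F K).toMonoidHom a) := by
  let e' : (K ⊗[F] F) ≃ₗ[K] K := TensorProduct.AlgebraTensorModule.rid F K K
  refine WittGroup.mk_eq (Iso.wittEquiv (Iso.of (B₁ := (SymForm.unary a).baseChange K)
    (B₂ := SymForm.unary (Units.map (algebraMap F K).toMonoidHom a)) e' ?_))
  refine bilin_ext_tmul (V := F) K
    (B₁ := LinearMap.BilinForm.comp (((algebraMap F K) a) • LinearMap.mul K K)
      e'.toLinearMap e'.toLinearMap)
    (B₂ := LinearMap.BilinForm.baseChange K ((a : F) • LinearMap.mul F F)) fun x y => ?_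
  simp [e', Algebra.smul_def]

end BaseChange

section Boundary

instance factPrimesPrime (p : Nat.Primes) : Fact (p : ℕ).Prime := ⟨p.2⟩

/-- `∂_p = ∂²_p ∘ ι_p : W(ℚ) → W(𝔽_p)`, with `ι_p : W(ℚ) → W(ℚ_p)` the extension of scalars. -/
def delPrime (p : ℕ) [Fact p.Prime] : WittGroup ℚ →+ WittGroup (ZMod p) :=
  (secondResidue p).comp (WittGroup.baseChange ℚ_[p])

theorem delPrime_unary_eq_zero {p : ℕ} [Fact p.Prime] (a : ℚˣ) (h : padicValRat p a = 0) :
    delPrime p (WittGroup.unary a) = 0 := by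
  have ha : ‖((a : ℚ) : ℚ_[p])‖ = 1 := by
    rw [Padic.norm_eq_zpow_neg_valuation (by simp), Padic.valuation_ratCast, h]; simp
  have : Units.map (algebraMap ℚ ℚ_[p]).toMonoidHom a = padicUnit (PadicInt.mkUnits ha) := by
    ext; exact eq_ratCast (algebraMap ℚ ℚ_[p]) _
  rw [delPrime, AddMonoidHom.comp_apply, WittGroup.baseChange_unary, this,
    (secondResidue_spec p _).1]

theorem finite_delPrime_ne_zero (x : WittGroup ℚ) :
    {p : Nat.Primes | delPrime p x ≠ 0}.Finite := by
  refine WittGroup.unary_induction two_ne_zero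
    (p := fun x => {p : Nat.Primes | delPrime p x ≠ 0}.Finite) (by simp) (fun a x hx => ?_) x
  have h1 : {p : Nat.Primes | padicValRat p a ≠ 0}.Finite := by
    have h2 : ((a : ℚ).num.natAbs * (a : ℚ).den) ≠ 0 :=
      mul_ne_zero (by simp) (a : ℚ).den_nz
    refine Set.Finite.subset (((Nat.divisors ((a : ℚ).num.natAbs * (a : ℚ).den)).finite_toSet).preimage
      (Subtype.val_injective.injOn : Set.InjOn (fun p : Nat.Primes => (p : ℕ)) _)) fun p hp => ?_
    simp only [Set.mem_preimage, Finset.mem_coe, Nat.mem_divisors]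
    refine ⟨?_, h2⟩
    by_contra hd
    refine hp ?_
    rw [padicValRat, padicValInt,
      padicValNat.eq_zero_of_not_dvd fun h => hd (h.mul_right _),
      padicValNat.eq_zero_of_not_dvd fun h => hd (h.mul_left _)]
    simp
  refine (h1.union hx).subset fun p hp => ?_
  by_contra hn
  rw [Set.mem_union, not_or] at hn
  exact hp (by rw [map_add, delPrime_unary_eq_zero a (not_not.1 hn.1), not_not.1 hn.2, add_zero])

theorem mk_delPrime_apply (x : WittGroup ℚ) (p : Nat.Primes) :
    DirectSum.mk (fun p : Nat.Primes => WittGroup (ZMod p))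
      (finite_delPrime_ne_zero x).toFinset (fun p => delPrime p.1 x) p = delPrime p x := by
  by_cases h : p ∈ (finite_delPrime_ne_zero x).toFinset
  · exact DirectSum.mk_apply_of_mem h
  · rw [DirectSum.mk_apply_of_notMem h]
    rw [Set.Finite.mem_toFinset] at h
    exact (not_not.1 h).symm

/-- `∂ = ⊕_p ∂_p : W(ℚ) → ⨁_p W(𝔽_p)`. -/
def del : WittGroup ℚ →+ ⨁ p : Nat.Primes, WittGroup (ZMod p) :=
  AddMonoidHom.mk'
    (fun x => DirectSum.mk (fun p : Nat.Primes => WittGroup (ZMod p))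
      (finite_delPrime_ne_zero x).toFinset fun p => delPrime p.1 x)
    (fun x y => by
      refine DFinsupp.ext fun p => ?_
      refine (mk_delPrime_apply (x + y) p).trans ?_
      rw [map_add, ← mk_delPrime_apply x p, ← mk_delPrime_apply y p]
      rfl)

theorem del_apply (x : WittGroup ℚ) (p : Nat.Primes) : del x p = delPrime p x :=
  mk_delPrime_apply x p

end Boundary

/-- The signature of a form over `ℚ`: the maximal dimension of a positive definite subspace minus
the maximal dimension of a negative definite one. -/
def SymForm.signature (B : SymForm ℚ) : ℤ :=
  (sigPos B.form.toQuadraticMap : ℤ) - (sigNeg B.form.toQuadraticMap : ℤ)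

/-- The Witt span of a class `x ∈ W(ℚ)`: the minimal rank of a form `B'` with `∂[B'] = ∂ x`. -/
def wittSpan (x : WittGroup ℚ) : ℕ :=
  sInf {n : ℕ | ∃ B' : SymForm ℚ, del (WittGroup.mk B') = del x ∧ B'.rank = n}

/-- `A` is a form `B_i` of rank `r`: it is anisotropic of rank `r` and signature `i`, and its Witt
class lies in `∂⁻¹(∂[B])`. -/
def IsPreimageForm (B : SymForm ℚ) (r : ℕ) (i : ℤ) (A : SymForm ℚ) : Prop :=
  A.rank = r ∧ A.Anisotropic ∧ del (WittGroup.mk A) = del (WittGroup.mk B) ∧ A.signature = i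

/-- The set `I_r` of signatures of the anisotropic forms of rank `r` whose Witt class lies in
`∂⁻¹(∂[B])`. -/
def signatureSet (B : SymForm ℚ) (r : ℕ) : Set ℤ := {i | ∃ A : SymForm ℚ, IsPreimageForm B r i A}

end

/-! Two remarks on forms over ℚ with a fixed boundary carry the characterizations. An isotropic form
can lose a hyperbolic plane without changing its Witt class (`exists_rank_add_two`), so a form whose
rank exceeds the Witt span by at most one is anisotropic (`anisotropic_of_rank_le`). Moreover ⟨1⟩
and ⟨-1⟩ have trivial boundary. Hence a form of minimal rank stays anisotropic after adding either
of them. Conversely, if A has minimal rank r - 1, then A ⊕ ⟨1⟩ is one of the anisotropic forms of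
rank r and becomes isotropic after adding ⟨-1⟩; so the anisotropy condition in rank r excludes the
span r - 1 (`wittSpan_add_one_ne`). The remaining smaller spans are excluded by definite forms:
⟨1,1⟩ or ⟨1,1,1⟩ against span 0, and ⟨a,±1,±1⟩, with the signs equal to that of a, against span 1.

The arithmetic content of (iv) is that every boundary is that of a ternary form with arbitrarily
prescribed signs e₁, e₂, e₃ (`exists_ternary_delPrime_eq`). Let D₁ and D₂ be the products of the odd
primes whose residue is of rank one, respectively anisotropic of rank two. The form is ⟨e₁kD₂,
e₂kD₂l, e₃k'D₁l⟩, where {k, k'} = {1, 2} is dictated by the residue at 2 and l is an auxiliary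
prime. The classes of l modulo the primes of D₁D₂ adjust the residues there. The residue at l
vanishes iff -e₂e₃·2D₁D₂ is a square modulo l. Taking l ≡ 1 mod 4 makes the signs irrelevant;
reciprocity turns the symbols (p/l) into the already prescribed (l/p), and the sign of (2/l) is
still free because l may be 1 or 5 modulo 8. Dirichlet's theorem supplies l
(`exists_prime_prescribed`).

The subsets of {0, ±2} are realized by forms ⟨q, ±Nq⟩ with N and q prime. The parities of the ranks
of the residues show that a binary form with the same boundary is ⟨n, εNn⟩ with ε = ±1
(`exists_eq_of_del_eq`). The residue at q can exclude one value of ε. For N = 7 and ε = 1, negative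
n is excluded by quadratic reciprocity (`false_of_del_eq_neg`). -/

noncomputable section

/-! ### Splitting, isotropic reduction and metabolic forms. -/

namespace SymForm

variable {F : Type} [Field F]

theorem rank_sum (A B : SymForm F) : (A.sum B).rank = A.rank + B.rank :=
  Module.finrank_prod (R := F) (M := A.V) (M' := B.V)

theorem rank_unary (a : Fˣ) : (unary a).rank = 1 := Module.finrank_self F

theorem rank_zero : (zero : SymForm F).rank = 0 :=
  Module.finrank_zero_of_subsingleton (M := PUnit)

theorem Iso.rank_eq {A B : SymForm F} (h : Iso A B) : A.rank = B.rank := by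
  obtain ⟨e, -⟩ := h.exists
  exact e.finrank_eq

theorem sum_form_apply (A B : SymForm F) (x y : A.V × B.V) :
    (A.sum B).form x y = A.form x.1 y.1 + B.form x.2 y.2 := rfl

/-- A vector `x` with `B(x, x) = a ≠ 0` splits off the form `⟨a⟩`. -/
theorem exists_split_of_form_self (B : SymForm F) (x : B.V) (a : Fˣ) (hx : B.form x x = a) :
    ∃ B' : SymForm F, Iso B ((unary a).sum B') ∧ B'.rank + 1 = B.rank := by
  have hxx : B.form x x ≠ 0 := hx ▸ a.ne_zero
  have hx0 : x ≠ 0 := fun h => hxx (by simp [h])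
  have hc := LinearMap.BilinForm.isCompl_span_singleton_orthogonal hxx
  let U := B.form.orthogonal (F ∙ x)
  have hU : ∀ u ∈ U, B.form x u = 0 := fun u hu => hu x (Submodule.mem_span_singleton_self x)
  have hU' : ∀ u ∈ U, B.form u x = 0 := fun u hu => by rw [B.symm.eq]; exact hU u hu
  let e : (F × U) ≃ₗ[F] B.V :=
    ((LinearEquiv.toSpanNonzeroSingleton F B.V x hx0).prodCongr (LinearEquiv.refl F U)).trans
      (Submodule.prodEquivOfIsCompl _ _ hc)
  have he : ∀ z, e z = z.1 • x + (z.2 : B.V) := fun z => rfl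
  have hs : (B.form.restrict U).IsSymm := ⟨fun u w => B.symm.eq _ _⟩
  let B' : SymForm F :=
    { V := U
      form := B.form.restrict U
      symm := hs
      nondeg := nondeg_of_symm hs fun u hu => by
        refine Subtype.ext (B.nondeg.1 _ fun y => ?_)
        obtain ⟨z, rfl⟩ := e.surjective y
        rw [he, map_add, map_smul, hU' _ u.2, smul_zero, zero_add]
        exact hu z.2 }
  have key : ∀ z w : F × U,
      B.form (e z) (e w) = a * (z.1 * w.1) + B.form z.2 w.2 := by
    intro z w
    rw [he, he]
    simp only [map_add, map_smul, LinearMap.add_apply, LinearMap.smul_apply, hU _ w.2.2,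
      hU' _ z.2.2, smul_eq_mul, mul_zero, add_zero, zero_add, hx]
    ring
  refine ⟨B', Iso.symm (Iso.of (B₁ := (unary a).sum B') (B₂ := B) e key), ?_⟩
  have h1 := e.finrank_eq
  rw [Module.finrank_prod, Module.finrank_self] at h1
  change Module.finrank F U + 1 = Module.finrank F B.V
  omega

theorem exists_split_rank (h2 : (2 : F) ≠ 0) (B : SymForm F) (hB : 0 < B.rank) :
    ∃ (a : Fˣ) (B' : SymForm F), Iso B ((unary a).sum B') ∧ B'.rank + 1 = B.rank := by
  obtain ⟨a, B', h, -⟩ := B.exists_split h2 hB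
  refine ⟨a, B', h, ?_⟩
  rw [h.rank_eq, rank_sum, rank_unary, add_comm]

theorem Anisotropic.of_iso {A B : SymForm F} (h : Iso A B) (hA : A.Anisotropic) :
    B.Anisotropic := by
  obtain ⟨e, he⟩ := h.symm.exists
  intro x hx
  have := hA (e x) (by rw [he, hx])
  simpa using this

theorem mk_unary_add_mk_unary_neg (a : Fˣ) : WittGroup.unary a + WittGroup.unary (-a) = 0 := by
  have := WittGroup.unary₀_relations.neg (a : F) a.ne_zero
  rwa [← Units.val_neg, WittGroup.unary₀_units, WittGroup.unary₀_units] at this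

/-- An isotropic form is Witt equivalent to a form of rank smaller by two. -/
theorem exists_rank_add_two (h2 : (2 : F) ≠ 0) (B : SymForm F) (hB : ¬ B.Anisotropic) :
    ∃ B' : SymForm F, B'.rank + 2 = B.rank ∧ WittGroup.mk B' = WittGroup.mk B := by
  induction hn : B.rank generalizing B with
  | zero =>
    refine absurd (fun x _ => ?_) hB
    have : Subsingleton B.V := Module.finrank_zero_iff.1 hn
    exact Subsingleton.elim _ _
  | succ n ih =>
    obtain ⟨a, A, e, hA⟩ := B.exists_split_rank h2 (by omega)
    have hi : ¬ ((unary a).sum A).Anisotropic := fun h => hB (h.of_iso e.symm)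
    simp only [Anisotropic, not_forall] at hi
    obtain ⟨⟨(s : F), y⟩, hz, hne⟩ := hi
    have hz' : (a : F) * (s * s) + A.form y y = 0 := hz
    rw [WittGroup.mk_eq e.wittEquiv, WittGroup.mk_sum]
    -- If the first coordinate of the isotropic vector vanishes, A itself is isotropic and the
    -- induction applies. Otherwise A takes the value -a at s⁻¹y, so ⟨-a⟩ splits off A and cancels
    -- ⟨a⟩.
    by_cases hs : s = 0
    · subst hs
      have hA' : ¬ A.Anisotropic := fun h => hne (Prod.ext rfl (h y (by simpa using hz')))
      obtain ⟨C, hC, hC'⟩ := ih A hA' (by omega)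
      exact ⟨(unary a).sum C, by rw [rank_sum, rank_unary]; omega, by
        rw [WittGroup.mk_sum, hC']⟩
    · obtain ⟨C, hC, hC'⟩ := A.exists_split_of_form_self (s⁻¹ • y) (-a) (by
        simp only [map_smul, LinearMap.smul_apply, smul_eq_mul, Units.val_neg]
        field_simp
        linear_combination hz')
      refine ⟨C, by omega, ?_⟩
      rw [WittGroup.mk_eq hC.wittEquiv, WittGroup.mk_sum, ← add_assoc]
      have := mk_unary_add_mk_unary_neg a
      rw [WittGroup.unary, WittGroup.unary] at this
      rw [this, zero_add]

theorem Metabolic.of_iso {A B : SymForm F} (h : Iso A B) (hA : A.Metabolic) : B.Metabolic := by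
  obtain ⟨e, he⟩ := h.exists
  obtain ⟨k, W, h1, h3, h4⟩ := hA
  refine ⟨k, W.map e.toLinearMap, h.rank_eq ▸ h1, ?_, ?_⟩
  · rw [← h3]; exact LinearEquiv.finrank_map_eq e W
  · rintro _ ⟨x, hx, rfl⟩ _ ⟨y, hy, rfl⟩
    exact (he x y).trans (h4 x hx y hy)

theorem metabolic_sum_of_mk_eq_zero {A : SymForm F} (h : WittGroup.mk A = 0) :
    ∃ M : SymForm F, M.Metabolic ∧ (A.sum M).Metabolic := by
  obtain ⟨M₁, M₂, m1, m2, e⟩ : WittEquiv A zero := Quotient.exact h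
  exact ⟨M₁, m1, (metabolic_zero.sum m2).of_iso e.symm⟩

/-- Both A ⊕ M and M are metabolic, hence of even rank. -/
theorem even_rank_of_mk_eq_zero {A : SymForm F} (h : WittGroup.mk A = 0) : Even A.rank := by
  obtain ⟨M, ⟨k, -, h1, -⟩, ⟨l, -, h3, -⟩⟩ := metabolic_sum_of_mk_eq_zero h
  rw [rank_sum] at h3
  exact ⟨l - k, by omega⟩

theorem finrank_submodule_prod {V W : Type} [AddCommGroup V] [Module F V] [AddCommGroup W]
    [Module F W] [FiniteDimensional F V] [FiniteDimensional F W] (P : Submodule F V)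
    (Q : Submodule F W) :
    Module.finrank F (P.prod Q) = Module.finrank F P + Module.finrank F Q := by
  rw [← Module.finrank_prod, ← LinearMap.finrank_range_of_inj
    (f := P.subtype.prodMap Q.subtype)
    (Prod.map_injective.2 ⟨P.injective_subtype, Q.injective_subtype⟩),
    LinearMap.range_prodMap, Submodule.range_subtype, Submodule.range_subtype]

/-- A nonzero form with trivial Witt class is isotropic. -/
theorem Anisotropic.rank_eq_zero {A : SymForm F} (hA : A.Anisotropic)
    (h : WittGroup.mk A = 0) : A.rank = 0 := by
  obtain ⟨M, ⟨k, L, h1, h3, h4⟩, ⟨l, N, h5, h6, h7⟩⟩ := metabolic_sum_of_mk_eq_zero h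
  let g : LinearMap.BilinForm F (A.V × M.V) := (A.sum M).form
  have hg : g.Nondegenerate := (A.sum M).nondeg
  let N : Submodule F (A.V × M.V) := N
  -- L and N are Lagrangians of M and A ⊕ M. A vector (x, y) of N ∩ P has A(x, x) = 0, so x = 0 by
  -- anisotropy and N ∩ P lies in J. Since J is orthogonal to both N and P, dim (N + P) ≤ dim (A ⊕
  -- M) - dim J, whence dim N + dim P ≤ dim (A ⊕ M). With rank A = a and rank M = 2k this reads (a/2
  -- + k) + (a + k) ≤ a + 2k, so a = 0. No assumption on the characteristic enters.
  let J : Submodule F (A.V × M.V) := N ⊓ (⊥ : Submodule F A.V).prod L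
  let P : Submodule F (A.V × M.V) := (⊤ : Submodule F A.V).prod L
  have hsub : N ⊓ P ≤ J := by
    rintro ⟨x, y⟩ ⟨hN, hP⟩
    refine ⟨hN, ?_, hP.2⟩
    have h8 := h7 _ hN _ hN
    rw [sum_form_apply, h4 y hP.2 y hP.2, add_zero] at h8
    exact hA x h8
  have hJ : N ⊔ P ≤ LinearMap.BilinForm.orthogonal g J := by
    refine sup_le ?_ ?_
    · intro x hx y hy
      exact h7 y hy.1 x hx
    · rintro x hx y hy
      change A.form y.1 x.1 + M.form y.2 x.2 = 0
      rw [(Submodule.mem_bot F).1 hy.2.1, h4 _ hy.2.2 _ hx.2]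
      simp
  have hS : Module.finrank F (A.V × M.V) = A.rank + M.rank := rank_sum A M
  have h9 : Module.finrank F (LinearMap.BilinForm.orthogonal g J) =
      Module.finrank F (A.V × M.V) - Module.finrank F J :=
    LinearMap.BilinForm.finrank_orthogonal hg J
  have h10 := Submodule.finrank_mono hJ
  have h11 := Submodule.finrank_sup_add_finrank_inf_eq N P
  have h12 := Submodule.finrank_mono hsub
  have h13 : Module.finrank F P = A.rank + k := by
    rw [finrank_submodule_prod, finrank_top, h3]; rfl
  have h14 : Module.finrank F N = l := h6
  have h15 : Module.finrank F J ≤ Module.finrank F (A.V × M.V) := Submodule.finrank_le _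
  rw [rank_sum] at h5
  omega

/-! ### Signatures. -/

/-- The signature is the sum of the signs of the entries of a diagonalization. -/
theorem signature_eq_sum_sign (B : SymForm ℚ) {ι : Type} [Fintype ι]
    (v : Module.Basis ι ℚ B.V) (hv : B.IsOrtho v) :
    B.signature = ∑ k, ((SignType.sign (B.form (v k) (v k)) : SignType) : ℤ) := by
  classical
  have h : QuadraticMap.Equivalent B.form.toQuadraticMap
      (QuadraticMap.weightedSumSquares ℚ fun k => B.form (v k) (v k)) := by
    have h1 : QuadraticMap.associated (R := ℚ) B.form.toQuadraticMap = B.form :=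
      QuadraticMap.associated_left_inverse ℚ fun x y => B.symm.eq x y
    have h3 := QuadraticMap.basisRepr_eq_of_iIsOrtho B.form.toQuadraticMap v
      (by rw [h1]; exact fun i j hij => hv i j hij)
    exact ⟨(QuadraticMap.isometryEquivBasisRepr B.form.toQuadraticMap v).trans
      ⟨LinearEquiv.refl ℚ _, fun x => (congrArg (fun q => q x) h3).symm⟩⟩
  rw [signature, QuadraticForm.sigPos_of_equiv_weightedSumSquares h,
    QuadraticForm.sigNeg_of_equiv_weightedSumSquares h]
  rw [Set.ncard_eq_toFinset_card', Set.ncard_eq_toFinset_card', Finset.card_eq_sum_ones,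
    Finset.card_eq_sum_ones]
  simp only [Set.toFinset_ofPred, Finset.sum_filter]
  push_cast
  rw [← Finset.sum_sub_distrib]
  refine Finset.sum_congr rfl fun k _ => ?_
  rcases lt_trichotomy (B.form (v k) (v k)) 0 with h | h | h
  · simp [h, h.not_gt]
  · simp [h]
  · simp [h, h.not_gt]

theorem signature_sum (A B : SymForm ℚ) : (A.sum B).signature = A.signature + B.signature := by
  obtain ⟨v, hv⟩ := A.exists_isOrtho two_ne_zero
  obtain ⟨w, hw⟩ := B.exists_isOrtho two_ne_zero
  rw [signature_eq_sum_sign _ _ (sum_isOrtho_sum hv hw), signature_eq_sum_sign A v hv,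
    signature_eq_sum_sign B w hw, Fintype.sum_sum_type]
  simp [sum_form_sumBasis]

theorem signature_unary (a : ℚˣ) :
    (unary a).signature = ((SignType.sign (a : ℚ) : SignType) : ℤ) := by
  rw [signature_eq_sum_sign (unary a)
    (Module.Basis.singleton Unit ℚ : Module.Basis Unit ℚ ℚ) fun i j hij => (hij rfl).elim]
  rw [Fintype.sum_unique]
  change ((SignType.sign ((a : ℚ) * (Module.Basis.singleton Unit ℚ default *
    Module.Basis.singleton Unit ℚ default)) : SignType) : ℤ) = _
  simp

theorem Iso.signature_eq {A B : SymForm ℚ} (h : Iso A B) : A.signature = B.signature := by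
  obtain ⟨e, he⟩ := h.exists
  obtain ⟨v, hv⟩ := A.exists_isOrtho two_ne_zero
  rw [signature_eq_sum_sign A v hv, signature_eq_sum_sign B (v.map e) fun i j hij => by
    simpa [he] using hv i j hij]
  exact Finset.sum_congr rfl fun k _ => by simp [he]

theorem signature_neg (A : SymForm ℚ) : A.neg.signature = -A.signature := by
  obtain ⟨v, hv⟩ := A.exists_isOrtho two_ne_zero
  have hvn : A.neg.IsOrtho (v : Module.Basis _ ℚ A.neg.V) := fun i j hij =>
    (congrArg Neg.neg (hv i j hij)).trans neg_zero
  rw [signature_eq_sum_sign A v hv, signature_eq_sum_sign A.neg v hvn, ← Finset.sum_neg_distrib]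
  refine Finset.sum_congr rfl fun k _ => ?_
  change ((SignType.sign (-(A.form (v k) (v k))) : SignType) : ℤ) = _
  rw [Left.sign_neg, SignType.coe_neg]

theorem signature_of_rank_eq_zero {A : SymForm ℚ} (h : A.rank = 0) : A.signature = 0 := by
  obtain ⟨v, hv⟩ := A.exists_isOrtho two_ne_zero
  have : IsEmpty (Fin (Module.finrank ℚ A.V)) := by
    rw [show Module.finrank ℚ A.V = 0 from h]; infer_instance
  rw [signature_eq_sum_sign A v hv]
  simp

end SymForm

/-! ### Classes of rank one forms and the parity of the rank. -/

namespace WittGroup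

open SymForm

section Field

variable {F : Type} [Field F]

theorem unary₀_zero : unary₀ (0 : F) = 0 := by simp [unary₀]

theorem unary₀_add_neg (a : F) : unary₀ a + unary₀ (-a) = 0 := by
  by_cases ha : a = 0
  · simp [ha, unary₀_zero]
  · exact unary₀_relations.neg a ha

theorem unary₀_eq_of_isSquare {a b : F} (ha : a ≠ 0) (hb : b ≠ 0) (h : IsSquare (a * b)) :
    unary₀ a = unary₀ b := by
  obtain ⟨c, hc⟩ := h
  have hc0 : c ≠ 0 := by rintro rfl; exact mul_ne_zero ha hb (by simpa using hc)
  rw [← unary₀_relations.sq a (c / a) ha (div_ne_zero hc0 ha)]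
  congr 1
  field_simp
  linear_combination -hc

theorem anisotropic_unary_sum_unary {a b : Fˣ} (h : ¬ IsSquare (-((a : F) * b))) :
    ((SymForm.unary a).sum (SymForm.unary b)).Anisotropic := by
  rintro ⟨(x : F), (y : F)⟩ hxy
  replace hxy : (a : F) * (x * x) + b * (y * y) = 0 := hxy
  have hy : y = 0 := by
    by_contra hy
    refine h ⟨a * x / y, ?_⟩
    field_simp
    linear_combination -hxy
  subst hy
  have hx : x = 0 := by simpa using hxy
  subst hx
  rfl

/-- If -ab is not a square, ⟨a, b⟩ is anisotropic of positive rank and so has nonzero class; if it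
is, then b and -a agree up to squares. -/
theorem unary₀_add_eq_zero_iff {a b : F} (ha : a ≠ 0) (hb : b ≠ 0) :
    unary₀ a + unary₀ b = 0 ↔ IsSquare (-(a * b)) := by
  constructor
  · intro h
    by_contra hn
    rw [unary₀_of_ne ha, unary₀_of_ne hb] at h
    have h1 := (anisotropic_unary_sum_unary (a := Units.mk0 a ha) (b := Units.mk0 b hb)
      hn).rank_eq_zero h
    rw [rank_sum, rank_unary, rank_unary] at h1
    omega
  · intro h
    rw [← unary₀_add_neg a, unary₀_eq_of_isSquare hb (neg_ne_zero.2 ha)]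
    convert h using 1; ring

theorem isSquare_of_unary₀_eq {a b : F} (ha : a ≠ 0) (hb : b ≠ 0) (h : unary₀ a = unary₀ b) :
    IsSquare (a * b) := by
  have h1 := unary₀_add_neg b
  rw [← h, unary₀_add_eq_zero_iff ha (neg_ne_zero.2 hb)] at h1
  simpa using h1

/-- The rank modulo two, as a homomorphism on the Witt group. -/
def rankParity : WittGroup F →+ ZMod 2 :=
  AddMonoidHom.mk' (Quotient.lift (fun B => (B.rank : ZMod 2)) fun A B h => by
      -- Equivalent forms have a difference A ⊕ -B of trivial class, hence of even rank.
      have h1 : mk (A.sum B.neg) = 0 := by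
        rw [mk_sum, mk_neg, mk_eq h, add_neg_cancel]
      have h2 : Even (A.rank + B.rank) := by
        have := even_rank_of_mk_eq_zero h1
        rwa [rank_sum] at this
      have h3 : ((A.rank + B.rank : ℕ) : ZMod 2) = 0 := (ZMod.natCast_eq_zero_iff_even).2 h2
      change (A.rank : ZMod 2) = B.rank
      push_cast at h3
      rw [eq_neg_of_add_eq_zero_left h3, ZMod.neg_eq_self_mod_two])
    (ind fun A => ind fun B => by
      change ((A.sum B).rank : ZMod 2) = A.rank + B.rank
      rw [rank_sum, Nat.cast_add])

theorem rankParity_unary₀ {a : F} (ha : a ≠ 0) : rankParity (unary₀ a) = 1 := by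
  rw [unary₀_of_ne ha]
  change ((SymForm.unary _).rank : ZMod 2) = 1
  rw [rank_unary, Nat.cast_one]

theorem unary₀_ne_zero {a : F} (ha : a ≠ 0) : unary₀ a ≠ 0 := fun h => by
  have := rankParity_unary₀ ha
  rw [h, map_zero] at this
  exact zero_ne_one this

end Field

/-! ### Witt groups of prime fields. -/

section FiniteField

variable {p : ℕ} [Fact p.Prime]

/-- Binary forms over a finite field of odd characteristic are classified by the discriminant. -/
theorem unary₀_add_unary₀_eq (hp : p ≠ 2) {a b c d : ZMod p} (ha : a ≠ 0) (hb : b ≠ 0)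
    (hc : c ≠ 0) (hd : d ≠ 0) (h : IsSquare (a * b * c * d)) :
    unary₀ a + unary₀ b = unary₀ c + unary₀ d := by
  obtain ⟨z, hz⟩ := h
  -- Over a finite field of odd order ⟨a, b⟩ represents every c, so its complement to ⟨c⟩ is ⟨abc⟩,
  -- which is ⟨d⟩ up to squares. If x or y vanishes, the relation below is not available, but then c
  -- already equals b or a up to squares.
  obtain ⟨x, y, hxy⟩ : ∃ x y : ZMod p, a * x ^ 2 + b * y ^ 2 = c := by
    obtain ⟨x, y, h⟩ := FiniteField.exists_root_sum_quadratic
      (f := Polynomial.C a * Polynomial.X ^ 2)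
      (g := Polynomial.C b * Polynomial.X ^ 2 - Polynomial.C c)
      (Polynomial.degree_C_mul_X_pow 2 ha)
      (by
        rw [Polynomial.degree_sub_C]
        · exact Polynomial.degree_C_mul_X_pow 2 hb
        · rw [Polynomial.degree_C_mul_X_pow 2 hb]; norm_num)
      (by rw [ZMod.card]; exact (Fact.out : p.Prime).eq_two_or_odd.resolve_left hp)
    refine ⟨x, y, ?_⟩
    simp at h
    linear_combination h
  by_cases hx : x = 0
  · subst hx
    rw [add_comm, unary₀_eq_of_isSquare hb hc ⟨b * y, by rw [← hxy]; ring⟩,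
      unary₀_eq_of_isSquare ha hd ⟨z / (b * y), ?_⟩]
    have hy : y ≠ 0 := by rintro rfl; exact hc (by rw [← hxy]; ring)
    field_simp
    linear_combination hz + a * b * d * hxy
  by_cases hy : y = 0
  · subst hy
    rw [unary₀_eq_of_isSquare ha hc ⟨a * x, by rw [← hxy]; ring⟩,
      unary₀_eq_of_isSquare hb hd ⟨z / (a * x), ?_⟩]
    field_simp
    linear_combination hz + a * b * d * hxy
  · have h1 := unary₀_relations.add (a * x ^ 2) (b * y ^ 2) (by positivity) (by positivity)
      (hxy ▸ hc)
    rw [hxy, unary₀_relations.sq _ _ ha hx, unary₀_relations.sq _ _ hb hy] at h1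
    rw [h1, unary₀_eq_of_isSquare (a := a * x ^ 2 * (b * y ^ 2) * c) (b := d) (by positivity) hd
      ⟨z * x * y, by linear_combination x ^ 2 * y ^ 2 * hz⟩]

theorem isSquare_mul_of_not_isSquare (a b : ZMod p) (ha : ¬ IsSquare a) (hb : ¬ IsSquare b) :
    IsSquare (a * b) := by
  have ha0 : a ≠ 0 := by rintro rfl; exact ha (IsSquare.zero)
  have hb0 : b ≠ 0 := by rintro rfl; exact hb (IsSquare.zero)
  have := quadraticChar_neg_one_iff_not_isSquare.2 ha
  have h2 := quadraticChar_neg_one_iff_not_isSquare.2 hb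
  rw [← quadraticChar_one_iff_isSquare (mul_ne_zero ha0 hb0), map_mul, this, h2]
  norm_num

/-- The product of two nonsquares is a square, so the two discriminants agree. This makes the class
of an anisotropic binary form unique. -/
theorem unary₀_add_unary₀_eq_of_not_isSquare (hp : p ≠ 2) {a b c d : ZMod p}
    (hab : ¬ IsSquare (-(a * b))) (hcd : ¬ IsSquare (-(c * d))) :
    unary₀ a + unary₀ b = unary₀ c + unary₀ d := by
  have ha : a ≠ 0 := by rintro rfl; simp at hab
  have hb : b ≠ 0 := by rintro rfl; simp at hab
  have hc : c ≠ 0 := by rintro rfl; simp at hcd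
  have hd : d ≠ 0 := by rintro rfl; simp at hcd
  refine unary₀_add_unary₀_eq hp ha hb hc hd ?_
  convert isSquare_mul_of_not_isSquare _ _ hab hcd using 1
  ring

theorem exists_not_isSquare (hp : p ≠ 2) : ∃ a : ZMod p, ¬ IsSquare a :=
  FiniteField.exists_nonsquare (by rwa [ZMod.ringChar_zmod_n])

/-- The Witt group of a prime field of odd characteristic consists of zero, the classes of the
rank one forms, and the class of the anisotropic binary forms. -/
theorem finite_cases (hp : p ≠ 2) (x : WittGroup (ZMod p)) :
    x = 0 ∨ (∃ u : ZMod p, u ≠ 0 ∧ x = unary₀ u) ∨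
      ∀ a b : ZMod p, ¬ IsSquare (-(a * b)) → x = unary₀ a + unary₀ b := by
  have h2 : (2 : ZMod p) ≠ 0 := Ring.two_ne_zero (by rwa [ZMod.ringChar_zmod_n])
  refine unary_induction h2 (p := fun x => x = 0 ∨ (∃ u : ZMod p, u ≠ 0 ∧ x = unary₀ u) ∨
      ∀ a b : ZMod p, ¬ IsSquare (-(a * b)) → x = unary₀ a + unary₀ b) (Or.inl rfl) ?_ x
  intro a x hx
  rw [← unary₀_units]
  rcases hx with rfl | ⟨u, hu, rfl⟩ | hx
  · exact Or.inr (Or.inl ⟨a, a.ne_zero, add_zero _⟩)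
  · by_cases h : IsSquare (-((a : ZMod p) * u))
    · exact Or.inl ((unary₀_add_eq_zero_iff a.ne_zero hu).2 h)
    · exact Or.inr (Or.inr fun c d hcd => unary₀_add_unary₀_eq_of_not_isSquare hp h hcd)
  · obtain ⟨n, hn⟩ := exists_not_isSquare hp
    have ha := a.ne_zero
    have hn0 : n ≠ 0 := by rintro rfl; simp at hn
    -- The anisotropic binary class may be written with any pair whose negated product is a
    -- nonsquare; the pair (-a, n/a) has negated product n, and its first entry cancels [a].
    refine Or.inr (Or.inl ⟨n / a, div_ne_zero hn0 ha, ?_⟩)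
    rw [hx (-a) (n / a) (by convert hn using 1; field_simp), ← add_assoc, unary₀_add_neg,
      zero_add]

theorem unary₀_two (a : ZMod 2) (ha : a ≠ 0) : unary₀ a = unary₀ (1 : ZMod 2) := by
  congr 1
  revert a; decide

theorem unary₀_two_add (a b : ZMod 2) (ha : a ≠ 0) (hb : b ≠ 0) : unary₀ a + unary₀ b = 0 := by
  have : b = -a := by revert a b; decide
  rw [this, unary₀_add_neg]

end FiniteField

end WittGroup

open WittGroup

/-! ### Residues of rank one forms over ℚ. -/

section

variable {p : ℕ} [hp : Fact p.Prime]

theorem delPrime_unary₀_of_not_dvd {n : ℤ} (h : ¬ (p : ℤ) ∣ n) :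
    delPrime p (unary₀ (n : ℚ)) = 0 := by
  have hn : (n : ℚ) ≠ 0 := by
    rintro h0
    exact h (by simp [Int.cast_eq_zero.1 h0])
  rw [unary₀_of_ne hn]
  refine delPrime_unary_eq_zero _ ?_
  simp only [Units.val_mk0, padicValRat.of_int, Nat.cast_eq_zero]
  exact padicValInt.eq_zero_of_not_dvd h

/-- Together with the case of n prime to p, this computes the residue of every squarefree integer,
hence of every rank one form over ℚ. -/
theorem delPrime_unary₀_mul {n : ℤ} (h : ¬ (p : ℤ) ∣ n) :
    delPrime p (unary₀ ((p * n : ℤ) : ℚ)) = unary₀ (n : ZMod p) := by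
  have hn : n ≠ 0 := by rintro rfl; simp at h
  have hu : ‖((n : ℤ_[p]) : ℚ_[p])‖ = 1 := by
    rw [PadicInt.coe_intCast]
    refine le_antisymm (Padic.norm_int_le_one n) (not_lt.1 fun hlt => h ?_)
    exact (Padic.norm_intCast_lt_one_iff).1 hlt
  have hpn : ((p * n : ℤ) : ℚ) ≠ 0 := by
    exact_mod_cast mul_ne_zero (by exact_mod_cast hp.1.ne_zero) hn
  rw [unary₀_of_ne hpn, delPrime, AddMonoidHom.comp_apply, WittGroup.baseChange_unary]
  have h1 := (secondResidue_spec p (PadicInt.mkUnits hu)).2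
  have h2 : Units.map (algebraMap ℚ ℚ_[p]).toMonoidHom (Units.mk0 _ hpn) =
      padicUniformizer p * padicUnit (PadicInt.mkUnits hu) := by
    ext
    have h3 : (padicUnit (PadicInt.mkUnits hu) : ℚ_[p]) = n := PadicInt.coe_intCast n
    rw [Units.val_mul, h3]
    simp [padicUniformizer]
  rw [h2, h1, ← unary₀_units]
  congr 1
  change PadicInt.toZMod (n : ℤ_[p]) = n
  exact map_intCast _ _

/-- Every class of a rank one form over `ℚ` is that of a squarefree integer of the same sign. -/
theorem exists_squarefree_unary (a : ℚˣ) : ∃ n : ℤ, Squarefree n ∧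
    unary a = unary₀ (n : ℚ) ∧ SignType.sign (a : ℚ) = SignType.sign n := by
  obtain ⟨m, b, h, hm⟩ := Nat.sq_mul_squarefree ((a : ℚ).num.natAbs * (a : ℚ).den)
  have ha : (a : ℚ) ≠ 0 := a.ne_zero
  have hd : (0 : ℚ) < (a : ℚ).den := by exact_mod_cast (a : ℚ).den_pos
  have hb0 : (b : ℚ) ≠ 0 := by
    rintro h0
    have : b = 0 := by exact_mod_cast h0
    subst this
    have : (a : ℚ).num.natAbs * (a : ℚ).den ≠ 0 := mul_ne_zero (by simp) (a : ℚ).den_nz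
    exact this (by rw [← h]; ring)
  have hnum : (a : ℚ) * (a : ℚ).den = (a : ℚ).num := Rat.mul_den_eq_num _
  -- Modulo squares, a is num · den, and |num| · den = b²m with m squarefree.
  have key : (((a : ℚ).num.sign * m : ℤ) : ℚ) * b ^ 2 = a * ((a : ℚ).den : ℚ) ^ 2 := by
    have h1 : ((b ^ 2 * m : ℕ) : ℚ) = ((a : ℚ).num.natAbs * (a : ℚ).den : ℕ) := by rw [h]
    have h3 : ((a : ℚ).num.sign * (a : ℚ).num.natAbs : ℤ) = (a : ℚ).num := Int.sign_mul_natAbs _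
    have h4 : (((a : ℚ).num.sign : ℤ) : ℚ) * ((a : ℚ).num.natAbs : ℚ) = (a : ℚ).num := by
      rw [← Int.cast_natCast, ← Int.cast_mul, h3]
    push_cast at h1 ⊢
    rw [pow_two ((a : ℚ).den : ℚ), ← mul_assoc, hnum, ← h4]
    linear_combination (((a : ℚ).num.sign : ℤ) : ℚ) * h1
  have hs : (a : ℚ).num.sign = 1 ∨ (a : ℚ).num.sign = -1 := by
    rcases lt_trichotomy (a : ℚ).num 0 with h | h | h
    · exact Or.inr (Int.sign_eq_neg_one_of_neg h)
    · exact absurd h (by simp)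
    · exact Or.inl (Int.sign_eq_one_of_pos h)
  have hm0 : 0 < (m : ℤ) := by exact_mod_cast Nat.pos_of_ne_zero hm.ne_zero
  refine ⟨(a : ℚ).num.sign * m, ?_, ?_, ?_⟩
  · rw [← Int.squarefree_natAbs]
    rcases hs with h | h <;> simpa [h] using hm
  · have hn0 : (((a : ℚ).num.sign * m : ℤ) : ℚ) ≠ 0 := by
      intro h0
      rw [h0, zero_mul] at key
      exact mul_ne_zero ha (pow_ne_zero 2 hd.ne') key.symm
    rw [← unary₀_units, ← unary₀_relations.sq _ _ ha hd.ne', ← key,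
      unary₀_relations.sq _ _ hn0 hb0]
  · have h5 : SignType.sign (a : ℚ) = SignType.sign ((a : ℚ).num) := by
      rcases lt_trichotomy (a : ℚ) 0 with h | h | h
      · rw [sign_neg h, sign_neg (Rat.num_neg.2 h)]
      · exact absurd h ha
      · rw [sign_pos h, sign_pos (Rat.num_pos.2 h)]
    rw [h5, sign_mul, sign_pos hm0, mul_one]
    rcases lt_trichotomy (a : ℚ).num 0 with h | h | h
    · simp [Int.sign_eq_neg_one_of_neg h, sign_neg h]
    · simp [h]
    · simp [Int.sign_eq_one_of_pos h, sign_pos h]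

theorem Squarefree.not_dvd_of_mul {n : ℤ} (h : Squarefree ((p : ℤ) * n)) : ¬ (p : ℤ) ∣ n := by
  rintro ⟨k, rfl⟩
  have := h p ⟨k, by ring⟩
  exact (Nat.prime_iff_prime_int.1 hp.1).not_isUnit this

/-- A squarefree integer has valuation 0 or 1 at p. This parity is the invariant that recovers which
primes divide the entries of a binary form from its boundary. -/
theorem rankParity_delPrime_unary₀ {n : ℤ} (h : Squarefree n) :
    rankParity (delPrime p (unary₀ (n : ℚ))) = if (p : ℤ) ∣ n then 1 else 0 := by
  split_ifs with hd
  · obtain ⟨m, rfl⟩ := hd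
    have hm := h.not_dvd_of_mul
    rw [delPrime_unary₀_mul hm, rankParity_unary₀]
    rwa [Ne, ZMod.intCast_zmod_eq_zero_iff_dvd]
  · rw [delPrime_unary₀_of_not_dvd hd, map_zero]

/-- The induction runs over rank one forms over ℚ, because the generation of the Witt group by such
forms is established only when 2 ≠ 0, which fails over 𝔽₂. -/
theorem delPrime_two_cases (x : WittGroup ℚ) :
    delPrime 2 x = 0 ∨ delPrime 2 x = unary₀ (1 : ZMod 2) := by
  refine unary_induction two_ne_zero
    (p := fun x => delPrime 2 x = 0 ∨ delPrime 2 x = unary₀ (1 : ZMod 2))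
    (Or.inl (map_zero _)) (fun a x hx => ?_) x
  obtain ⟨n, hn, h, -⟩ := exists_squarefree_unary a
  have h1 : delPrime 2 (unary a) = 0 ∨ delPrime 2 (unary a) = unary₀ (1 : ZMod 2) := by
    rw [h]
    by_cases hd : ((2 : ℕ) : ℤ) ∣ n
    · obtain ⟨m, rfl⟩ := hd
      have hm := hn.not_dvd_of_mul
      rw [delPrime_unary₀_mul hm]
      exact Or.inr (unary₀_two _ (by rwa [Ne, ZMod.intCast_zmod_eq_zero_iff_dvd]))
    · exact Or.inl (delPrime_unary₀_of_not_dvd hd)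
  rw [map_add]
  rcases h1 with h1 | h1 <;> rcases hx with hx | hx <;> rw [h1, hx]
  · exact Or.inl (add_zero _)
  · exact Or.inr (zero_add _)
  · exact Or.inr (add_zero _)
  · exact Or.inl (unary₀_two_add _ _ one_ne_zero one_ne_zero)

end

/-! ### Auxiliary primes from Dirichlet's theorem and reciprocity. -/

theorem jacobiSym_prod_left {ι : Type} (T : Finset ι) (f : ι → ℤ) (l : ℕ) :
    jacobiSym (∏ p ∈ T, f p) l = ∏ p ∈ T, jacobiSym (f p) l := by
  classical
  induction T using Finset.induction_on with
  | empty => simp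
  | insert p T hp ih => rw [Finset.prod_insert hp, Finset.prod_insert hp, jacobiSym.mul_left, ih]

/-- A prime `ℓ ≡ 1 mod 4` with prescribed residues modulo the odd primes in `T`, such that twice
the product of `T` is a square modulo `ℓ`. -/
theorem exists_prime_prescribed (T : Finset ℕ) (hT : ∀ p ∈ T, p.Prime ∧ p ≠ 2) (c : ℕ → ℕ)
    (hc : ∀ p ∈ T, (c p).Coprime p) :
    ∃ l : ℕ, l.Prime ∧ l % 4 = 1 ∧ l ∉ T ∧ (∀ p ∈ T, l ≡ c p [MOD p]) ∧
      IsSquare ((2 * ∏ p ∈ T, p : ℕ) : ZMod l) := by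
  have h8T : 8 ∉ T := fun h => absurd (hT 8 h).1 (by norm_num)
  have hodd : ∀ p ∈ T, Odd p := fun p hp => (hT p hp).1.odd_of_ne_two (hT p hp).2
  -- The classes 1 and 5 modulo 8 are both 1 modulo 4 but have opposite values of χ₈, so e can
  -- compensate the sign of the product of the prescribed symbols.
  obtain ⟨e, he, hχ⟩ : ∃ e : ℕ, (e = 1 ∨ e = 5) ∧
      (ZMod.χ₈ e : ℤ) * ∏ p ∈ T, jacobiSym (c p) p = 1 := by
    have h1 : (∏ p ∈ T, jacobiSym (c p) p) ^ 2 = 1 := by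
      rw [← Finset.prod_pow]
      refine Finset.prod_eq_one fun p hp => jacobiSym.sq_one ?_
      simpa using hc p hp
    rcases mul_self_eq_one_iff.1 ((sq _).symm.trans h1) with h | h
    · exact ⟨1, Or.inl rfl, by rw [h]; decide⟩
    · exact ⟨5, Or.inr rfl, by rw [h]; decide⟩
  -- The congruences are indexed by their moduli, the primes of T and 8. The slot 8 is free because
  -- T contains only primes.
  let a : ℕ → ℕ := fun i => if i = 8 then e else c i
  have hcop : Set.Pairwise (insert 8 T : Finset ℕ) (Function.onFun Nat.Coprime id) := by
    have h8 : ∀ p ∈ T, Nat.Coprime 8 p := fun p hp => by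
      rw [show 8 = 2 ^ 3 by norm_num]
      exact Nat.Coprime.pow_left _ (Nat.coprime_two_left.2 (hodd p hp))
    intro i hi j hj hij
    rw [Finset.mem_coe, Finset.mem_insert] at hi hj
    rcases hi with rfl | hi <;> rcases hj with rfl | hj
    · exact absurd rfl hij
    · exact h8 _ hj
    · exact (h8 _ hi).symm
    · exact (Nat.coprime_primes (hT i hi).1 (hT j hj).1).2 hij
  obtain ⟨r, hr⟩ := Nat.chineseRemainderOfFinset a id (insert 8 T) (fun i hi => by
    rcases Finset.mem_insert.1 hi with rfl | hi
    · norm_num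
    · exact (hT i hi).1.ne_zero) hcop
  have hr8 : r ≡ e [MOD 8] := by
    have := hr 8 (Finset.mem_insert_self _ _)
    simpa [a] using this
  have hrp : ∀ p ∈ T, r ≡ c p [MOD p] := fun p hp => by
    have := hr p (Finset.mem_insert_of_mem hp)
    have h9 : p ≠ 8 := fun h => h8T (h ▸ hp)
    simpa [a, h9] using this
  let N := 8 * ∏ p ∈ T, p
  have hT0 : ∏ p ∈ T, p ≠ 0 := Finset.prod_ne_zero_iff.2 fun p hp => (hT p hp).1.ne_zero
  have : NeZero N := ⟨mul_ne_zero (by norm_num) hT0⟩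
  have hrN : IsUnit (r : ZMod N) := by
    rw [ZMod.isUnit_iff_coprime]
    refine Nat.Coprime.mul_right ?_ (Nat.Coprime.prod_right fun p hp => ?_)
    · rw [Nat.Coprime, hr8.gcd_eq]
      rcases he with rfl | rfl <;> norm_num
    · rw [Nat.Coprime, (hrp p hp).gcd_eq]
      exact hc p hp
  -- Dirichlet's theorem; asking for l > N keeps l out of T, whose members divide N.
  obtain ⟨l, hl, hlp, hlr⟩ := Nat.forall_exists_prime_gt_and_eq_mod hrN N
  have hlr : l ≡ r [MOD N] := (ZMod.natCast_eq_natCast_iff _ _ _).1 hlr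
  have hl8 : l ≡ e [MOD 8] := (hlr.of_mul_right _).trans hr8
  have hlp' : ∀ p ∈ T, l ≡ c p [MOD p] := fun p hp =>
    (hlr.of_dvd ((Finset.dvd_prod_of_mem _ hp).mul_left _)).trans (hrp p hp)
  have hl4 : l % 4 = 1 := by
    have := hl8.of_dvd (show 4 ∣ 8 by norm_num)
    rcases he with rfl | rfl <;> simpa [Nat.ModEq] using this
  have hlT : l ∉ T := fun h => by
    have h1 : l ≤ N := Nat.le_of_dvd (Nat.pos_of_ne_zero (NeZero.ne N))
      ((Finset.dvd_prod_of_mem _ h).mul_left _)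
    omega
  refine ⟨l, hlp, hl4, hlT, hlp', ?_⟩
  have : Fact l.Prime := ⟨hlp⟩
  have hlodd : Odd l := Nat.odd_iff.2 (by omega)
  have hJ : jacobiSym ((2 * ∏ p ∈ T, p : ℕ) : ℤ) l = 1 := by
    push_cast
    rw [jacobiSym.mul_left, jacobiSym.at_two hlodd]
    rw [jacobiSym_prod_left, ← hχ]
    congr 1
    · rw [(ZMod.natCast_eq_natCast_iff _ _ _).2 hl8]
    · refine Finset.prod_congr rfl fun p hp => ?_
      -- Since l ≡ 1 mod 4, each (p/l) equals (l/p), which was prescribed through c.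
      rw [← jacobiSym.quadratic_reciprocity_one_mod_four hl4 (hodd p hp)]
      refine jacobiSym.mod_left' ?_
      exact_mod_cast hlp' p hp
  simpa using ZMod.isSquare_of_jacobiSym_eq_one hJ

theorem exists_prime_prescribed_primes (T : Finset Nat.Primes) (hT : ∀ p ∈ T, (p : ℕ) ≠ 2)
    (c : ∀ p : Nat.Primes, ZMod p) (hc : ∀ p ∈ T, c p ≠ 0) :
    ∃ l : Nat.Primes, (l : ℕ) % 4 = 1 ∧ l ∉ T ∧ (∀ p ∈ T, ((l : ℕ) : ZMod p) = c p) ∧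
      IsSquare ((2 * ∏ p ∈ T, (p : ℕ) : ℕ) : ZMod l) := by
  -- The value 0 at non-primes is never consulted.
  let c' : ℕ → ℕ := fun n => if h : n.Prime then (c ⟨n, h⟩).val else 0
  have hc' : ∀ p : Nat.Primes, c' p = (c p).val := fun p => dif_pos p.2
  obtain ⟨l, hl, h4, hlT, hlc, hsq⟩ := exists_prime_prescribed
    (T.map ⟨fun p : Nat.Primes => (p : ℕ), Subtype.val_injective⟩) (fun p hp => by
      obtain ⟨q, hq, rfl⟩ := Finset.mem_map.1 hp
      exact ⟨q.2, hT q hq⟩) c' (fun p hp => by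
      obtain ⟨q, hq, rfl⟩ := Finset.mem_map.1 hp
      change (c' q).Coprime q
      rw [hc', Nat.coprime_comm, q.2.coprime_iff_not_dvd, ← ZMod.natCast_eq_zero_iff]
      simpa using hc q hq)
  refine ⟨⟨l, hl⟩, h4, fun h => hlT (Finset.mem_map.2 ⟨_, h, rfl⟩), fun p hp => ?_, ?_⟩
  · have h1 := hlc p (Finset.mem_map.2 ⟨p, hp, rfl⟩)
    have h2 := (ZMod.natCast_eq_natCast_iff _ _ _).2 h1
    rw [hc'] at h2
    simpa using h2
  · rwa [Finset.prod_map] at hsq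

/-! ### Ternary forms with prescribed boundary and signs. -/

section Ternary

open WittGroup

theorem natPrimes_dvd_prod_iff (S : Finset Nat.Primes) (q : Nat.Primes) :
    ((q : ℕ) : ℤ) ∣ ∏ p ∈ S, ((p : ℕ) : ℤ) ↔ q ∈ S := by
  rw [(Nat.prime_iff_prime_int.1 q.2).dvd_finsetProd_iff]
  constructor
  · rintro ⟨p, hp, h⟩
    have h1 : (q : ℕ) ∣ p := by exact_mod_cast h
    have h2 : q = p := Subtype.ext ((Nat.prime_dvd_prime_iff_eq q.2 p.2).1 h1)
    exact h2 ▸ hp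
  · exact fun h => ⟨q, h, dvd_rfl⟩

theorem isSquare_neg_one_of_mod_four {l : Nat.Primes} (h : (l : ℕ) % 4 = 1) :
    IsSquare (-1 : ZMod l) :=
  ZMod.exists_sq_eq_neg_one_iff.2 (by omega)

/-- This makes the prescribed signs irrelevant for the residue at the auxiliary prime. -/
theorem isSquare_intCast_of_isUnit {l : Nat.Primes} (h : (l : ℕ) % 4 = 1) {e : ℤ}
    (he : IsUnit e) : IsSquare (e : ZMod l) := by
  rcases Int.isUnit_iff.1 he with rfl | rfl
  · simp
  · simpa using isSquare_neg_one_of_mod_four h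

/-- Every family of residues is that of a ternary form with prescribed signs. -/
theorem exists_ternary_delPrime_eq (x : WittGroup ℚ) {e₁ e₂ e₃ : ℤ} (h₁ : IsUnit e₁)
    (h₂ : IsUnit e₂) (h₃ : IsUnit e₃) :
    ∃ a b c : ℤ, 0 < a ∧ 0 < b ∧ 0 < c ∧ ∀ q : Nat.Primes,
      delPrime q (unary₀ ((e₁ * a : ℤ) : ℚ) + unary₀ ((e₂ * b : ℤ) : ℚ) +
        unary₀ ((e₃ * c : ℤ) : ℚ)) = delPrime q x := by
  classical
  obtain ⟨S, hS⟩ : ∃ S : Finset Nat.Primes, ∀ p, p ∈ S ↔ delPrime p x ≠ 0 :=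
    ⟨(finite_delPrime_ne_zero x).toFinset, fun p => by simp⟩
  obtain ⟨S₁, hS₁⟩ : ∃ S₁ : Finset Nat.Primes, ∀ p, p ∈ S₁ ↔ (p : ℕ) ≠ 2 ∧
      ∃ u : ZMod p, u ≠ 0 ∧ delPrime p x = unary₀ u :=
    ⟨S.filter fun p => (p : ℕ) ≠ 2 ∧ ∃ u : ZMod p, u ≠ 0 ∧ delPrime p x = unary₀ u, fun p => by
      rw [Finset.mem_filter, hS, and_iff_right_iff_imp]
      rintro ⟨-, u, hu, h⟩
      rw [h]
      exact unary₀_ne_zero hu⟩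
  -- By `finite_cases`, the primes of S₂ are those where the residue is the anisotropic binary
  -- class.
  obtain ⟨S₂, hS₂⟩ : ∃ S₂ : Finset Nat.Primes, ∀ p, p ∈ S₂ ↔ (p : ℕ) ≠ 2 ∧
      delPrime p x ≠ 0 ∧ p ∉ S₁ :=
    ⟨S.filter fun p => (p : ℕ) ≠ 2 ∧ p ∉ S₁, fun p => by
      rw [Finset.mem_filter, hS]; tauto⟩
  have hdisj : Disjoint S₁ S₂ := Finset.disjoint_left.2 fun p h h' => ((hS₂ p).1 h').2.2 h
  -- k enters the first two entries and k' the third. If the residue at 2 is trivial, the factor 2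
  -- goes into both of the first two entries, whose residues cancel in W(𝔽₂); otherwise only into
  -- the third. In both cases k k' = 2, so the condition at l always contains the factor 2 whose
  -- symbol is free.
  obtain ⟨k, k', hk, hk2⟩ : ∃ k k' : ℤ, (k = 2 ∧ k' = 1 ∧ delPrime 2 x = 0 ∨
      k = 1 ∧ k' = 2 ∧ delPrime 2 x = unary₀ (1 : ZMod 2)) ∧ k * k' = 2 := by
    rcases delPrime_two_cases x with h | h
    · exact ⟨2, 1, Or.inl ⟨rfl, rfl, h⟩, rfl⟩
    · exact ⟨1, 2, Or.inr ⟨rfl, rfl, h⟩, rfl⟩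
  have hk0 : 0 < k ∧ 0 < k' := by omega
  have hPr : ∀ q : Nat.Primes, Prime ((q : ℕ) : ℤ) := fun q => Nat.prime_iff_prime_int.1 q.2
  have hUn : ∀ (q : Nat.Primes) {e : ℤ}, IsUnit e → ¬ ((q : ℕ) : ℤ) ∣ e := fun q e he h =>
    (hPr q).not_isUnit (isUnit_of_dvd_unit h he)
  have hqk : ∀ q : Nat.Primes, (q : ℕ) ≠ 2 → ¬ ((q : ℕ) : ℤ) ∣ k ∧ ¬ ((q : ℕ) : ℤ) ∣ k' := by
    intro q hq
    have h2 : ¬ ((q : ℕ) : ℤ) ∣ 2 := fun h => hq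
      ((Nat.prime_dvd_prime_iff_eq q.2 Nat.prime_two).1 (by exact_mod_cast h))
    rw [← hk2] at h2
    exact ⟨fun h => h2 (h.mul_right _), fun h => h2 (h.mul_left _)⟩
  have hcast : ∀ (q : Nat.Primes) (n : ℤ), (n : ZMod q) ≠ 0 ↔ ¬ ((q : ℕ) : ℤ) ∣ n := fun q n => by
    rw [Ne, ZMod.intCast_zmod_eq_zero_iff_dvd]
  let d : Finset Nat.Primes → ℤ := fun S => ∏ p ∈ S, ((p : ℕ) : ℤ)
  have hd : ∀ S (q : Nat.Primes), ((q : ℕ) : ℤ) ∣ d S ↔ q ∈ S := natPrimes_dvd_prod_iff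
  have hd0 : ∀ S, 0 < d S := fun S => Finset.prod_pos fun p _ => by exact_mod_cast p.2.pos
  have hde : ∀ (S : Finset Nat.Primes), ∀ q ∈ S, d S = (q : ℕ) * d (S.erase q) := fun S q hq =>
    (Finset.mul_prod_erase S _ hq).symm
  -- z is the class that l must have modulo p. On S₁ only the third entry is divisible by p, and z
  -- fixes its residue; on S₂ only the first two are, and z fixes the discriminant of the residue.
  have hz : ∀ p : Nat.Primes, ∃ z : ZMod p, (p ∈ S₁ ∪ S₂ → z ≠ 0) ∧
      (p ∈ S₁ → unary₀ (((e₃ * k' * d (S₁.erase p) : ℤ) : ZMod p) * z) = delPrime p x) ∧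
      (p ∈ S₂ → unary₀ ((e₁ * k * d (S₂.erase p) : ℤ) : ZMod p) +
        unary₀ (((e₂ * k * d (S₂.erase p) : ℤ) : ZMod p) * z) = delPrime p x) := by
    intro p
    by_cases hp1 : p ∈ S₁
    · obtain ⟨hp2, u, hu, hpu⟩ := (hS₁ p).1 hp1
      have h0 : ((e₃ * k' * d (S₁.erase p) : ℤ) : ZMod p) ≠ 0 := by
        rw [hcast, (hPr p).dvd_mul, (hPr p).dvd_mul, hd]
        simp [hUn p h₃, (hqk p hp2).2]
      refine ⟨u / ((e₃ * k' * d (S₁.erase p) : ℤ) : ZMod p), fun _ => div_ne_zero hu h0,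
        fun _ => ?_, fun h => absurd hp1 ((hS₂ p).1 h).2.2⟩
      rw [mul_div_cancel₀ _ h0, hpu]
    by_cases hp : p ∈ S₂
    · obtain ⟨hp2, hne, -⟩ := (hS₂ p).1 hp
      obtain ⟨n, hn⟩ := exists_not_isSquare hp2
      have hn0 : n ≠ 0 := by rintro rfl; simp at hn
      have h1 : ((e₁ * k * d (S₂.erase p) : ℤ) : ZMod p) ≠ 0 := by
        rw [hcast, (hPr p).dvd_mul, (hPr p).dvd_mul, hd]
        simp [hUn p h₁, (hqk p hp2).1]
      have h2 : ((e₂ * k * d (S₂.erase p) : ℤ) : ZMod p) ≠ 0 := by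
        rw [hcast, (hPr p).dvd_mul, (hPr p).dvd_mul, hd]
        simp [hUn p h₂, (hqk p hp2).1]
      generalize ((e₁ * k * d (S₂.erase p) : ℤ) : ZMod p) = α at *
      generalize ((e₂ * k * d (S₂.erase p) : ℤ) : ZMod p) = β at *
      -- With this z the negated product of α and βz is the nonsquare n, so the residue is the
      -- anisotropic class.
      refine ⟨-n / (α * β), fun _ => div_ne_zero (neg_ne_zero.2 hn0) (mul_ne_zero h1 h2),
        fun h => absurd h hp1, fun _ => Eq.symm ?_⟩
      rcases finite_cases hp2 (delPrime p x) with h | h | h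
      · exact absurd h hne
      · exact absurd ((hS₁ p).2 ⟨hp2, h⟩) hp1
      · refine h _ _ ?_
        convert hn using 1
        field_simp
    · exact ⟨0, fun h => ((Finset.mem_union.1 h).elim hp1 hp).elim, fun h => absurd h hp1,
      fun h => absurd h hp⟩
  choose z hz0 hz1 hz2 using hz
  obtain ⟨l, hl4, hlT, hlz, hsq⟩ := exists_prime_prescribed_primes (S₁ ∪ S₂) (fun p hp => by
    rcases Finset.mem_union.1 hp with hp | hp
    · exact ((hS₁ p).1 hp).1
    · exact ((hS₂ p).1 hp).1) z hz0
  have hl1 : l ∉ S₁ := fun h => hlT (Finset.mem_union_left _ h)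
  have hl2 : l ∉ S₂ := fun h => hlT (Finset.mem_union_right _ h)
  have hl0 : (0 : ℤ) < (l : ℕ) := by exact_mod_cast l.2.pos
  have hlne : (l : ℕ) ≠ 2 := by omega
  have hql : ∀ q : Nat.Primes, q ≠ l → ¬ ((q : ℕ) : ℤ) ∣ (l : ℕ) := fun q hq h => hq
    (Subtype.ext ((Nat.prime_dvd_prime_iff_eq q.2 l.2).1 (by exact_mod_cast h)))
  -- A prime of S₁ divides one entry; a prime of S₂ divides two; l divides two, whose residues must
  -- cancel.
  refine ⟨k * d S₂, k * d S₂ * (l : ℕ), (l : ℕ) * k' * d S₁, mul_pos hk0.1 (hd0 _),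
    mul_pos (mul_pos hk0.1 (hd0 _)) hl0, mul_pos (mul_pos hl0 hk0.2) (hd0 _), fun q => ?_⟩
  rw [map_add, map_add]
  have hdm : ∀ a b : ℤ, ((q : ℕ) : ℤ) ∣ a * b ↔ ((q : ℕ) : ℤ) ∣ a ∨ ((q : ℕ) : ℤ) ∣ b :=
    fun a b => (hPr q).dvd_mul
  by_cases hq2 : (q : ℕ) = 2
  · have hq1 : q ∉ S₁ := fun h => ((hS₁ q).1 h).1 hq2
    have hq3 : q ∉ S₂ := fun h => ((hS₂ q).1 h).1 hq2
    have hl : q ≠ l := fun h => hlne (h ▸ hq2)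
    have hn1 : ¬ ((q : ℕ) : ℤ) ∣ e₁ * d S₂ := by
      rw [hdm, hd]; simp [hUn q h₁, hq3]
    have hn2 : ¬ ((q : ℕ) : ℤ) ∣ e₂ * d S₂ * (l : ℕ) := by
      rw [hdm, hdm, hd]; simp [hUn q h₂, hq3, hql q hl]
    have hn3 : ¬ ((q : ℕ) : ℤ) ∣ e₃ * (l : ℕ) * d S₁ := by
      rw [hdm, hdm, hd]; simp [hUn q h₃, hq1, hql q hl]
    obtain rfl : q = ⟨2, Nat.prime_two⟩ := Subtype.ext hq2
    have hv : (((⟨2, Nat.prime_two⟩ : Nat.Primes) : ℕ) : ℤ) = 2 := rfl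
    rcases hk with ⟨rfl, rfl, hx⟩ | ⟨rfl, rfl, hx⟩
    · rw [delPrime_unary₀_of_not_dvd (n := e₃ * _) (by convert hn3 using 2; ring), add_zero,
        show e₁ * (2 * d S₂) = ((⟨2, Nat.prime_two⟩ : Nat.Primes) : ℕ) * (e₁ * d S₂) by
          rw [hv]; ring,
        show e₂ * (2 * d S₂ * (l : ℕ)) =
          ((⟨2, Nat.prime_two⟩ : Nat.Primes) : ℕ) * (e₂ * d S₂ * (l : ℕ)) by rw [hv]; ring,
        delPrime_unary₀_mul hn1, delPrime_unary₀_mul hn2]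
      exact (unary₀_two_add _ _ ((hcast _ _).2 hn1) ((hcast _ _).2 hn2)).trans hx.symm
    · rw [delPrime_unary₀_of_not_dvd (n := e₁ * _) (by convert hn1 using 2; ring),
        delPrime_unary₀_of_not_dvd (n := e₂ * _) (by convert hn2 using 2; ring),
        add_zero, zero_add,
        show e₃ * ((l : ℕ) * 2 * d S₁) =
          ((⟨2, Nat.prime_two⟩ : Nat.Primes) : ℕ) * (e₃ * (l : ℕ) * d S₁) by rw [hv]; ring,
        delPrime_unary₀_mul hn3]
      exact (unary₀_two _ ((hcast _ _).2 hn3)).trans hx.symm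
  obtain ⟨hqk, hqk'⟩ := hqk q hq2
  by_cases hq : q = l
  · subst hq
    have hx0 : delPrime q x = 0 := by
      by_contra h
      exact hl2 ((hS₂ q).2 ⟨hq2, h, hl1⟩)
    have hn1 : ¬ ((q : ℕ) : ℤ) ∣ e₂ * (k * d S₂) := by
      rw [hdm, hdm, hd]; simp [hUn q h₂, hqk, hl2]
    have hn2 : ¬ ((q : ℕ) : ℤ) ∣ e₃ * (k' * d S₁) := by
      rw [hdm, hdm, hd]; simp [hUn q h₃, hqk', hl1]
    rw [hx0, delPrime_unary₀_of_not_dvd (by rw [hdm, hdm, hd]; simp [hUn q h₁, hqk, hl2]),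
      zero_add, show e₂ * (k * d S₂ * (q : ℕ)) = (q : ℕ) * (e₂ * (k * d S₂)) by ring,
      show e₃ * ((q : ℕ) * k' * d S₁) = (q : ℕ) * (e₃ * (k' * d S₁)) by ring,
      delPrime_unary₀_mul hn1, delPrime_unary₀_mul hn2,
      unary₀_add_eq_zero_iff ((hcast _ _).2 hn1) ((hcast _ _).2 hn2)]
    -- The residues at l are e₂kD₂ and e₃k'D₁. They cancel because their negated product -e₂e₃ ·
    -- 2D₁D₂ is a square modulo l, by the choice of l.
    have h1 : (2 * ∏ p ∈ S₁ ∪ S₂, ((p : ℕ) : ℤ)) = k * k' * (d S₁ * d S₂) := by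
      rw [hk2, Finset.prod_union hdisj]
    have h2 : IsSquare ((k * k' * (d S₁ * d S₂) : ℤ) : ZMod q) := by
      rw [← h1]; simpa using hsq
    have h3 := ((isSquare_intCast_of_isUnit hl4 (h₂.mul h₃).neg).mul h2)
    have h4 : -(((e₂ * (k * d S₂) : ℤ) : ZMod q) * ((e₃ * (k' * d S₁) : ℤ) : ZMod q)) =
        ((-(e₂ * e₃) : ℤ) : ZMod q) * ((k * k' * (d S₁ * d S₂) : ℤ) : ZMod q) := by
      push_cast
      ring
    rw [h4]
    exact h3
  by_cases hq1 : q ∈ S₁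
  · have hq3 : q ∉ S₂ := Finset.disjoint_left.1 hdisj hq1
    have hn : ¬ ((q : ℕ) : ℤ) ∣ e₃ * (l : ℕ) * k' * d (S₁.erase q) := by
      rw [hdm, hdm, hdm, hd]; simp [hUn q h₃, hqk', hql q hq]
    rw [← hz1 q hq1, ← hlz q (Finset.mem_union_left _ hq1),
      delPrime_unary₀_of_not_dvd (by rw [hdm, hdm, hd]; simp [hUn q h₁, hqk, hq3]),
      delPrime_unary₀_of_not_dvd (by rw [hdm, hdm, hdm, hd]; simp [hUn q h₂, hqk, hq3, hql q hq]),
      zero_add, zero_add, hde S₁ q hq1,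
      show e₃ * ((l : ℕ) * k' * ((q : ℕ) * d (S₁.erase q))) =
        (q : ℕ) * (e₃ * (l : ℕ) * k' * d (S₁.erase q)) by ring, delPrime_unary₀_mul hn]
    congr 1
    push_cast
    ring
  by_cases hq3 : q ∈ S₂
  · have hn1 : ¬ ((q : ℕ) : ℤ) ∣ e₁ * k * d (S₂.erase q) := by
      rw [hdm, hdm, hd]; simp [hUn q h₁, hqk]
    have hn2 : ¬ ((q : ℕ) : ℤ) ∣ e₂ * k * (l : ℕ) * d (S₂.erase q) := by
      rw [hdm, hdm, hdm, hd]; simp [hUn q h₂, hqk, hql q hq]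
    rw [← hz2 q hq3, ← hlz q (Finset.mem_union_right _ hq3),
      delPrime_unary₀_of_not_dvd (n := e₃ * _)
        (by rw [hdm, hdm, hdm, hd]; simp [hUn q h₃, hqk', hq1, hql q hq]),
      add_zero, hde S₂ q hq3,
      show e₁ * (k * ((q : ℕ) * d (S₂.erase q))) = (q : ℕ) * (e₁ * k * d (S₂.erase q)) by ring,
      show e₂ * (k * ((q : ℕ) * d (S₂.erase q)) * (l : ℕ)) =
        (q : ℕ) * (e₂ * k * (l : ℕ) * d (S₂.erase q)) by ring,
      delPrime_unary₀_mul hn1, delPrime_unary₀_mul hn2]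
    congr 2
    push_cast
    ring
  · have hx0 : delPrime q x = 0 := by
      by_contra h
      exact hq3 ((hS₂ q).2 ⟨hq2, h, hq1⟩)
    rw [hx0, delPrime_unary₀_of_not_dvd (by rw [hdm, hdm, hd]; simp [hUn q h₁, hqk, hq3]),
      delPrime_unary₀_of_not_dvd (by rw [hdm, hdm, hdm, hd]; simp [hUn q h₂, hqk, hq3, hql q hq]),
      delPrime_unary₀_of_not_dvd
        (by rw [hdm, hdm, hdm, hd]; simp [hUn q h₃, hqk', hq1, hql q hq]), add_zero, add_zero]

end Ternary

/-! ### The Witt span and the four characterizations. -/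

section WittSpan

open WittGroup

theorem del_eq_iff (x y : WittGroup ℚ) :
    del x = del y ↔ ∀ q : Nat.Primes, delPrime q x = delPrime q y := by
  constructor
  · intro h q
    rw [← del_apply, h, del_apply]
  · intro h
    refine DFinsupp.ext fun q => ?_
    exact (del_apply x q).trans ((h q).trans (del_apply y q).symm)

theorem del_unary_one : del (WittGroup.mk (SymForm.unary (1 : ℚˣ))) = 0 := by
  rw [← map_zero del, del_eq_iff]
  intro q
  rw [map_zero]
  exact delPrime_unary_eq_zero _ (by simp)

theorem del_unary_neg_one : del (WittGroup.mk (SymForm.unary (-1 : ℚˣ))) = 0 := by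
  have h := congrArg del (SymForm.mk_unary_add_mk_unary_neg (1 : ℚˣ))
  rw [map_add, map_zero, WittGroup.unary, WittGroup.unary, del_unary_one, zero_add] at h
  exact h

theorem del_sum_unary_one (A : SymForm ℚ) :
    del (WittGroup.mk (A.sum (SymForm.unary 1))) = del (WittGroup.mk A) := by
  rw [mk_sum, map_add, del_unary_one, add_zero]

theorem del_sum_unary_neg_one (A : SymForm ℚ) :
    del (WittGroup.mk (A.sum (SymForm.unary (-1)))) = del (WittGroup.mk A) := by
  rw [mk_sum, map_add, del_unary_neg_one, add_zero]

theorem rank_sum_unary (A : SymForm ℚ) (a : ℚˣ) :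
    (A.sum (SymForm.unary a)).rank = A.rank + 1 := by
  rw [SymForm.rank_sum, SymForm.rank_unary]

theorem exists_rank_eq_wittSpan (x : WittGroup ℚ) :
    ∃ A : SymForm ℚ, del (WittGroup.mk A) = del x ∧ A.rank = wittSpan x :=
  Nat.sInf_mem (s := {n : ℕ | ∃ B' : SymForm ℚ, del (WittGroup.mk B') = del x ∧ B'.rank = n})
    (WittGroup.ind (p := fun x => {n : ℕ | ∃ B' : SymForm ℚ,
      del (WittGroup.mk B') = del x ∧ B'.rank = n}.Nonempty) (fun B => ⟨B.rank, B, rfl, rfl⟩) x)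

theorem wittSpan_le {x : WittGroup ℚ} {A : SymForm ℚ} (h : del (WittGroup.mk A) = del x) :
    wittSpan x ≤ A.rank := Nat.sInf_le ⟨A, h, rfl⟩

/-- Forms of nearly minimal rank are anisotropic. -/
theorem anisotropic_of_rank_le {x : WittGroup ℚ} {A : SymForm ℚ}
    (h : del (WittGroup.mk A) = del x) (hr : A.rank ≤ wittSpan x + 1) : A.Anisotropic := by
  by_contra hA
  obtain ⟨A', h1, h2⟩ := A.exists_rank_add_two two_ne_zero hA
  have := wittSpan_le (x := x) (A := A') (by rw [h2, h])
  omega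

theorem not_anisotropic_sum_one_sum_neg_one (A : SymForm ℚ) :
    ¬ ((A.sum (SymForm.unary 1)).sum (SymForm.unary (-1))).Anisotropic := by
  intro h
  have h1 : (((0 : A.V), (1 : ℚ)), (1 : ℚ)) = 0 := h _ (by
    change (A.form 0 0 + (1 : ℚ) * (1 * 1)) + (-1 : ℚ) * (1 * 1) = 0
    simp)
  exact one_ne_zero (congrArg Prod.snd h1)

theorem not_anisotropic_sum_neg_one_sum_one (A : SymForm ℚ) :
    ¬ ((A.sum (SymForm.unary (-1))).sum (SymForm.unary 1)).Anisotropic := by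
  intro h
  have h1 : (((0 : A.V), (1 : ℚ)), (1 : ℚ)) = 0 := h _ (by
    change (A.form 0 0 + (-1 : ℚ) * (1 * 1)) + (1 : ℚ) * (1 * 1) = 0
    simp)
  exact one_ne_zero (congrArg Prod.snd h1)

theorem wittSpan_eq_zero_iff (x : WittGroup ℚ) : wittSpan x = 0 ↔ del x = 0 := by
  constructor
  · intro h
    obtain ⟨A, h1, h2⟩ := exists_rank_eq_wittSpan x
    rw [← h1, mk_metabolic ⟨0, ⊥, h2.trans h, finrank_bot _ _, by simp⟩, map_zero]
  · intro h
    have := wittSpan_le (x := x) (A := SymForm.zero) (by rw [h, mk_zero, map_zero])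
    rwa [SymForm.rank_zero, Nat.le_zero] at this

variable {B : SymForm ℚ}

theorem IsPreimageForm.mem {r : ℕ} {i : ℤ} {A : SymForm ℚ} (h : IsPreimageForm B r i A) :
    i ∈ signatureSet B r := ⟨A, h⟩

theorem mem_signatureSet_of_rank_le {A : SymForm ℚ}
    (h : del (WittGroup.mk A) = del (WittGroup.mk B))
    (hr : A.rank ≤ wittSpan (WittGroup.mk B) + 1) : A.signature ∈ signatureSet B A.rank :=
  ⟨A, rfl, anisotropic_of_rank_le h hr, h, rfl⟩

/-- All forms of minimal rank stay anisotropic after adding `⟨1⟩` or `⟨-1⟩`. -/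
theorem IsPreimageForm.anisotropic_sum {i : ℤ} {A : SymForm ℚ}
    (h : IsPreimageForm B (wittSpan (WittGroup.mk B)) i A) :
    (A.sum (SymForm.unary 1)).Anisotropic ∧ (A.sum (SymForm.unary (-1))).Anisotropic := by
  obtain ⟨h1, -, h3, -⟩ := h
  constructor
  · exact anisotropic_of_rank_le ((del_sum_unary_one A).trans h3) (by rw [rank_sum_unary, h1])
  · exact anisotropic_of_rank_le ((del_sum_unary_neg_one A).trans h3) (by rw [rank_sum_unary, h1])

theorem wittSpan_le_of_nonempty {r : ℕ} (h : (signatureSet B r).Nonempty) :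
    wittSpan (WittGroup.mk B) ≤ r := by
  obtain ⟨i, A, h1, -, h3, -⟩ := h
  exact h1 ▸ wittSpan_le h3

/-- If all forms of rank `r` stay anisotropic after adding `⟨1⟩` or `⟨-1⟩`, then the Witt span is
not `r - 1`. -/
theorem wittSpan_add_one_ne {r : ℕ} (h : ∀ i ∈ signatureSet B r, ∀ A : SymForm ℚ,
    IsPreimageForm B r i A →
      (A.sum (SymForm.unary 1)).Anisotropic ∧ (A.sum (SymForm.unary (-1))).Anisotropic) :
    wittSpan (WittGroup.mk B) + 1 ≠ r := by
  rintro hr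
  obtain ⟨A, h1, h2⟩ := exists_rank_eq_wittSpan (WittGroup.mk B)
  have h3 := (del_sum_unary_one A).trans h1
  have h4 : (A.sum (SymForm.unary 1)).rank = r := by rw [rank_sum_unary, h2, hr]
  -- The form A ⊕ ⟨1⟩ exceeds the Witt span by one, which is still too little for it to be
  -- isotropic.
  have h5 : IsPreimageForm B r _ _ := ⟨h4, anisotropic_of_rank_le h3 (by omega), h3, rfl⟩
  exact not_anisotropic_sum_one_sum_neg_one A (h _ h5.mem _ h5).2

/-- A positive definite form plus `⟨1⟩` is positive definite. -/
theorem posDef_sum_unary {A : SymForm ℚ} (hA : ∀ x, x ≠ 0 → 0 < A.form x x) {a : ℚˣ}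
    (ha : 0 < (a : ℚ)) (x : (A.sum (SymForm.unary a)).V) (hx : x ≠ 0) :
    0 < (A.sum (SymForm.unary a)).form x x := by
  obtain ⟨y, (t : ℚ)⟩ := x
  change 0 < A.form y y + a * (t * t)
  by_cases hy : y = 0
  · subst hy
    have ht : t ≠ 0 := by rintro rfl; exact hx rfl
    have : 0 < t * t := mul_self_pos.2 ht
    simp only [map_zero, zero_add]
    positivity
  · have := hA y hy
    have h2 := mul_self_nonneg t
    positivity

theorem posDef_unary {a : ℚˣ} (ha : 0 < (a : ℚ)) (x : (SymForm.unary a).V) (hx : x ≠ 0) :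
    0 < (SymForm.unary a).form x x := by
  have hx' : (show ℚ from x) ≠ 0 := hx
  exact mul_pos ha (mul_self_pos.2 hx')

theorem anisotropic_of_posDef {A : SymForm ℚ} (hA : ∀ x, x ≠ 0 → 0 < A.form x x) :
    A.Anisotropic := fun x h => by
  by_contra hx
  exact (hA x hx).ne' h

theorem anisotropic_neg_iff {A : SymForm ℚ} : A.neg.Anisotropic ↔ A.Anisotropic :=
  forall_congr' fun x => by
    change (-(A.form x x) = 0 → x = 0) ↔ _
    rw [neg_eq_zero]
    rfl

/-- In the converse, nonemptiness bounds the span by 2, and the anisotropy condition excludes span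
1. Span 0 would put ⟨1,1⟩ among the B_i, and ⟨1,1⟩ ⊕ ⟨-1⟩ is isotropic. -/
theorem wittSpan_eq_two_iff : wittSpan (WittGroup.mk B) = 2 ↔
    (signatureSet B 2).Nonempty ∧
      ∀ i ∈ signatureSet B 2, ∀ A : SymForm ℚ, IsPreimageForm B 2 i A →
        (A.sum (SymForm.unary 1)).Anisotropic ∧ (A.sum (SymForm.unary (-1))).Anisotropic := by
  constructor
  · intro h
    obtain ⟨A, h1, h2⟩ := exists_rank_eq_wittSpan (WittGroup.mk B)
    refine ⟨⟨_, h ▸ h2 ▸ mem_signatureSet_of_rank_le h1 (by omega)⟩, fun i _ A hA => ?_⟩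
    exact (h.symm ▸ hA : IsPreimageForm B (wittSpan (WittGroup.mk B)) i A).anisotropic_sum
  · rintro ⟨h1, h2⟩
    have h3 := wittSpan_le_of_nonempty h1
    have h4 := wittSpan_add_one_ne h2
    suffices wittSpan (WittGroup.mk B) ≠ 0 by omega
    intro h0
    rw [wittSpan_eq_zero_iff] at h0
    have h5 : IsPreimageForm B 2 _ ((SymForm.unary 1).sum (SymForm.unary 1)) :=
      ⟨by rw [rank_sum_unary, SymForm.rank_unary],
        anisotropic_of_posDef (posDef_sum_unary (posDef_unary (by simp)) (by simp)),
        by rw [del_sum_unary_one, del_unary_one, h0], rfl⟩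
    exact not_anisotropic_sum_one_sum_neg_one _ (h2 _ h5.mem _ h5).2

theorem wittSpan_eq_one_iff : wittSpan (WittGroup.mk B) = 1 ↔
    (signatureSet B 1).Nonempty ∧ del (WittGroup.mk B) ≠ 0 := by
  rw [Ne, ← wittSpan_eq_zero_iff]
  constructor
  · intro h
    obtain ⟨A, h1, h2⟩ := exists_rank_eq_wittSpan (WittGroup.mk B)
    exact ⟨⟨_, h ▸ h2 ▸ mem_signatureSet_of_rank_le h1 (by omega)⟩, by omega⟩
  · rintro ⟨h1, h2⟩
    have h3 := wittSpan_le_of_nonempty h1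
    omega

/-- A form of rank `r + 1` splits off a rank one form. -/
theorem exists_split_signature {A : SymForm ℚ} {r : ℕ} (h : A.rank = r + 1) :
    ∃ (a : ℚˣ) (A' : SymForm ℚ), SymForm.Iso A ((SymForm.unary a).sum A') ∧ A'.rank = r ∧
      A.signature = ((SignType.sign (a : ℚ) : SignType) : ℤ) + A'.signature ∧
      WittGroup.mk A = WittGroup.unary a + WittGroup.mk A' := by
  obtain ⟨a, A', e, h1⟩ := A.exists_split_rank two_ne_zero (by omega)
  refine ⟨a, A', e, by omega, ?_, mk_eq e.wittEquiv⟩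
  rw [e.signature_eq, SymForm.signature_sum, SymForm.signature_unary]

theorem sign_unit_cases (a : ℚˣ) : ((SignType.sign (a : ℚ) : SignType) : ℤ) = 1 ∨
    ((SignType.sign (a : ℚ) : SignType) : ℤ) = -1 := by
  rcases lt_or_gt_of_ne a.ne_zero with h | h
  · right; rw [sign_neg h]; rfl
  · left; rw [sign_pos h]; rfl

theorem signatureSet_two_subset : signatureSet B 2 ⊆ {0, 2, -2} := by
  rintro i ⟨A, h1, -, -, rfl⟩
  obtain ⟨a, A', -, h2, h3, -⟩ := exists_split_signature h1
  obtain ⟨b, A'', -, h4, h5, -⟩ := exists_split_signature h2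
  have h6 := SymForm.signature_of_rank_eq_zero h4
  have h7 := sign_unit_cases a
  have h8 := sign_unit_cases b
  simp only [Set.mem_insert_iff, Set.mem_singleton_iff]
  omega

theorem signatureSet_three_subset : signatureSet B 3 ⊆ {1, -1, 3, -3} := by
  rintro i ⟨A, h1, -, -, rfl⟩
  obtain ⟨a, A', -, h2, h3, -⟩ := exists_split_signature h1
  obtain ⟨b, A'', -, h4, h5, -⟩ := exists_split_signature h2
  obtain ⟨c, A₃, -, h4, h6, -⟩ := exists_split_signature h4
  have h7 := SymForm.signature_of_rank_eq_zero h4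
  have h8 := sign_unit_cases a
  have h9 := sign_unit_cases b
  have h10 := sign_unit_cases c
  simp only [Set.mem_insert_iff, Set.mem_singleton_iff]
  omega

/-- Every element of the image of `∂` is the boundary of a form of rank three with any signs. -/
theorem exists_rank_three (x : WittGroup ℚ) {e₁ e₂ e₃ : ℤ} (h₁ : IsUnit e₁) (h₂ : IsUnit e₂)
    (h₃ : IsUnit e₃) :
    ∃ A : SymForm ℚ, del (WittGroup.mk A) = del x ∧ A.rank = 3 ∧ A.signature = e₁ + e₂ + e₃ := by
  have hsgn : ∀ {e a : ℤ}, IsUnit e → 0 < a → ∃ u : ℚˣ, (u : ℚ) = ((e * a : ℤ) : ℚ) ∧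
      (SymForm.unary u).signature = e := by
    intro e a he ha
    have hne : ((e * a : ℤ) : ℚ) ≠ 0 := by exact_mod_cast mul_ne_zero he.ne_zero ha.ne'
    refine ⟨Units.mk0 _ hne, rfl, ?_⟩
    have ha' : (0 : ℚ) < a := by exact_mod_cast ha
    rw [SymForm.signature_unary, Units.val_mk0]
    rcases Int.isUnit_iff.1 he with rfl | rfl
    · rw [sign_pos (by push_cast; linarith)]; rfl
    · rw [sign_neg (by push_cast; linarith)]; rfl
  obtain ⟨a, b, c, ha, hb, hc, h⟩ := exists_ternary_delPrime_eq x h₁ h₂ h₃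
  obtain ⟨u, hu, hu'⟩ := hsgn h₁ ha
  obtain ⟨v, hv, hv'⟩ := hsgn h₂ hb
  obtain ⟨w, hw, hw'⟩ := hsgn h₃ hc
  refine ⟨((SymForm.unary u).sum (SymForm.unary v)).sum (SymForm.unary w), ?_, ?_, ?_⟩
  · rw [del_eq_iff]
    intro q
    rw [← h q, ← hu, ← hv, ← hw, unary₀_units, unary₀_units, unary₀_units]
    rfl
  · rw [rank_sum_unary, rank_sum_unary, SymForm.rank_unary]
  · rw [SymForm.signature_sum, SymForm.signature_sum, hu', hv', hw']

theorem wittSpan_eq_three_iff : wittSpan (WittGroup.mk B) = 3 ↔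
    signatureSet B 3 = {1, -1, 3, -3} ∧
      ∀ i ∈ signatureSet B 3, ∀ A : SymForm ℚ, IsPreimageForm B 3 i A →
        (A.sum (SymForm.unary 1)).Anisotropic ∧ (A.sum (SymForm.unary (-1))).Anisotropic := by
  constructor
  · intro h
    refine ⟨signatureSet_three_subset.antisymm ?_, fun i _ A hA =>
      (h.symm ▸ hA : IsPreimageForm B (wittSpan (WittGroup.mk B)) i A).anisotropic_sum⟩
    -- When the span is 3, ternary forms with this boundary are automatically anisotropic, so each
    -- choice of signs contributes its signature.
    have key : ∀ {e₁ e₂ e₃ : ℤ}, IsUnit e₁ → IsUnit e₂ → IsUnit e₃ →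
        e₁ + e₂ + e₃ ∈ signatureSet B 3 := by
      intro e₁ e₂ e₃ h₁ h₂ h₃
      obtain ⟨A, h4, h5, h6⟩ := exists_rank_three (WittGroup.mk B) h₁ h₂ h₃
      exact ⟨A, h5, anisotropic_of_rank_le h4 (by omega), h4, h6⟩
    have u : IsUnit (1 : ℤ) := isUnit_one
    rintro i (rfl | rfl | rfl | rfl)
    · exact key u u u.neg
    · exact key u u.neg u.neg
    · exact key u u u
    · exact key u.neg u.neg u.neg
  · rintro ⟨h1, h2⟩
    have h3 : wittSpan (WittGroup.mk B) ≤ 3 := wittSpan_le_of_nonempty ⟨1, by rw [h1]; simp⟩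
    have h4 := wittSpan_add_one_ne h2
    have h5 : wittSpan (WittGroup.mk B) ≠ 0 := by
      intro h0
      rw [wittSpan_eq_zero_iff] at h0
      have h5 : IsPreimageForm B 3 _
          (((SymForm.unary 1).sum (SymForm.unary 1)).sum (SymForm.unary 1)) :=
        ⟨by rw [rank_sum_unary, rank_sum_unary, SymForm.rank_unary],
          anisotropic_of_posDef (posDef_sum_unary
            (posDef_sum_unary (posDef_unary (by simp)) (by simp)) (by simp)),
          by rw [del_sum_unary_one, del_sum_unary_one, del_unary_one, h0], rfl⟩
      exact not_anisotropic_sum_one_sum_neg_one _ (h2 _ h5.mem _ h5).2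
    -- Span 1 would give an ⟨a⟩ with this boundary. Adding ⟨1,1⟩ if a > 0, or ⟨-1,-1⟩ if a < 0,
    -- produces a definite form B_i, which the opposite unit makes isotropic.
    suffices wittSpan (WittGroup.mk B) ≠ 1 by omega
    intro h6
    obtain ⟨A, hA, hA1⟩ := exists_rank_eq_wittSpan (WittGroup.mk B)
    obtain ⟨a, A', -, h7, -, h8⟩ := exists_split_signature (r := 0) (hA1.trans h6)
    have h9 : del (WittGroup.mk (SymForm.unary a)) = del (WittGroup.mk B) := by
      rw [← hA, h8, mk_metabolic ⟨0, ⊥, h7, finrank_bot _ _, by simp⟩, add_zero]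
      rfl
    rcases lt_or_gt_of_ne a.ne_zero with ha | ha
    · have h10 : IsPreimageForm B 3
          (((SymForm.unary a).sum (SymForm.unary (-1))).sum (SymForm.unary (-1))).signature
          (((SymForm.unary a).sum (SymForm.unary (-1))).sum (SymForm.unary (-1))) := by
        refine ⟨by rw [rank_sum_unary, rank_sum_unary, SymForm.rank_unary], ?_,
          by rw [del_sum_unary_neg_one, del_sum_unary_neg_one, h9], rfl⟩
        refine anisotropic_neg_iff.1 (anisotropic_of_posDef ?_)
        rintro ⟨⟨(x : ℚ), (y : ℚ)⟩, (z : ℚ)⟩ hx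
        change 0 < -((a : ℚ) * (x * x) + -1 * (y * y) + -1 * (z * z))
        have h11 : 0 ≤ -(a : ℚ) * (x * x) := mul_nonneg (by linarith) (mul_self_nonneg x)
        have h12 := mul_self_nonneg y
        have h13 := mul_self_nonneg z
        by_contra hn
        have hy : y = 0 := mul_self_eq_zero.1 (by linarith)
        have hz : z = 0 := mul_self_eq_zero.1 (by linarith)
        have hx' : -(a : ℚ) * (x * x) = 0 := by linarith
        have hx0 : x = 0 := by simpa using hx'
        subst hx0 hy hz
        exact hx rfl
      exact not_anisotropic_sum_neg_one_sum_one _ (h2 _ h10.mem _ h10).1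
    · have h10 : IsPreimageForm B 3 _
          (((SymForm.unary a).sum (SymForm.unary 1)).sum (SymForm.unary 1)) :=
        ⟨by rw [rank_sum_unary, rank_sum_unary, SymForm.rank_unary],
          anisotropic_of_posDef (posDef_sum_unary
            (posDef_sum_unary (posDef_unary ha) (by simp)) (by simp)),
          by rw [del_sum_unary_one, del_sum_unary_one, h9], rfl⟩
      exact not_anisotropic_sum_one_sum_neg_one _ (h2 _ h10.mem _ h10).2

end WittSpan

/-! ### Binary forms and their boundaries. -/

section Binary

open WittGroup

theorem signature_unary_intCast {n : ℤ} {a : ℚˣ} (h : (a : ℚ) = n) :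
    (SymForm.unary a).signature = n.sign := by
  rw [SymForm.signature_unary, h]
  rcases lt_trichotomy n 0 with hn | rfl | hn
  · rw [sign_neg (by exact_mod_cast hn), Int.sign_eq_neg_one_of_neg hn]; rfl
  · simp
  · rw [sign_pos (by exact_mod_cast hn), Int.sign_eq_one_of_pos hn]; rfl

theorem exists_binary {a b : ℤ} (ha : a ≠ 0) (hb : b ≠ 0) : ∃ A : SymForm ℚ, A.rank = 2 ∧
    WittGroup.mk A = unary₀ (a : ℚ) + unary₀ (b : ℚ) ∧ A.signature = a.sign + b.sign := by
  have ha' : (a : ℚ) ≠ 0 := by exact_mod_cast ha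
  have hb' : (b : ℚ) ≠ 0 := by exact_mod_cast hb
  refine ⟨(SymForm.unary (Units.mk0 _ ha')).sum (SymForm.unary (Units.mk0 _ hb')), ?_, ?_, ?_⟩
  · rw [rank_sum_unary, SymForm.rank_unary]
  · rw [unary₀_of_ne ha', unary₀_of_ne hb']; rfl
  · rw [SymForm.signature_sum, signature_unary_intCast (n := a) rfl,
      signature_unary_intCast (n := b) rfl]

theorem exists_squarefree_binary {A : SymForm ℚ} (h : A.rank = 2) : ∃ a b : ℤ, Squarefree a ∧
    Squarefree b ∧ WittGroup.mk A = unary₀ (a : ℚ) + unary₀ (b : ℚ) ∧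
      A.signature = a.sign + b.sign := by
  obtain ⟨a, A', -, h2, h3, h4⟩ := exists_split_signature h
  obtain ⟨b, A'', -, h5, h6, h7⟩ := exists_split_signature h2
  obtain ⟨m, hm, hm', hms⟩ := exists_squarefree_unary a
  obtain ⟨n, hn, hn', hns⟩ := exists_squarefree_unary b
  refine ⟨m, n, hm, hn, ?_, ?_⟩
  · rw [h4, h7, mk_metabolic ⟨0, ⊥, h5, finrank_bot _ _, by simp⟩, add_zero, hm', hn']
  · have hs : ∀ k : ℤ, ((SignType.sign k : SignType) : ℤ) = k.sign := fun k => by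
      rcases lt_trichotomy k 0 with hk | rfl | hk
      · rw [sign_neg hk, Int.sign_eq_neg_one_of_neg hk]; rfl
      · simp
      · rw [sign_pos hk, Int.sign_eq_one_of_pos hk]; rfl
    rw [h3, h6, SymForm.signature_of_rank_eq_zero h5, add_zero, hms, hns, hs, hs]

/-- A nonzero residue of even rank forces the Witt span of a binary form to be two. -/
theorem wittSpan_eq_two_of_delPrime {A : SymForm ℚ} (hA : A.rank = 2) (p : ℕ) [hp : Fact p.Prime]
    (h0 : delPrime p (WittGroup.mk A) ≠ 0) (h1 : rankParity (delPrime p (WittGroup.mk A)) = 0) :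
    wittSpan (WittGroup.mk A) = 2 := by
  have hle := wittSpan_le (x := WittGroup.mk A) (A := A) rfl
  have hd : ∀ x, del x = del (WittGroup.mk A) → delPrime p x = delPrime p (WittGroup.mk A) :=
    fun x hx => (del_eq_iff _ _).1 hx ⟨p, hp.1⟩
  have hz : wittSpan (WittGroup.mk A) ≠ 0 := by
    rw [Ne, wittSpan_eq_zero_iff]
    intro h
    exact h0 ((hd 0 (by rw [h, map_zero])).symm.trans (map_zero _))
  suffices wittSpan (WittGroup.mk A) ≠ 1 by omega
  intro h2
  obtain ⟨C, hC, hC1⟩ := exists_rank_eq_wittSpan (WittGroup.mk A)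
  obtain ⟨a, C', -, h5, -, h7⟩ := exists_split_signature (r := 0) (hC1.trans h2)
  obtain ⟨n, hn, hn', -⟩ := exists_squarefree_unary a
  rw [← hd _ hC, h7, mk_metabolic ⟨0, ⊥, h5, finrank_bot _ _, by simp⟩, add_zero, hn'] at h0 h1
  -- A rank one form has at p either the zero residue or one of odd rank; both contradict the
  -- assumptions.
  rw [rankParity_delPrime_unary₀ hn] at h1
  split_ifs at h1 with hpn
  · exact one_ne_zero h1
  · exact h0 (delPrime_unary₀_of_not_dvd hpn)

/-- Both entries are squarefree, and N is the only prime dividing exactly one of them. -/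
theorem rankParity_delPrime_binary {N : ℕ} (hN : N.Prime) {c e : ℤ} (he : IsUnit e)
    (hc : Squarefree (N * c)) (q : ℕ) [hq : Fact q.Prime] :
    rankParity (delPrime q (unary₀ (c : ℚ) + unary₀ ((e * (N * c) : ℤ) : ℚ))) =
      if q = N then 1 else 0 := by
  have hN' : Fact N.Prime := ⟨hN⟩
  have hsq : Squarefree (e * (N * c)) := by
    rcases Int.isUnit_iff.1 he with rfl | rfl
    · simpa using hc
    · rw [neg_one_mul, ← Int.squarefree_natAbs, Int.natAbs_neg, Int.squarefree_natAbs]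
      exact hc
  have hP : Prime (q : ℤ) := Nat.prime_iff_prime_int.1 hq.1
  have h1 : (q : ℤ) ∣ e * (N * c) ↔ q = N ∨ (q : ℤ) ∣ c := by
    rw [hP.dvd_mul, hP.dvd_mul, Int.natCast_dvd_natCast, Nat.prime_dvd_prime_iff_eq hq.1 hN,
      or_iff_right fun h => hP.not_isUnit (isUnit_of_dvd_unit h he)]
  rw [map_add, map_add, rankParity_delPrime_unary₀ hc.of_mul_right,
    rankParity_delPrime_unary₀ hsq]
  simp only [h1]
  by_cases hqN : q = N
  · subst hqN
    have := hc.not_dvd_of_mul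
    simp [this]
  · by_cases hqc : (q : ℤ) ∣ c
    · simp only [hqN, hqc, or_true, if_true, if_false]; decide
    · simp [hqN, hqc]

theorem natAbs_eq_of_forall_dvd_iff {a b : ℤ} (ha : Squarefree a) (hb : Squarefree b)
    (h : ∀ q : ℕ, q.Prime → ((q : ℤ) ∣ a ↔ (q : ℤ) ∣ b)) : a.natAbs = b.natAbs := by
  refine (Nat.Squarefree.ext_iff (Int.squarefree_natAbs.2 ha) (Int.squarefree_natAbs.2 hb)).2
    fun q hq => ?_
  rw [← Int.natCast_dvd, ← Int.natCast_dvd]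
  exact h q hq

theorem iff_of_ite_add_ite {P Q R : Prop} [Decidable P] [Decidable Q] [Decidable R]
    (h : ((if P then 1 else 0) + (if Q then 1 else 0) : ZMod 2) = if R then 1 else 0) :
    (¬ R → (P ↔ Q)) ∧ (R → (P ↔ ¬ Q)) := by
  have h2 : (1 : ZMod 2) + 1 = 0 := by decide
  by_cases hP : P <;> by_cases hQ : Q <;> by_cases hR : R <;> simp [hP, hQ, hR, h2] at h ⊢

/-- A binary form with the same boundary as `⟨c, ±N c⟩` is of the form `⟨n, ±N n⟩`. -/
theorem exists_eq_of_del_eq {A : SymForm ℚ} (hA : A.rank = 2) {N : ℕ} (hN : N.Prime) {c e : ℤ}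
    (he : IsUnit e) (hc : Squarefree (N * c))
    (h : del (WittGroup.mk A) = del (unary₀ (c : ℚ) + unary₀ ((e * (N * c) : ℤ) : ℚ))) :
    ∃ n ε : ℤ, IsUnit ε ∧ Squarefree (N * n) ∧
      WittGroup.mk A = unary₀ (n : ℚ) + unary₀ ((ε * (N * n) : ℤ) : ℚ) ∧
      A.signature = n.sign + ε * n.sign := by
  obtain ⟨a, b, ha, hb, hab, hs⟩ := exists_squarefree_binary hA
  -- Comparing parities of residue ranks: N divides exactly one of a and b, and every other prime
  -- divides both or neither.
  have hpar : ∀ q : ℕ, q.Prime → (((if (q : ℤ) ∣ a then 1 else 0) +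
      (if (q : ℤ) ∣ b then 1 else 0) : ZMod 2) = if q = N then 1 else 0) := by
    intro q hq
    have : Fact q.Prime := ⟨hq⟩
    rw [← rankParity_delPrime_binary hN he hc q, ← (del_eq_iff _ _).1 h ⟨q, hq⟩, hab, map_add,
      map_add, rankParity_delPrime_unary₀ ha, rankParity_delPrime_unary₀ hb]
  have hiff : ∀ q : ℕ, q.Prime → (q ≠ N → ((q : ℤ) ∣ a ↔ (q : ℤ) ∣ b)) ∧
      (q = N → ((q : ℤ) ∣ a ↔ ¬ (q : ℤ) ∣ b)) := by
    intro q hq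
    exact iff_of_ite_add_ite (hpar q hq)
  -- The entry divisible by N therefore equals ±N times the other. Which of the two it is only
  -- affects the order of the summands.
  have key : ∀ a b : ℤ, Squarefree a → Squarefree b → (N : ℤ) ∣ b → ¬ (N : ℤ) ∣ a →
      (∀ q : ℕ, q.Prime → q ≠ N → ((q : ℤ) ∣ a ↔ (q : ℤ) ∣ b)) →
      ∃ ε : ℤ, IsUnit ε ∧ Squarefree (N * a) ∧ b = ε * (N * a) := by
    rintro a b ha hb ⟨k, rfl⟩ hNa hq
    have hN' : Fact N.Prime := ⟨hN⟩
    have h1 : a.natAbs = k.natAbs := by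
      refine natAbs_eq_of_forall_dvd_iff ha hb.of_mul_right fun q hq' => ?_
      by_cases hqN : q = N
      · subst hqN
        simp [hNa, hb.not_dvd_of_mul]
      · rw [hq q hq' hqN, (Nat.prime_iff_prime_int.1 hq').dvd_mul, Int.natCast_dvd_natCast,
          Nat.prime_dvd_prime_iff_eq hq' hN, or_iff_right hqN]
    rcases Int.natAbs_eq_natAbs_iff.1 h1 with rfl | rfl
    · exact ⟨1, isUnit_one, hb, by ring⟩
    · refine ⟨-1, isUnit_one.neg, ?_, by ring⟩
      rwa [mul_neg, ← Int.squarefree_natAbs, Int.natAbs_neg, Int.squarefree_natAbs]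
  have hsign : ∀ n ε : ℤ, IsUnit ε → (ε * (N * n)).sign = ε * n.sign := by
    intro n ε hε
    rw [Int.sign_mul, Int.sign_mul, Int.sign_eq_one_of_pos (a := (N : ℤ))
      (by exact_mod_cast hN.pos), one_mul]
    rcases Int.isUnit_iff.1 hε with rfl | rfl <;> simp
  by_cases hNb : (N : ℤ) ∣ b
  · obtain ⟨ε, hε, h1, h2⟩ := key a b ha hb hNb (fun h' => ((hiff N hN).2 rfl).1 h' hNb)
      fun q hq => (hiff q hq).1
    exact ⟨a, ε, hε, h1, by rw [hab, h2], by rw [hs, h2, hsign _ _ hε]⟩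
  · obtain ⟨ε, hε, h1, h2⟩ := key b a hb ha (((hiff N hN).2 rfl).2 hNb) hNb
      fun q hq h' => ((hiff q hq).1 h').symm
    exact ⟨b, ε, hε, h1, by rw [hab, h2, add_comm], by rw [hs, h2, hsign _ _ hε, add_comm]⟩

/-- If q divides n, the residue is a multiple of ⟨1, d⟩, hyperbolic because -d is a square;
otherwise both entries are units at q. -/
theorem delPrime_binary_eq_zero (q : ℕ) [hq : Fact q.Prime] {n d : ℤ} (hn : Squarefree n)
    (hd : ¬ (q : ℤ) ∣ d) (hsq : IsSquare ((-d : ℤ) : ZMod q)) :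
    delPrime q (unary₀ (n : ℚ) + unary₀ ((d * n : ℤ) : ℚ)) = 0 := by
  have hP : Prime (q : ℤ) := Nat.prime_iff_prime_int.1 hq.1
  rw [map_add]
  by_cases h : (q : ℤ) ∣ n
  · obtain ⟨m, rfl⟩ := h
    have hm := hn.not_dvd_of_mul
    have hdm : ¬ (q : ℤ) ∣ d * m := fun h => (hP.dvd_mul.1 h).elim hd hm
    rw [show d * ((q : ℤ) * m) = q * (d * m) by ring, delPrime_unary₀_mul hm,
      delPrime_unary₀_mul hdm, unary₀_add_eq_zero_iff]
    · have h1 : -((m : ZMod q) * ((d * m : ℤ) : ZMod q)) = ((-d : ℤ) : ZMod q) * (m * m) := by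
        push_cast; ring
      rw [h1]
      exact hsq.mul ⟨_, rfl⟩
    · rwa [Ne, ZMod.intCast_zmod_eq_zero_iff_dvd]
    · rwa [Ne, ZMod.intCast_zmod_eq_zero_iff_dvd]
  · rw [delPrime_unary₀_of_not_dvd h,
      delPrime_unary₀_of_not_dvd fun h' => (hP.dvd_mul.1 h').elim hd h, add_zero]

theorem delPrime_binary_of_dvd (q : ℕ) [hq : Fact q.Prime] {m d : ℤ} (hm : ¬ (q : ℤ) ∣ m)
    (hd : ¬ (q : ℤ) ∣ d) :
    delPrime q (unary₀ ((q * m : ℤ) : ℚ) + unary₀ ((d * (q * m) : ℤ) : ℚ)) =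
      unary₀ (m : ZMod q) + unary₀ ((d * m : ℤ) : ZMod q) := by
  have hP : Prime (q : ℤ) := Nat.prime_iff_prime_int.1 hq.1
  rw [map_add, show d * ((q : ℤ) * m) = q * (d * m) by ring, delPrime_unary₀_mul hm,
    delPrime_unary₀_mul fun h => (hP.dvd_mul.1 h).elim hd hm]

theorem isSquare_two_zmod_seven : IsSquare ((2 : ℕ) : ZMod 7) := ⟨3, by decide⟩

theorem zmod_seven_mul_self_ne_neg_one : ∀ z : ZMod 7, z * z ≠ -1 := by decide

/-- If p ≡ 1 mod 4, then -1 and hence 7 is a square modulo p, and reciprocity carries this over. If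
p ≡ 3 mod 4, reciprocity with 7 ≡ 3 mod 4 flips: p being a nonsquare modulo 7 would make 7, hence -1
= -7/7, a square modulo p. -/
theorem isSquare_seven_of_isSquare_neg_seven {p : ℕ} [hp : Fact p.Prime] (h2 : p ≠ 2) (h7 : p ≠ 7)
    (h : IsSquare (-7 : ZMod p)) : IsSquare (p : ZMod 7) := by
  have : Fact (Nat.Prime 7) := ⟨by norm_num⟩
  have hodd : p % 4 = 1 ∨ p % 4 = 3 := Nat.odd_mod_four_iff.1
    (hp.1.eq_two_or_odd.resolve_left h2)
  have h70 : (7 : ZMod p) ≠ 0 := by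
    intro h0
    have : ((7 : ℕ) : ZMod p) = 0 := by exact_mod_cast h0
    rw [ZMod.natCast_eq_zero_iff, Nat.prime_dvd_prime_iff_eq hp.1 (by norm_num)] at this
    exact h7 this
  rcases hodd with h4 | h4
  · have h1 : IsSquare (-1 : ZMod p) := ZMod.exists_sq_eq_neg_one_iff.2 (by omega)
    rw [← ZMod.exists_sq_eq_prime_iff_of_mod_four_eq_one h4 (by norm_num)]
    have := h.mul h1
    simpa using this
  · by_contra hn
    rw [← ZMod.exists_sq_eq_prime_iff_of_mod_four_eq_three h4 (by norm_num) h7] at hn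
    have h1 : IsSquare (-1 : ZMod p) := by
      have := h.div hn
      rwa [Nat.cast_ofNat, neg_div, div_self h70] at this
    exact ZMod.exists_sq_eq_neg_one_iff.1 h1 h4

theorem isSquare_natCast_of_forall_prime {N m : ℕ}
    (h : ∀ p : ℕ, p.Prime → p ∣ m → IsSquare (p : ZMod N)) : IsSquare (m : ZMod N) := by
  induction m using induction_on_primes with
  | zero => simp
  | one => simp
  | prime_mul p a hp ih =>
    rw [Nat.cast_mul]
    exact (h p hp (dvd_mul_right _ _)).mul (ih fun q hq hqa => h q hq (hqa.mul_left _))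

/-- The boundary of `⟨q, 7q⟩` with `-7` not a square modulo `q` is not that of a negative definite
form `⟨n, 7n⟩`. -/
theorem false_of_del_eq_neg {q : ℕ} (hq : q.Prime) (hq7 : q ≠ 7)
    (hns : ¬ IsSquare (-7 : ZMod q)) {n : ℤ} (hn : Squarefree (7 * n)) (hneg : n < 0)
    (h : del (unary₀ (n : ℚ) + unary₀ ((7 * n : ℤ) : ℚ)) =
      del (unary₀ (q : ℚ) + unary₀ ((7 * q : ℤ) : ℚ))) : False := by
  have hF : Fact q.Prime := ⟨hq⟩
  have h7 : Fact (Nat.Prime 7) := ⟨by norm_num⟩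
  have hd := fun p : Nat.Primes => (del_eq_iff _ _).1 h p
  have hn7 : ¬ ((7 : ℕ) : ℤ) ∣ n := Squarefree.not_dvd_of_mul (p := 7) hn
  have hq7' : ¬ ((7 : ℕ) : ℤ) ∣ q := fun h' => hq7
    ((Nat.prime_dvd_prime_iff_eq (by norm_num) hq).1 (by exact_mod_cast h')).symm
  have h7q' : ¬ (q : ℤ) ∣ 7 := fun h' => hq7
    ((Nat.prime_dvd_prime_iff_eq hq (by norm_num)).1 (by exact_mod_cast h'))
  -- At 7 the residues are ⟨n⟩ and ⟨q⟩, so n and q agree up to squares modulo 7.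
  have hs7 : IsSquare ((n : ZMod 7) * (q : ZMod 7)) := by
    have h1 := hd ⟨7, by norm_num⟩
    rw [map_add, map_add] at h1
    have e1 : delPrime 7 (unary₀ (n : ℚ)) = 0 := delPrime_unary₀_of_not_dvd hn7
    have e2 : delPrime 7 (unary₀ ((q : ℤ) : ℚ)) = 0 := delPrime_unary₀_of_not_dvd hq7'
    have e3 : delPrime 7 (unary₀ ((7 * n : ℤ) : ℚ)) = unary₀ (n : ZMod 7) :=
      delPrime_unary₀_mul hn7
    have e4 : delPrime 7 (unary₀ ((7 * q : ℤ) : ℚ)) = unary₀ ((q : ℤ) : ZMod 7) :=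
      delPrime_unary₀_mul hq7'
    rw [Int.cast_natCast] at e2 e4
    change delPrime 7 _ + delPrime 7 _ = delPrime 7 _ + delPrime 7 _ at h1
    rw [e1, e2, e3, e4, zero_add, zero_add] at h1
    refine isSquare_of_unary₀_eq ?_ ?_ h1
    · rwa [Ne, ZMod.intCast_zmod_eq_zero_iff_dvd]
    · rw [← Int.cast_natCast, Ne, ZMod.intCast_zmod_eq_zero_iff_dvd]; exact hq7'
  -- The residue of ⟨q, 7q⟩ at q is ⟨1, 7⟩, nonzero since -7 is a nonsquare, whereas n prime to q
  -- would give zero.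
  have hqn : (q : ℤ) ∣ n := by
    by_contra hqn
    have h1 := hd ⟨q, hq⟩
    have e1 := delPrime_binary_of_dvd q (m := 1) (d := 7)
      (fun h' => hq.one_lt.ne' (by simpa using Int.natAbs_dvd_natAbs.2 h')) h7q'
    rw [mul_one, Int.cast_natCast] at e1
    change delPrime q _ = delPrime q _ at h1
    rw [e1, map_add, delPrime_unary₀_of_not_dvd hqn, delPrime_unary₀_of_not_dvd fun h' =>
      ((Nat.prime_iff_prime_int.1 hq).dvd_mul.1 h').elim h7q' hqn, add_zero] at h1
    have h70 : ((7 : ℤ) : ZMod q) ≠ 0 := by rwa [Ne, ZMod.intCast_zmod_eq_zero_iff_dvd]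
    have h2 := (unary₀_add_eq_zero_iff (by simp) (by simpa using h70)).1 h1.symm
    exact hns (by simpa using h2)
  obtain ⟨k, rfl⟩ := hqn
  have hk : k < 0 := by
    have : (0 : ℤ) < q := by exact_mod_cast hq.pos
    by_contra hk
    exact absurd hneg (not_lt.2 (mul_nonneg this.le (not_lt.1 hk)))
  obtain ⟨m, rfl⟩ : ∃ m : ℕ, k = -m := ⟨k.natAbs, by omega⟩
  have hsqf : Squarefree ((q : ℤ) * -m) := hn.of_mul_right
  -- At an odd prime p dividing m the right-hand residue vanishes, which forces -7 to be a square
  -- modulo p, so p is a square modulo 7. The prime 2 is treated apart: it is 3² modulo 7.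
  have hm : IsSquare (m : ZMod 7) := by
    refine isSquare_natCast_of_forall_prime fun p hp hpm => ?_
    have hpF : Fact p.Prime := ⟨hp⟩
    have hpk : (p : ℤ) ∣ -m := by rw [dvd_neg]; exact_mod_cast hpm
    have hp7 : p ≠ 7 := by
      rintro rfl
      exact hn7 (hpk.mul_left _)
    have hpq : p ≠ q := by
      rintro rfl
      exact hsqf.not_dvd_of_mul hpk
    by_cases hp2 : p = 2
    · subst hp2; exact isSquare_two_zmod_seven
    refine isSquare_seven_of_isSquare_neg_seven hp2 hp7 ?_
    obtain ⟨j, hj⟩ := hpk.mul_left (q : ℤ)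
    have hj' : ¬ (p : ℤ) ∣ j := by
      rw [hj] at hsqf
      exact hsqf.not_dvd_of_mul
    have hp7' : ¬ (p : ℤ) ∣ 7 := fun h' => hp7
      ((Nat.prime_dvd_prime_iff_eq hp (by norm_num)).1 (by exact_mod_cast h'))
    have hpq' : ¬ (p : ℤ) ∣ (q : ℤ) := fun h' => hpq
      ((Nat.prime_dvd_prime_iff_eq hp hq).1 (by exact_mod_cast h'))
    have h1 := hd ⟨p, hp⟩
    change delPrime p _ = delPrime p _ at h1
    rw [hj, delPrime_binary_of_dvd p hj' hp7', map_add, ← Int.cast_natCast (R := ℚ) q,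
      delPrime_unary₀_of_not_dvd hpq', delPrime_unary₀_of_not_dvd fun h' =>
      ((Nat.prime_iff_prime_int.1 hp).dvd_mul.1 h').elim hp7' hpq', add_zero] at h1
    have hj0 : (j : ZMod p) ≠ 0 := by rwa [Ne, ZMod.intCast_zmod_eq_zero_iff_dvd]
    have h70 : ((7 : ℤ) : ZMod p) ≠ 0 := by rwa [Ne, ZMod.intCast_zmod_eq_zero_iff_dvd]
    have h2 := (unary₀_add_eq_zero_iff hj0
      (by rw [Int.cast_mul]; exact mul_ne_zero h70 hj0)).1 h1
    obtain ⟨s, hs⟩ := h2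
    refine ⟨s / j, ?_⟩
    push_cast at hs
    field_simp
    linear_combination hs
  obtain ⟨s, hs⟩ := hm
  obtain ⟨t, ht⟩ := hs7
  have hq0 : (q : ZMod 7) ≠ 0 := by
    rw [← Int.cast_natCast, Ne, ZMod.intCast_zmod_eq_zero_iff_dvd]; exact hq7'
  have hs0 : s ≠ 0 := by
    rintro rfl
    refine hn7 (Dvd.dvd.mul_left ?_ _)
    rw [← ZMod.intCast_zmod_eq_zero_iff_dvd]
    push_cast
    rw [hs]; simp
  -- Modulo 7, m = s² and nq = t² with n = -qm, so -(qs)² = t² and -1 would be the square of t/(qs).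
  refine zmod_seven_mul_self_ne_neg_one (t / (q * s)) ?_
  push_cast at ht
  field_simp
  linear_combination -ht - (q : ZMod 7) ^ 2 * hs

end Binary

/-! ### Realizing every nonempty subset of {0, ±2}. -/

section Realization

open WittGroup

/-- At a prime dividing n the two residues are ⟨m⟩ and ⟨-m⟩, which coincide when -1 is a square; at
all others both vanish. -/
theorem del_unary₀_neg {n : ℤ} (hn : Squarefree n)
    (h : ∀ q : Nat.Primes, ((q : ℕ) : ℤ) ∣ n → IsSquare (-1 : ZMod q)) :
    del (unary₀ ((-n : ℤ) : ℚ)) = del (unary₀ (n : ℚ)) := by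
  rw [del_eq_iff]
  intro q
  by_cases hq : ((q : ℕ) : ℤ) ∣ n
  · have hsq := h q hq
    obtain ⟨m, rfl⟩ := hq
    have hm := hn.not_dvd_of_mul
    have hm0 : (m : ZMod q) ≠ 0 := by rwa [Ne, ZMod.intCast_zmod_eq_zero_iff_dvd]
    rw [← mul_neg, delPrime_unary₀_mul hm, delPrime_unary₀_mul (by rwa [dvd_neg]), Int.cast_neg]
    refine unary₀_eq_of_isSquare (neg_ne_zero.2 hm0) hm0 ?_
    rw [show -(m : ZMod q) * m = -1 * (m * m) by ring]
    exact hsq.mul ⟨_, rfl⟩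
  · rw [delPrime_unary₀_of_not_dvd hq, delPrime_unary₀_of_not_dvd (by rwa [dvd_neg])]

/-- The form `⟨q, d q⟩` has Witt span two if `-d` is not a square modulo the prime `q`. -/
theorem wittSpan_binary {q : ℕ} [hq : Fact q.Prime] {d : ℤ} (hd : ¬ IsSquare ((-d : ℤ) : ZMod q))
    {A : SymForm ℚ} (hA : A.rank = 2)
    (hmk : WittGroup.mk A = unary₀ ((q : ℤ) : ℚ) + unary₀ ((d * q : ℤ) : ℚ)) :
    delPrime q (WittGroup.mk A) ≠ 0 ∧ wittSpan (WittGroup.mk A) = 2 := by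
  have hd0 : ¬ (q : ℤ) ∣ d := by
    intro h
    rw [← ZMod.intCast_zmod_eq_zero_iff_dvd] at h
    rw [Int.cast_neg, h] at hd
    simp at hd
  have hd0' : (d : ZMod q) ≠ 0 := by rwa [Ne, ZMod.intCast_zmod_eq_zero_iff_dvd]
  have h1 : ¬ (q : ℤ) ∣ 1 := (Nat.prime_iff_prime_int.1 hq.1).not_dvd_one
  have h2 := delPrime_binary_of_dvd q h1 hd0
  rw [mul_one, mul_one, ← hmk, Int.cast_one] at h2
  -- The residue at q is ⟨1, d⟩: anisotropic, so nonzero, and of even rank.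
  have h3 : delPrime q (WittGroup.mk A) ≠ 0 := by
    rw [h2, Ne, unary₀_add_eq_zero_iff one_ne_zero hd0']
    simpa using hd
  refine ⟨h3, wittSpan_eq_two_of_delPrime hA q h3 ?_⟩
  rw [h2, map_add, rankParity_unary₀ one_ne_zero, rankParity_unary₀ hd0']
  decide

theorem mem_signatureSet_two {A B : SymForm ℚ} (hB : wittSpan (WittGroup.mk B) = 2)
    (hA : A.rank = 2) (h : del (WittGroup.mk A) = del (WittGroup.mk B)) :
    A.signature ∈ signatureSet B 2 :=
  hA ▸ mem_signatureSet_of_rank_le h (by omega)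

theorem del_mk_neg (A : SymForm ℚ) : del (WittGroup.mk A.neg) = -del (WittGroup.mk A) := by
  rw [mk_neg, map_neg]

/-- Negation preserves ranks and commutes with ∂; being an involution on classes, it gives equality
from this one inequality. -/
theorem wittSpan_neg_le (B : SymForm ℚ) :
    wittSpan (WittGroup.mk B.neg) ≤ wittSpan (WittGroup.mk B) := by
  obtain ⟨A, h1, h2⟩ := exists_rank_eq_wittSpan (WittGroup.mk B)
  rw [← h2]
  exact wittSpan_le (A := A.neg) (by rw [del_mk_neg, del_mk_neg, h1])

theorem wittSpan_neg (B : SymForm ℚ) :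
    wittSpan (WittGroup.mk B.neg) = wittSpan (WittGroup.mk B) := by
  refine (wittSpan_neg_le B).antisymm ?_
  have h := wittSpan_neg_le B.neg
  rwa [mk_neg, mk_neg, neg_neg] at h

theorem mem_signatureSet_neg {B : SymForm ℚ} {r : ℕ} {i : ℤ} :
    i ∈ signatureSet B.neg r ↔ -i ∈ signatureSet B r := by
  constructor
  · rintro ⟨A, h1, h2, h3, h4⟩
    exact ⟨A.neg, h1, anisotropic_neg_iff.2 h2, by rw [del_mk_neg, h3, del_mk_neg, neg_neg],
      by rw [SymForm.signature_neg, h4]⟩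
  · rintro ⟨A, h1, h2, h3, h4⟩
    exact ⟨A.neg, h1, anisotropic_neg_iff.2 h2, by rw [del_mk_neg, h3, del_mk_neg],
      by rw [SymForm.signature_neg, h4, neg_neg]⟩

/-- The elements of `I_2` for a form with the boundary of `⟨c, ±N c⟩`. -/
theorem exists_of_mem_signatureSet_two {B : SymForm ℚ} {N : ℕ} (hN : N.Prime) {c e : ℤ}
    (he : IsUnit e) (hc : Squarefree (N * c))
    (hB : WittGroup.mk B = unary₀ (c : ℚ) + unary₀ ((e * (N * c) : ℤ) : ℚ)) {i : ℤ}
    (hi : i ∈ signatureSet B 2) : ∃ n ε : ℤ, IsUnit ε ∧ Squarefree (N * n) ∧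
      del (unary₀ (n : ℚ) + unary₀ ((ε * (N * n) : ℤ) : ℚ)) = del (WittGroup.mk B) ∧
      i = n.sign + ε * n.sign := by
  obtain ⟨A, h1, -, h3, rfl⟩ := hi
  obtain ⟨n, ε, hε, hn, hA, hs⟩ := exists_eq_of_del_eq h1 hN he hc (hB ▸ h3)
  exact ⟨n, ε, hε, hn, by rw [← hA, h3], hs⟩

/-- A residue at `q` excludes the binary forms `⟨n, ε N n⟩` with `-ε N` a square modulo `q`. -/
theorem not_isSquare_of_del_eq {x : WittGroup ℚ} {N q : ℕ} [hq : Fact q.Prime] (hN : N.Prime)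
    (hqN : q ≠ N) {n ε : ℤ} (hε : IsUnit ε) (hn : Squarefree (N * n))
    (h : del (unary₀ (n : ℚ) + unary₀ ((ε * (N * n) : ℤ) : ℚ)) = del x)
    (hx : delPrime q x ≠ 0) : ¬ IsSquare ((-(ε * N) : ℤ) : ZMod q) := by
  intro hsq
  have hP : Prime (q : ℤ) := Nat.prime_iff_prime_int.1 hq.1
  refine hx ?_
  rw [← (del_eq_iff _ _).1 h ⟨q, hq.1⟩, ← mul_assoc]
  refine delPrime_binary_eq_zero q hn.of_mul_right (fun h' => ?_) hsq
  rcases hP.dvd_mul.1 h' with h' | h'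
  · exact hP.not_isUnit (isUnit_of_dvd_unit h' hε)
  · exact hqN ((Nat.prime_dvd_prime_iff_eq hq.1 hN).1 (by exact_mod_cast h'))

theorem squarefree_intCast_of_nat {n : ℕ} (h : Squarefree n) : Squarefree (n : ℤ) := by
  rwa [← Int.squarefree_natAbs]

theorem squarefree_intCast_mul {p q : ℕ} (hp : p.Prime) (hq : q.Prime) (h : p ≠ q) :
    Squarefree ((p : ℤ) * q) := by
  rw [← Nat.cast_mul]
  exact squarefree_intCast_of_nat ((Nat.squarefree_mul ((Nat.coprime_primes hp hq).2 h)).2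
    ⟨(Nat.prime_iff.1 hp).squarefree, (Nat.prime_iff.1 hq).squarefree⟩)

theorem del_neg_five : del (unary₀ ((-5 : ℤ) : ℚ)) = del (unary₀ ((5 : ℤ) : ℚ)) := by
  refine del_unary₀_neg
    (squarefree_intCast_of_nat (n := 5) (Nat.prime_iff.1 Nat.prime_five).squarefree) fun q hq => ?_
  have h1 : (q : ℕ) ∣ 5 := by exact_mod_cast hq
  obtain rfl : q = ⟨5, by norm_num⟩ :=
    Subtype.ext ((Nat.prime_dvd_prime_iff_eq q.2 (by norm_num)).1 h1)
  exact ⟨(2 : ZMod 5), by decide⟩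

theorem del_neg_ten : del (unary₀ ((-10 : ℤ) : ℚ)) = del (unary₀ ((10 : ℤ) : ℚ)) := by
  refine del_unary₀_neg
    (squarefree_intCast_mul Nat.prime_two Nat.prime_five (by norm_num)) fun q hq => ?_
  have h1 : (q : ℕ) ∣ 2 * 5 := by exact_mod_cast hq
  rcases q.2.dvd_mul.1 h1 with h1 | h1
  · obtain rfl : q = ⟨2, by norm_num⟩ :=
      Subtype.ext ((Nat.prime_dvd_prime_iff_eq q.2 (by norm_num)).1 h1)
    exact ⟨(1 : ZMod 2), by decide⟩
  · obtain rfl : q = ⟨5, by norm_num⟩ :=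
      Subtype.ext ((Nat.prime_dvd_prime_iff_eq q.2 (by norm_num)).1 h1)
    exact ⟨(2 : ZMod 5), by decide⟩

theorem not_isSquare_zmod_five_two : ¬ IsSquare ((-2 : ℤ) : ZMod 5) := by
  unfold IsSquare; decide

theorem not_isSquare_zmod_five_seven : ¬ IsSquare ((-7 : ℤ) : ZMod 5) := by
  unfold IsSquare; decide

theorem not_isSquare_zmod_three_seven : ¬ IsSquare ((-7 : ℤ) : ZMod 3) := by
  unfold IsSquare; decide

theorem not_isSquare_zmod_three_neg_two : ¬ IsSquare ((-(-2) : ℤ) : ZMod 3) := by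
  unfold IsSquare; decide

theorem not_isSquare_zmod_seven_two : ¬ IsSquare ((-2 : ℤ) : ZMod 7) := by
  unfold IsSquare; decide

theorem isSquare_zmod_seven_neg_two : IsSquare ((-(-1 * (2 : ℕ)) : ℤ) : ZMod 7) :=
  ⟨3, by decide⟩

theorem isSquare_zmod_three_two : IsSquare ((-(1 * (2 : ℕ)) : ℤ) : ZMod 3) := ⟨1, by decide⟩

theorem isSquare_zmod_three_neg_seven : IsSquare ((-(-1 * (7 : ℕ)) : ℤ) : ZMod 3) :=
  ⟨1, by decide⟩

/-- At 7 both residues are anisotropic binary forms, -2 being a nonsquare, and there is only one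
such class. At 2 signs are invisible, and no other prime divides 14. -/
theorem del_neg_seven_add_neg_fourteen :
    del (unary₀ ((-7 : ℤ) : ℚ) + unary₀ ((-14 : ℤ) : ℚ)) =
      del (unary₀ ((7 : ℤ) : ℚ) + unary₀ ((14 : ℤ) : ℚ)) := by
  have h7 : Fact (Nat.Prime 7) := ⟨by norm_num⟩
  rw [del_eq_iff]
  intro q
  by_cases hq7 : (q : ℕ) = 7
  · obtain rfl : q = ⟨7, by norm_num⟩ := Subtype.ext hq7
    have e1 := delPrime_binary_of_dvd 7 (m := -1) (d := 2) (by norm_num) (by norm_num)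
    have e2 := delPrime_binary_of_dvd 7 (m := 1) (d := 2) (by norm_num) (by norm_num)
    norm_num at e1 e2 ⊢
    rw [e1, e2]
    have hns := not_isSquare_zmod_seven_two
    push_cast at hns
    refine unary₀_add_unary₀_eq_of_not_isSquare (by norm_num) ?_ ?_
    · simpa using hns
    · simpa using hns
  by_cases hq2 : (q : ℕ) = 2
  · obtain rfl : q = ⟨2, by norm_num⟩ := Subtype.ext hq2
    change delPrime 2 _ = delPrime 2 _
    have e1 : delPrime 2 (unary₀ ((-7 : ℤ) : ℚ)) = 0 := delPrime_unary₀_of_not_dvd (by norm_num)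
    have e2 : delPrime 2 (unary₀ ((7 : ℤ) : ℚ)) = 0 := delPrime_unary₀_of_not_dvd (by norm_num)
    have e3 : delPrime 2 (unary₀ ((-14 : ℤ) : ℚ)) = unary₀ ((-7 : ℤ) : ZMod 2) := by
      rw [show (-14 : ℤ) = (2 : ℕ) * (-7) by norm_num]
      exact delPrime_unary₀_mul (by norm_num)
    have e4 : delPrime 2 (unary₀ ((14 : ℤ) : ℚ)) = unary₀ ((7 : ℤ) : ZMod 2) :=
      delPrime_unary₀_mul (p := 2) (n := 7) (by norm_num)
    rw [map_add, map_add, e1, e2, e3, e4]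
    congr 2
  · have h14 : ¬ ((q : ℕ) : ℤ) ∣ 14 := by
      intro h
      have h1 : (q : ℕ) ∣ 2 * 7 := by exact_mod_cast h
      rcases q.2.dvd_mul.1 h1 with h1 | h1
      · exact hq2 ((Nat.prime_dvd_prime_iff_eq q.2 (by norm_num)).1 h1)
      · exact hq7 ((Nat.prime_dvd_prime_iff_eq q.2 (by norm_num)).1 h1)
    have h7' : ¬ ((q : ℕ) : ℤ) ∣ 7 := fun h => h14 (h.trans (by norm_num))
    rw [map_add, map_add, delPrime_unary₀_of_not_dvd h14, delPrime_unary₀_of_not_dvd h7',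
      delPrime_unary₀_of_not_dvd (by rwa [dvd_neg]), delPrime_unary₀_of_not_dvd (by rwa [dvd_neg])]

/-- In ⟨5, 10⟩ either sign can be changed without affecting the boundary, because -1 is a square
modulo 2 and modulo 5. -/
theorem exists_signatureSet_eq_zero_two_neg_two :
    ∃ B : SymForm ℚ, wittSpan (WittGroup.mk B) = 2 ∧ signatureSet B 2 = {0, 2, -2} := by
  have : Fact (Nat.Prime 5) := ⟨by norm_num⟩
  obtain ⟨B, hB, hmk, hs⟩ := exists_binary (a := 5) (b := 10) (by norm_num) (by norm_num)
  have hw := (wittSpan_binary (q := 5) (d := 2) not_isSquare_zmod_five_two hB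
    (by rw [hmk]; norm_num)).2
  refine ⟨B, hw, signatureSet_two_subset.antisymm ?_⟩
  obtain ⟨C, hC, hCmk, hCs⟩ := exists_binary (a := 5) (b := -10) (by norm_num) (by norm_num)
  obtain ⟨D, hD, hDmk, hDs⟩ := exists_binary (a := -5) (b := -10) (by norm_num) (by norm_num)
  rintro i (rfl | rfl | rfl)
  · have := mem_signatureSet_two hw hC (by rw [hCmk, hmk, map_add, map_add, del_neg_ten])
    rw [hCs] at this
    exact this
  · have := mem_signatureSet_two hw hB rfl
    rw [hs] at this
    exact this
  · have := mem_signatureSet_two hw hD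
      (by rw [hDmk, hmk, map_add, map_add, del_neg_ten, del_neg_five])
    rw [hDs] at this
    exact this

/-- For ⟨7, 14⟩, signature 0 would need a form ⟨n, -2n⟩, whose residue at 7 vanishes because 2 is a
square modulo 7. Both signs can only be changed simultaneously. -/
theorem exists_signatureSet_eq_two_neg_two :
    ∃ B : SymForm ℚ, wittSpan (WittGroup.mk B) = 2 ∧ signatureSet B 2 = {2, -2} := by
  have h7 : Fact (Nat.Prime 7) := ⟨by norm_num⟩
  obtain ⟨B, hB, hmk, hs⟩ := exists_binary (a := 7) (b := 14) (by norm_num) (by norm_num)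
  obtain ⟨hne, hw⟩ := wittSpan_binary (q := 7) (d := 2) not_isSquare_zmod_seven_two hB
    (by rw [hmk]; norm_num)
  refine ⟨B, hw, subset_antisymm (fun i hi => ?_) ?_⟩
  · obtain ⟨n, ε, hε, hn, hdel, rfl⟩ := exists_of_mem_signatureSet_two (N := 2) (c := 7) (e := 1)
      Nat.prime_two isUnit_one (squarefree_intCast_mul Nat.prime_two h7.1 (by norm_num))
      (by rw [hmk]; norm_num) hi
    have hns := not_isSquare_of_del_eq (q := 7) Nat.prime_two (by norm_num) hε hn hdel hne
    have hn0 := hn.of_mul_right.ne_zero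
    rcases Int.isUnit_iff.1 hε with rfl | rfl
    · rcases lt_or_gt_of_ne hn0 with h | h
      · simp [Int.sign_eq_neg_one_of_neg h]
      · simp [Int.sign_eq_one_of_pos h]
    · exact absurd isSquare_zmod_seven_neg_two hns
  · obtain ⟨C, hC, hCmk, hCs⟩ := exists_binary (a := -7) (b := -14) (by norm_num) (by norm_num)
    rintro i (rfl | rfl)
    · have := mem_signatureSet_two hw hB rfl
      rw [hs] at this
      exact this
    · have := mem_signatureSet_two hw hC ?_
      · rw [hCs] at this
        exact this
      rw [hCmk, hmk, del_neg_seven_add_neg_fourteen]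

/-- The form `⟨q, 7q⟩` for a prime `q` modulo which `-7` is not a square. -/
theorem neg_two_notMem_signatureSet {q : ℕ} (hq : q.Prime) (hq7 : q ≠ 7)
    (hns : ¬ IsSquare (-7 : ZMod q)) {B : SymForm ℚ}
    (hB : WittGroup.mk B = unary₀ ((q : ℤ) : ℚ) + unary₀ ((1 * ((7 : ℕ) * q) : ℤ) : ℚ)) :
    -2 ∉ signatureSet B 2 := by
  intro hi
  have hsf : Squarefree (((7 : ℕ) : ℤ) * q) :=
    squarefree_intCast_mul (by norm_num) hq (Ne.symm hq7)
  obtain ⟨n, ε, hε, hn, hdel, hs⟩ := exists_of_mem_signatureSet_two (N := 7) (c := q) (e := 1)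
    (by norm_num) isUnit_one hsf hB hi
  -- The signature (1 + ε) sign n is -2 only for ε = 1 and n negative.
  have hneg : n < 0 ∧ ε = 1 := by
    rcases Int.isUnit_iff.1 hε with rfl | rfl
    · refine ⟨?_, rfl⟩
      by_contra h
      rcases (not_lt.1 h).eq_or_lt with h | h
      · simp [← h] at hs
      · simp [Int.sign_eq_one_of_pos h] at hs
    · omega
  obtain ⟨hneg, rfl⟩ := hneg
  refine false_of_del_eq_neg hq hq7 hns hn hneg ?_
  rw [hB] at hdel
  simpa using hdel

/-- For ⟨3, -6⟩, signature ±2 would need a form ⟨n, 2n⟩, whose residue at 3 vanishes because -2 is a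
square modulo 3. -/
theorem exists_signatureSet_eq_zero :
    ∃ B : SymForm ℚ, wittSpan (WittGroup.mk B) = 2 ∧ signatureSet B 2 = {0} := by
  have h3 : Fact (Nat.Prime 3) := ⟨by norm_num⟩
  obtain ⟨B, hB, hmk, hs⟩ := exists_binary (a := 3) (b := -6) (by norm_num) (by norm_num)
  obtain ⟨hne, hw⟩ := wittSpan_binary (q := 3) (d := -2) not_isSquare_zmod_three_neg_two hB
    (by rw [hmk]; norm_num)
  refine ⟨B, hw, subset_antisymm (fun i hi => ?_) ?_⟩
  · obtain ⟨n, ε, hε, hn, hdel, rfl⟩ := exists_of_mem_signatureSet_two (N := 2) (c := 3) (e := -1)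
      Nat.prime_two isUnit_one.neg (squarefree_intCast_mul Nat.prime_two h3.1 (by norm_num))
      (by rw [hmk]; norm_num) hi
    have hns := not_isSquare_of_del_eq (q := 3) Nat.prime_two (by norm_num) hε hn hdel hne
    rcases Int.isUnit_iff.1 hε with rfl | rfl
    · exact absurd isSquare_zmod_three_two hns
    · simp
  · rintro i rfl
    have := mem_signatureSet_two hw hB rfl
    rw [hs] at this
    exact this

/-- For ⟨3, 21⟩, signature 0 would need ⟨n, -7n⟩, which is excluded at 3 since 7 is a square there;
-2 is excluded by reciprocity, -7 being a nonsquare modulo 3. -/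
theorem exists_signatureSet_eq_two :
    ∃ B : SymForm ℚ, wittSpan (WittGroup.mk B) = 2 ∧ signatureSet B 2 = {2} := by
  have h3 : Fact (Nat.Prime 3) := ⟨by norm_num⟩
  obtain ⟨B, hB, hmk, hs⟩ := exists_binary (a := 3) (b := 21) (by norm_num) (by norm_num)
  obtain ⟨hne, hw⟩ := wittSpan_binary (q := 3) (d := 7) not_isSquare_zmod_three_seven hB
    (by rw [hmk]; norm_num)
  refine ⟨B, hw, subset_antisymm (fun i hi => ?_) ?_⟩
  · have h2 : i ≠ -2 := by
      rintro rfl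
      exact neg_two_notMem_signatureSet (q := 3) (by norm_num) (by norm_num)
        (by simpa using not_isSquare_zmod_three_seven) (by rw [hmk]; norm_num) hi
    have h0 : i ≠ 0 := by
      rintro h0
      obtain ⟨n, ε, hε, hn, hdel, h⟩ := exists_of_mem_signatureSet_two (N := 7) (c := 3) (e := 1)
        (by norm_num) isUnit_one (squarefree_intCast_mul (p := 7) (by norm_num) h3.1 (by norm_num))
        (by rw [hmk]; norm_num) hi
      have hns := not_isSquare_of_del_eq (q := 3) (by norm_num) (by norm_num) hε hn hdel hne
      have hn0 := hn.of_mul_right.ne_zero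
      rcases Int.isUnit_iff.1 hε with rfl | rfl
      · rw [h0, one_mul] at h
        have := Int.sign_eq_zero_iff_zero.1 (show n.sign = 0 by omega)
        exact hn0 this
      · exact hns isSquare_zmod_three_neg_seven
    have := signatureSet_two_subset hi
    simp only [Set.mem_insert_iff, Set.mem_singleton_iff] at this ⊢
    tauto
  · rintro i rfl
    have := mem_signatureSet_two hw hB rfl
    rw [hs] at this
    exact this

/-- For ⟨5, 35⟩ the sign of 5 can be changed, -1 being a square modulo 5, while reciprocity excludes
-2 since -7 is a nonsquare modulo 5. -/
theorem exists_signatureSet_eq_zero_two :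
    ∃ B : SymForm ℚ, wittSpan (WittGroup.mk B) = 2 ∧ signatureSet B 2 = {0, 2} := by
  have h5 : Fact (Nat.Prime 5) := ⟨by norm_num⟩
  obtain ⟨B, hB, hmk, hs⟩ := exists_binary (a := 5) (b := 35) (by norm_num) (by norm_num)
  obtain ⟨hne, hw⟩ := wittSpan_binary (q := 5) (d := 7) not_isSquare_zmod_five_seven hB
    (by rw [hmk]; norm_num)
  refine ⟨B, hw, subset_antisymm (fun i hi => ?_) ?_⟩
  · have h2 : i ≠ -2 := by
      rintro rfl
      exact neg_two_notMem_signatureSet (q := 5) (by norm_num) (by norm_num)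
        (by simpa using not_isSquare_zmod_five_seven) (by rw [hmk]; norm_num) hi
    have := signatureSet_two_subset hi
    simp only [Set.mem_insert_iff, Set.mem_singleton_iff] at this ⊢
    tauto
  · obtain ⟨C, hC, hCmk, hCs⟩ := exists_binary (a := -5) (b := 35) (by norm_num) (by norm_num)
    rintro i (rfl | rfl)
    · have := mem_signatureSet_two hw hC (by rw [hCmk, hmk, map_add, map_add, del_neg_five])
      rw [hCs] at this
      exact this
    · have := mem_signatureSet_two hw hB rfl
      rw [hs] at this
      exact this

theorem exists_signatureSet_neg {S : Set ℤ}
    (h : ∃ B : SymForm ℚ, wittSpan (WittGroup.mk B) = 2 ∧ signatureSet B 2 = S) :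
    ∃ B : SymForm ℚ, wittSpan (WittGroup.mk B) = 2 ∧ signatureSet B 2 = -S := by
  obtain ⟨B, h1, h2⟩ := h
  refine ⟨B.neg, (wittSpan_neg B).trans h1, Set.ext fun i => ?_⟩
  rw [mem_signatureSet_neg, h2, Set.mem_neg]

/-- Five subsets come from the explicit examples; {0, -2} and {-2} follow by replacing B with -B. -/
theorem exists_signatureSet_eq {S : Set ℤ} (hS : S ⊆ {0, 2, -2}) (hne : S.Nonempty) :
    ∃ B : SymForm ℚ, wittSpan (WittGroup.mk B) = 2 ∧ signatureSet B 2 = S := by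
  have hext : ∀ T : Set ℤ, T ⊆ {0, 2, -2} → (0 ∈ S ↔ 0 ∈ T) → (2 ∈ S ↔ 2 ∈ T) →
      (-2 ∈ S ↔ -2 ∈ T) → S = T := by
    intro T hT h0 h2 h2'
    ext i
    constructor
    · intro hi
      rcases hS hi with rfl | rfl | rfl <;> tauto
    · intro hi
      rcases hT hi with rfl | rfl | rfl <;> tauto
  by_cases h0 : (0 : ℤ) ∈ S <;> by_cases h2 : (2 : ℤ) ∈ S <;> by_cases h3 : (-2 : ℤ) ∈ S
  · rw [hext {0, 2, -2} subset_rfl (by simp [h0]) (by simp [h2]) (by simp [h3])]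
    exact exists_signatureSet_eq_zero_two_neg_two
  · rw [hext {0, 2} (by simp [Set.insert_subset_iff]) (by simp [h0]) (by simp [h2])
      (by simp [h3])]
    exact exists_signatureSet_eq_zero_two
  · rw [hext (-{0, 2}) (by simp [Set.insert_subset_iff]) (by simp [h0]) (by simp [h2])
      (by simp [h3])]
    exact exists_signatureSet_neg exists_signatureSet_eq_zero_two
  · rw [hext {0} (by simp) (by simp [h0]) (by simp [h2]) (by simp [h3])]
    exact exists_signatureSet_eq_zero
  · rw [hext {2, -2} (by simp) (by simp [h0]) (by simp [h2]) (by simp [h3])]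
    exact exists_signatureSet_eq_two_neg_two
  · rw [hext {2} (by simp) (by simp [h0]) (by simp [h2]) (by simp [h3])]
    exact exists_signatureSet_eq_two
  · rw [hext (-{2}) (by simp) (by simp [h0]) (by simp [h2]) (by simp [h3])]
    exact exists_signatureSet_neg exists_signatureSet_eq_two
  · obtain ⟨i, hi⟩ := hne
    rcases hS hi with rfl | rfl | rfl <;> contradiction

end Realization

end

theorem theorem3p3 :
    (∀ B : SymForm ℚ,
      -- (i)
      (wittSpan (WittGroup.mk B) = 0 ↔ del (WittGroup.mk B) = 0) ∧
      -- (ii)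
      (wittSpan (WittGroup.mk B) = 1 ↔
        (signatureSet B 1).Nonempty ∧ del (WittGroup.mk B) ≠ 0) ∧
      -- (iii)
      (wittSpan (WittGroup.mk B) = 2 ↔
        (signatureSet B 2).Nonempty ∧
          ∀ i ∈ signatureSet B 2, ∀ A : SymForm ℚ, IsPreimageForm B 2 i A →
            (A.sum (SymForm.unary 1)).Anisotropic ∧ (A.sum (SymForm.unary (-1))).Anisotropic) ∧
      signatureSet B 2 ⊆ {0, 2, -2} ∧
      -- (iv)
      (wittSpan (WittGroup.mk B) = 3 ↔
        signatureSet B 3 = {1, -1, 3, -3} ∧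
          ∀ i ∈ signatureSet B 3, ∀ A : SymForm ℚ, IsPreimageForm B 3 i A →
            (A.sum (SymForm.unary 1)).Anisotropic ∧ (A.sum (SymForm.unary (-1))).Anisotropic)) ∧
    -- every non-empty subset of `{0, 2, -2}` occurs as `I_2` in case (iii)
    (∀ S : Set ℤ, S ⊆ {0, 2, -2} → S.Nonempty →
      ∃ B : SymForm ℚ, wittSpan (WittGroup.mk B) = 2 ∧ signatureSet B 2 = S) := by
  exact ⟨fun B => ⟨wittSpan_eq_zero_iff _, wittSpan_eq_one_iff, wittSpan_eq_two_iff,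
    signatureSet_two_subset, wittSpan_eq_three_iff⟩, fun S => exists_signatureSet_eq⟩
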